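/- Let $q\in(0,1)$ and $0\le\nu\le\mu<1$. Write $(a;q)_m=\prod_{i=0}^{m-1}(1-aq^i)$ and $(a;q)_\infty=\prod_{i\ge0}(1-aq^i)$, and for $0\le j\le m$ put $$\varphi(j|m)=\mu^j\frac{(\nu/\mu;q)_j(\mu;q)_{m-j}}{(\nu;q)_m}\,\frac{(q;q)_m}{(q;q)_j(q;q)_{m-j}},\qquad \varphi(j|+\infty)=\mu^j\frac{(\nu/\mu;q)_j(\mu;q)_\infty}{(\nu;q)_\infty}\,\frac1{(q;q)_j}$$ (for $\mu=\nu=0$, $\nu/\mu$ is read as $0$, so that $\varphi(0|\cdot)=1$). The $N$-particle $(q,\mu,\nu)$-TASEP is the discrete time Markov chain of particle positions $x_1(t)>\dots>x_N(t)$ in $\mathbb Z$ in which, at each time step, all particles move in parallel and independently given the present configuration, $x_i(t+1)=x_i(t)+j_i$ with $j_i$ distributed according to $\varphi(\cdot\,|\,x_{i-1}(t)-x_i(t)-1)$, where $x_0=+\infty$. Start it from step initial data $x_i(0)=-i$. Then for every time $t\in\mathbb Z_{\ge0}$, every $1\le n\le N$ and every $\zeta\in\mathbb C\setminus[0,\infty)$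 the law of the process at time $t$ is a probability measure, the expectation below exists, and the following two formulas hold, where $$g(w)=\left(\frac{(\nu w;q)_\infty}{(w;q)_\infty}\right)^n\left(\frac{(\mu w;q)_\infty}{(\nu w;q)_\infty}\right)^t\frac1{(\nu w;q)_\infty}.$$ For a kernel $K$ on a positively oriented circle $C$, the Fredholm determinant is $$\det(I+K)=1+\sum_{k\ge1}\frac1{k!}\oint_C\!\cdots\oint_C\det[K(w_a,w_b)]_{a,b=1}^k\prod_{a=1}^k\frac{dw_a}{2\pi i}.$$ (1) (Mellin–Barnes type.) Let $C_1$ be a positively oriented circle with $1$ in its interior, such that $0$, $1/q$ and (if $\nu\neq0$) $1/\nu$ lie neither on nor inside it, and small enough that $\sqrt q\,|w|<|w'|$ for all $w,w'\in C_1$. Then $$\mathbb E\left[\frac1{(\zeta q^{x_n(t)+n};q)_\infty}\right]=\det(I+K_\zeta),\qquad K_\zeta(w,w')=\frac1{2\pi i}\int_{1/2-i\infty}^{1/2+i\infty}\frac{\pi}{\sin(-\pi s)}(-\zeta)^s\frac{g(w)}{g(q^sw)}\frac{ds}{q^sw-w'}$$ on $C_1$, where $(-\zeta)^s$ is the principal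 branch. (2) (Cauchy type.) Let $C_{0,1}$ be a positively oriented circle with $0$ and $1$ in its interior, such that (if $\nu\ne0$) $1/\nu$ lies neither on nor inside it. Then $$\mathbb E\left[\frac1{(\zeta q^{x_n(t)+n};q)_\infty}\right]=\frac{\det(I+\zeta\tilde K)}{(\zeta;q)_\infty},\qquad \tilde K(w,w')=\frac{g(w)/g(qw)}{qw'-w}$$ on $C_{0,1}$. In both cases the kernel is square integrable on the product of the circle with itself, and all the integrals and the series above converge absolutely. -/

import Mathlib

open MeasureTheory

noncomputable section

/-- The finite `q`-Pochhammer symbol `(a;q)_n = ∏_{i=0}^{n-1} (1 - a q^i)`. -/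
def qPoch {R : Type*} [CommRing R] (a q : R) (n : ℕ) : R :=
  ∏ i ∈ Finset.range n, (1 - a * q ^ i)

/-- The infinite `q`-Pochhammer symbol `(a;q)_∞ = ∏_{i=0}^∞ (1 - a q^i)`. -/
def qPochInf {R : Type*} [CommRing R] [TopologicalSpace R] (a q : R) : R :=
  ∏' i : ℕ, (1 - a * q ^ i)

/-! ### The `(q,μ,ν)`-TASEP -/

/-- The jump distribution `φ_{q,μ,ν}(j|m)` for a finite gap `m`; it vanishes for `j > m`.
For `μ = 0` (hence `ν = 0`), Lean's `ν / μ = 0` gives `φ(0|m) = 1`, the limit as `μ → 0`. -/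
def jumpProb (q μ ν : ℝ) (m j : ℕ) : ℝ :=
  if j ≤ m then
    μ ^ j * (qPoch (ν / μ) q j * qPoch μ q (m - j) / qPoch ν q m) *
      (qPoch q q m / (qPoch q q j * qPoch q q (m - j)))
  else 0

/-- The jump distribution `φ_{q,μ,ν}(j|+∞)`. -/
def jumpProbTop (q μ ν : ℝ) (j : ℕ) : ℝ :=
  μ ^ j * (qPoch (ν / μ) q j * qPochInf μ q / qPochInf ν q) * (1 / qPoch q q j)

/-- A configuration of `N` particles; the entry with index `i` is the position of the particle
labelled `i + 1`, so that the leading particle has index `0`. The chain only visits strictly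
decreasing configurations. -/
abbrev Config (N : ℕ) : Type := Fin N → ℤ

/-- The probability that in one time step, from configuration `x`, the particle with index `i`
jumps by `j`: the leading particle sees an infinite gap, the others the number of empty sites up to
the preceding particle. -/
def particleJumpProb (q μ ν : ℝ) {N : ℕ} (x : Config N) (i : Fin N) (j : ℕ) : ℝ :=
  if i.val = 0 then jumpProbTop q μ ν j
  else jumpProb q μ ν (x ⟨i.val - 1, lt_of_le_of_lt (Nat.sub_le _ _) i.isLt⟩ - x i - 1).toNat j

/-- The one-step transition probability of the `N`-particle `(q,μ,ν)`-TASEP from `x` to `y`: all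
particles jump to the right, in parallel and independently given `x`. -/
def tasepStep (q μ ν : ℝ) {N : ℕ} (x y : Config N) : ℝ :=
  ∏ i : Fin N, if x i ≤ y i then particleJumpProb q μ ν x i (y i - x i).toNat else 0

/-- Step initial data: the particle labelled `n` starts at `-n`. -/
def stepConfig (N : ℕ) : Config N := fun i => -((i.val : ℤ) + 1)

/-- The probability that the `(q,μ,ν)`-TASEP with step initial data is in configuration `y` at
time `t`. -/
def tasepMass (q μ ν : ℝ) (N : ℕ) : ℕ → Config N → ENNReal
  | 0, y => if y = stepConfig N then 1 else 0
  | t + 1, y => ∑' x : Config N, tasepMass q μ ν N t x * ENNReal.ofReal (tasepStep q μ ν x y)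

/-- The law of the configuration `(x_1(t), …, x_N(t))` of the `N`-particle `(q,μ,ν)`-TASEP at
time `t`, started from step initial data. -/
def tasepLaw (q μ ν : ℝ) (N t : ℕ) : Measure (Config N) :=
  Measure.sum fun x : Config N => tasepMass q μ ν N t x • Measure.dirac x

/-! ### Fredholm determinants on circles -/

/-- The `k`-th term
`(1/k!) ∮ ⋯ ∮ det[K(w_a, w_b)]_{a,b=1}^k dw_1/(2πi) ⋯ dw_k/(2πi)` of the Fredholm determinant of
the kernel `K` on the positively oriented circle of centre `c` and radius `r`, which carries the
(complex) measure `dw/(2πi)`. -/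
def fredholmTerm (K : ℂ → ℂ → ℂ) (c : ℂ) (r : ℝ) (k : ℕ) : ℂ :=
  ((k.factorial : ℂ))⁻¹ * ((2 * (Real.pi : ℂ) * Complex.I)⁻¹) ^ k *
    torusIntegral (fun w : Fin k → ℂ => Matrix.det (Matrix.of fun a b => K (w a) (w b)))
      (fun _ => c) (fun _ => r)

/-- The Fredholm determinant
`det(I + K) = 1 + ∑_{k ≥ 1} (1/k!) ∮ ⋯ ∮ det[K(w_a, w_b)]_{a,b=1}^k ∏_a dw_a/(2πi)`
of the integral operator `(Kf)(w) = ∮ K(w,w') f(w') dw'/(2πi)` on the positively oriented circle of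
centre `c` and radius `r` (the term `k = 0` is `1`). -/
def fredholmDet (K : ℂ → ℂ → ℂ) (c : ℂ) (r : ℝ) : ℂ :=
  ∑' k : ℕ, fredholmTerm K c r k

/-- The Fredholm determinant of `K` on the circle of centre `c` and radius `r` is well defined: `K`
is square integrable on the circle times itself (so that it is the kernel of an operator on `L²` of
the circle), and the integrals and the series in `fredholmDet` converge absolutely. -/
structure HasFredholmDet (K : ℂ → ℂ → ℂ) (c : ℂ) (r : ℝ) : Prop where
  memLp : MemLp (fun θ : ℝ × ℝ => K (circleMap c r θ.1) (circleMap c r θ.2)) 2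
    (volume.restrict (Set.Icc 0 (2 * Real.pi) ×ˢ Set.Icc 0 (2 * Real.pi)))
  integrable : ∀ k : ℕ,
    TorusIntegrable (fun w : Fin k → ℂ => Matrix.det (Matrix.of fun a b => K (w a) (w b)))
      (fun _ => c) (fun _ => r)
  summable : Summable (fredholmTerm K c r)

/-! ### The kernels -/

/-- `g(w) = ((νw;q)_∞/(w;q)_∞)^n ((μw;q)_∞/(νw;q)_∞)^t / (νw;q)_∞`. -/
def gFun (q μ ν : ℝ) (n t : ℕ) (w : ℂ) : ℂ :=
  (qPochInf (ν * w) (q : ℂ) / qPochInf w (q : ℂ)) ^ n *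
    (qPochInf (μ * w) (q : ℂ) / qPochInf (ν * w) (q : ℂ)) ^ t *
    (1 / qPochInf (ν * w) (q : ℂ))

/-- The integrand
`π / sin(-πs) · (-ζ)^s · g(w)/g(q^s w) · 1/(q^s w - w')`, with the principal branch of `(-ζ)^s`. -/
def mbIntegrand (q μ ν : ℝ) (n t : ℕ) (ζ w w' s : ℂ) : ℂ :=
  (Real.pi : ℂ) / Complex.sin (-(Real.pi : ℂ) * s) * (-ζ) ^ s *
    (gFun q μ ν n t w / gFun q μ ν n t ((q : ℂ) ^ s * w)) *
    (1 / ((q : ℂ) ^ s * w - w'))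

/-- The Mellin–Barnes kernel
`K_ζ(w,w') = (1/2πi) ∫_{1/2-i∞}^{1/2+i∞} mbIntegrand ds`, along `s = 1/2 + iy`, `ds = i dy`. -/
def mbKernel (q μ ν : ℝ) (n t : ℕ) (ζ w w' : ℂ) : ℂ :=
  1 / (2 * (Real.pi : ℂ) * Complex.I) *
    ∫ y : ℝ, mbIntegrand q μ ν n t ζ w w' (1 / 2 + y * Complex.I) * Complex.I

/-- The Cauchy type kernel `K̃(w,w') = (g(w)/g(qw)) / (qw' - w)`. -/
def cauchyKernel (q μ ν : ℝ) (n t : ℕ) (w w' : ℂ) : ℂ :=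
  (gFun q μ ν n t w / gFun q μ ν n t ((q : ℂ) * w)) / ((q : ℂ) * w' - w)

/-- The observable `1 / (ζ q^{x_n + n}; q)_∞`, where `m = x_n + n`. -/
def eqObservable (q : ℝ) (ζ : ℂ) (m : ℤ) : ℂ :=
  1 / qPochInf (ζ * (q : ℂ) ^ m) (q : ℂ)

end

/-!
The proof computes the `q`-factorial moments of `q^{x_n(t)+n}`, sums them to a Fredholm determinant,
which is the Cauchy type formula, and deduces the Mellin–Barnes formula by comparing finite
sections.

**Moments.** Let `k` dual particles sit at the sites `n_0 ≥ ⋯ ≥ n_{k-1}` and consider the observable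
`∏_j (q^{x_{n_j}+n_j} - q^j)`. The jump distribution has `q`-factorial moments proportional to those
of a point mass at the gap (`sum_jumpWeight_mul_qPow_pow`), and therefore the average of the
observable over the jump of one particle that carries a cluster of `m` dual particles is the average
over a number `s` of dual particles that move to the site ahead, where `s` has the distribution
`φ(s|m)` (`HasQGap.hasSum_qPow`). Performing a step of the chain cluster by cluster gives the
recursion `meanObs_cluster`. The nested contour integrals `stepInt` satisfy the same recursion: for
a cluster of equal factors, antisymmetry (`torusAvg_exchange`) allows one to replace the integration
variables by a geometric progression (`nestedInt_cluster`), and what is left is the scalar identity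
`sum_jumpWeight_mul_qPoch`. The boundary conditions agree as well, by residues at `0` and at
infinity, and hence the expectations are the integrals (`meanObs_eq_stepInt`).

**The Cauchy type formula.** If all `n_j` are equal to `n`, the integrand may be symmetrized; its
symmetrization is a Cauchy determinant (`det_inv_sub_mul`, `sum_perm_crossWeight`), so that the
`k`-th term of `det(I + ζK̃)` is the `k`-th `q`-factorial moment times `ζ^k/(q;q)_k`
(`fredholmTerm_gRatio`). As `q^{x_n+n}` is a power `q^m` with a natural exponent, the finite
`q`-binomial theorem sums the series to `(ζ;q)_m = (ζ;q)_∞ / (ζq^m;q)_∞`, for all `ζ`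
(`hasSum_integral_qPow`).

**The Mellin–Barnes formula.** Expanding `1/g(z) · 1/(w'-z)` in powers of `z` turns both kernels
into separable kernels `∑_j d_j w^j g(w) v_j(w')` with the same functions `v_j`. For the
Mellin–Barnes kernel, where `z = q^s w`, the integral over `s` gives `d_j = -ζq^j/(1-ζq^j)`
(`mbKernel_expansion`); for the transposed Cauchy type kernel on a large circle around `0`, where `z
= qw`, one has `d_j = -ζq^j`. The Fredholm determinant of a separable kernel is the limit of its
finite sections `det(1 + (∮ v_i u_j)_{i,j<M})` (`hasFredholmDet_separable`). The pole of the
integrand at `0` makes the integrals `∮ v_i w^j g` over the two circles differ by exactly `δ_{ij}`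
(`circleAvg_polarPart`), and consequently the finite sections differ by the factor `∏_{j<M}
(1-ζq^j)`, which tends to `(ζ;q)_∞` (`hasFredholmDet_mbKernel`).
-/

noncomputable section

open Finset Filter Topology ProbabilityTheory

/-! ### Finite `q`-series identities -/

theorem qPoch_zero {R : Type*} [CommRing R] (a q : R) : qPoch a q 0 = 1 := by simp [qPoch]

theorem qPoch_succ {R : Type*} [CommRing R] (a q : R) (n : ℕ) :
    qPoch a q (n + 1) = qPoch a q n * (1 - a * q ^ n) := by
  simp [qPoch, prod_range_succ]

theorem qPoch_add {R : Type*} [CommRing R] (a q : R) (m n : ℕ) :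
    qPoch a q (m + n) = qPoch a q m * qPoch (a * q ^ m) q n := by
  simp only [qPoch, prod_range_add, mul_assoc, ← pow_add]

/-- The homogeneous `q`-power `P_n(x, y) = ∏_{i<n} (x - q^i y)`. -/
def qPow {R : Type*} [CommRing R] (q x y : R) (n : ℕ) : R :=
  ∏ i ∈ range n, (x - q ^ i * y)

theorem qPow_zero {R : Type*} [CommRing R] (q x y : R) : qPow q x y 0 = 1 := by simp [qPow]

theorem qPow_succ {R : Type*} [CommRing R] (q x y : R) (n : ℕ) :
    qPow q x y (n + 1) = qPow q x y n * (x - q ^ n * y) := by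
  simp [qPow, prod_range_succ]

theorem qPow_add {R : Type*} [CommRing R] (q x y : R) (m n : ℕ) :
    qPow q x y (m + n) = qPow q x y m * qPow q x (q ^ m * y) n := by
  simp only [qPow, prod_range_add, pow_add]
  congr 1
  exact prod_congr rfl fun i _ => by ring

theorem qPow_mul_left {R : Type*} [CommRing R] (q c x y : R) (n : ℕ) :
    qPow q (c * x) (c * y) n = c ^ n * qPow q x y n := by
  simp only [qPow]
  rw [← card_range n, ← prod_const, card_range, ← prod_mul_distrib]
  exact prod_congr rfl fun i _ => by ring

/-- Summing over triples `k + l + a = m`, grouping either `k, l` or `l, a`. -/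
theorem sum_antidiagonal_assoc {M : Type*} [AddCommMonoid M] (f : ℕ → ℕ → ℕ → M) (m : ℕ) :
    ∑ p ∈ antidiagonal m, ∑ r ∈ antidiagonal p.1, f r.1 r.2 p.2 =
      ∑ p ∈ antidiagonal m, ∑ r ∈ antidiagonal p.2, f p.1 r.1 r.2 := by
  rw [sum_sigma', sum_sigma']
  refine sum_nbij' (fun x => ⟨(x.2.1, x.2.2 + x.1.2), (x.2.2, x.1.2)⟩)
    (fun x => ⟨(x.1.1 + x.2.1, x.2.2), (x.1.1, x.2.1)⟩) ?_ ?_ ?_ ?_ ?_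
  · rintro ⟨⟨a, b⟩, ⟨c, d⟩⟩ h
    simp only [mem_sigma, HasAntidiagonal.mem_antidiagonal] at h ⊢
    obtain ⟨h1, h2⟩ := h
    exact ⟨by omega, trivial⟩
  · rintro ⟨⟨a, b⟩, ⟨c, d⟩⟩ h
    simp only [mem_sigma, HasAntidiagonal.mem_antidiagonal] at h ⊢
    obtain ⟨h1, h2⟩ := h
    exact ⟨by omega, trivial⟩
  · rintro ⟨⟨a, b⟩, ⟨c, d⟩⟩ h
    simp only [mem_sigma, HasAntidiagonal.mem_antidiagonal] at h
    obtain ⟨h1, h2⟩ := h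
    subst h2
    rfl
  · rintro ⟨⟨a, b⟩, ⟨c, d⟩⟩ h
    simp only [mem_sigma, HasAntidiagonal.mem_antidiagonal] at h
    obtain ⟨h1, h2⟩ := h
    subst h2
    rfl
  · rintro ⟨⟨a, b⟩, ⟨c, d⟩⟩ _
    rfl

section Field

variable {K : Type*} [Field K] {q : K}

/-- The `q`-Pascal rule for sums over `k + l = n + 1` weighted by `1 / ((q;q)_k (q;q)_l)`, from the
splitting `1 - q^{n+1} = (1 - q^k) + q^k (1 - q^l)`. -/
theorem pascal_antidiagonal (hq : ∀ n, qPoch q q n ≠ 0) (f : ℕ → ℕ → K) (n : ℕ) :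
    (1 - q ^ (n + 1)) *
        ∑ p ∈ antidiagonal (n + 1), f p.1 p.2 / (qPoch q q p.1 * qPoch q q p.2) =
      ∑ p ∈ antidiagonal n,
        (f (p.1 + 1) p.2 + q ^ p.1 * f p.1 (p.2 + 1)) / (qPoch q q p.1 * qPoch q q p.2) := by
  have h0 : ∀ k, 1 - q * q ^ k ≠ 0 := fun k h => hq (k + 1) (by rw [qPoch_succ, h, mul_zero])
  have key : (1 - q ^ (n + 1)) *
        ∑ p ∈ antidiagonal (n + 1), f p.1 p.2 / (qPoch q q p.1 * qPoch q q p.2) =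
      ∑ p ∈ antidiagonal (n + 1),
          (1 - q ^ p.1) * f p.1 p.2 / (qPoch q q p.1 * qPoch q q p.2) +
        ∑ p ∈ antidiagonal (n + 1),
          q ^ p.1 * (1 - q ^ p.2) * f p.1 p.2 / (qPoch q q p.1 * qPoch q q p.2) := by
    rw [mul_sum, ← sum_add_distrib]
    refine sum_congr rfl fun p hp => ?_
    rw [← HasAntidiagonal.mem_antidiagonal.mp hp, pow_add]
    ring
  rw [key, Nat.sum_antidiagonal_succ, Nat.sum_antidiagonal_succ']
  simp only [pow_zero, sub_self, zero_mul, zero_div, mul_zero, zero_add]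
  rw [← sum_add_distrib]
  refine sum_congr rfl fun p _ => ?_
  have h1 := h0 p.1
  have h2 := h0 p.2
  have h3 := hq p.1
  have h4 := hq p.2
  rw [qPoch_succ, qPoch_succ, pow_succ', pow_succ']
  field_simp

/-- The `q`-Pascal rule from the splitting `1 - q^{n+1} = q^l (1 - q^k) + (1 - q^l)`. -/
theorem pascal_antidiagonal' (hq : ∀ n, qPoch q q n ≠ 0) (f : ℕ → ℕ → K) (n : ℕ) :
    (1 - q ^ (n + 1)) *
        ∑ p ∈ antidiagonal (n + 1), f p.1 p.2 / (qPoch q q p.1 * qPoch q q p.2) =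
      ∑ p ∈ antidiagonal n,
        (q ^ p.2 * f (p.1 + 1) p.2 + f p.1 (p.2 + 1)) / (qPoch q q p.1 * qPoch q q p.2) := by
  have h := pascal_antidiagonal hq (fun k l => f l k) n
  rw [← Nat.sum_antidiagonal_swap, ← Nat.sum_antidiagonal_swap (n := n)] at h
  simp only [Prod.fst_swap, Prod.snd_swap] at h
  simp only [add_comm (q ^ _ * _)]
  simpa only [mul_comm (qPoch q q _) (qPoch q q _)] using h

theorem one_sub_pow_succ_ne_zero (hq : ∀ n, qPoch q q n ≠ 0) (n : ℕ) : 1 - q ^ (n + 1) ≠ 0 :=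
  fun h => hq (n + 1) (by rw [qPoch_succ, ← pow_succ', h, mul_zero])

/-- The `q`-Chu–Vandermonde sum, in the form stating that the jump distribution has mass one. -/
theorem sum_antidiagonal_qPoch (hq : ∀ n, qPoch q q n ≠ 0) (μ ρ : K) (n : ℕ) :
    ∑ p ∈ antidiagonal n,
        μ ^ p.1 * qPoch ρ q p.1 * qPoch μ q p.2 / (qPoch q q p.1 * qPoch q q p.2) =
      qPoch (μ * ρ) q n / qPoch q q n := by
  induction n with
  | zero => simp [qPoch]
  | succ n ih =>
    have h := pascal_antidiagonal' hq (fun k l => μ ^ k * qPoch ρ q k * qPoch μ q l) n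
    have h1 := one_sub_pow_succ_ne_zero hq n
    rw [← mul_right_inj' h1, h]
    have : ∀ p ∈ antidiagonal n,
        (q ^ p.2 * (μ ^ (p.1 + 1) * qPoch ρ q (p.1 + 1) * qPoch μ q p.2) +
          μ ^ p.1 * qPoch ρ q p.1 * qPoch μ q (p.2 + 1)) / (qPoch q q p.1 * qPoch q q p.2) =
        (1 - μ * ρ * q ^ n) *
          (μ ^ p.1 * qPoch ρ q p.1 * qPoch μ q p.2 / (qPoch q q p.1 * qPoch q q p.2)) := by
      intro p hp
      rw [← HasAntidiagonal.mem_antidiagonal.mp hp, qPoch_succ, qPoch_succ, pow_add]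
      ring
    rw [sum_congr rfl this, ← mul_sum, ih, qPoch_succ, qPoch_succ]
    have h2 := hq n
    rw [← pow_succ']
    field_simp

/-- The addition formula of Goldman and Rota for the homogeneous `q`-powers. -/
theorem sum_antidiagonal_qPow (hq : ∀ n, qPoch q q n ≠ 0) (x y z : K) (n : ℕ) :
    ∑ p ∈ antidiagonal n,
        qPow q x y p.1 * qPow q y z p.2 / (qPoch q q p.1 * qPoch q q p.2) =
      qPow q x z n / qPoch q q n := by
  induction n with
  | zero => simp [qPoch, qPow]
  | succ n ih =>
    have h := pascal_antidiagonal hq (fun k l => qPow q x y k * qPow q y z l) n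
    have h1 := one_sub_pow_succ_ne_zero hq n
    rw [← mul_right_inj' h1, h]
    have : ∀ p ∈ antidiagonal n,
        (qPow q x y (p.1 + 1) * qPow q y z p.2 +
          q ^ p.1 * (qPow q x y p.1 * qPow q y z (p.2 + 1))) / (qPoch q q p.1 * qPoch q q p.2) =
        (x - q ^ n * z) *
          (qPow q x y p.1 * qPow q y z p.2 / (qPoch q q p.1 * qPoch q q p.2)) := by
      intro p hp
      rw [← HasAntidiagonal.mem_antidiagonal.mp hp, qPow_succ, qPow_succ, pow_add]
      ring
    rw [sum_congr rfl this, ← mul_sum, ih, qPow_succ, qPoch_succ]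
    have h2 := hq n
    rw [← pow_succ']
    field_simp

/-- The coefficient `∏_{i<k} q^i (a q^i - y)` of the expansion of `(y;q)_n` in the shifted
symbols `(a q^k;q)_{n-k}`. -/
def shiftCoeff (q a y : K) (k : ℕ) : K := ∏ i ∈ range k, q ^ i * (a * q ^ i - y)

/-- The expansion of `(y;q)_n` in the shifted symbols `(a q^k;q)_{n-k}`. -/
theorem sum_antidiagonal_shiftCoeff (hq : ∀ n, qPoch q q n ≠ 0) (a y : K) (n : ℕ) :
    ∑ p ∈ antidiagonal n,
        shiftCoeff q a y p.1 * qPoch (a * q ^ p.1) q p.2 / (qPoch q q p.1 * qPoch q q p.2) =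
      qPoch y q n / qPoch q q n := by
  induction n generalizing a with
  | zero => simp [qPoch, shiftCoeff]
  | succ n ih =>
    have h := pascal_antidiagonal' hq (fun k l => shiftCoeff q a y k * qPoch (a * q ^ k) q l) n
    have h1 := one_sub_pow_succ_ne_zero hq n
    rw [← mul_right_inj' h1, h]
    -- the first factor of the coefficient splits off, at the price of the shift `a ↦ a q`
    have hs : ∀ k, shiftCoeff q a y (k + 1) = (a - y) * q ^ k * shiftCoeff q (a * q) y k := by
      intro k
      rw [shiftCoeff, prod_range_succ', shiftCoeff, prod_mul_distrib, prod_mul_distrib]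
      simp only [pow_zero, one_mul, mul_one, pow_succ, prod_mul_distrib, prod_const, card_range]
      have : ∀ i, a * (q ^ i * q) - y = a * q * q ^ i - y := fun i => by ring
      simp only [this]
      ring
    have : ∀ p ∈ antidiagonal n,
        (q ^ p.2 * (shiftCoeff q a y (p.1 + 1) * qPoch (a * q ^ (p.1 + 1)) q p.2) +
          shiftCoeff q a y p.1 * qPoch (a * q ^ p.1) q (p.2 + 1)) /
            (qPoch q q p.1 * qPoch q q p.2) =
        q ^ n * (a - y) * (shiftCoeff q (a * q) y p.1 * qPoch (a * q * q ^ p.1) q p.2 /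
            (qPoch q q p.1 * qPoch q q p.2)) +
        (1 - a * q ^ n) * (shiftCoeff q a y p.1 * qPoch (a * q ^ p.1) q p.2 /
            (qPoch q q p.1 * qPoch q q p.2)) := by
      intro p hp
      rw [← HasAntidiagonal.mem_antidiagonal.mp hp, hs, qPoch_succ,
        show a * q ^ (p.1 + 1) = a * q * q ^ p.1 by ring, pow_add]
      ring
    rw [sum_congr rfl this, sum_add_distrib, ← mul_sum, ← mul_sum, ih, ih, qPoch_succ, qPoch_succ]
    have h2 := hq n
    rw [← pow_succ']
    field_simp
    ring

/-- The jump distribution `φ(s|m)` with parameters `μ` and `ν = μρ`; the arguments are `s` and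
`a = m - s`. Using `ρ` in place of `ν/μ` makes identities in these weights polynomial in `μ, ρ`. -/
def jumpWeight (q μ ρ : K) (s a : ℕ) : K :=
  qPoch q q (s + a) / qPoch (μ * ρ) q (s + a) *
    (μ ^ s * qPoch ρ q s * qPoch μ q a / (qPoch q q s * qPoch q q a))

/-- The average against the jump weights of a function expanded as
`f s a = (q;q)_s ∑_{k+l=s} c k (l + a) / ((q;q)_k (q;q)_l)`: for fixed `k`
the sum over `l` and `a` is a `q`-Chu–Vandermonde sum. -/
theorem sum_jumpWeight_mul (hq : ∀ n, qPoch q q n ≠ 0) (μ ρ : K)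
    (hν : ∀ n, qPoch (μ * ρ) q n ≠ 0) (f c : ℕ → ℕ → K)
    (m : ℕ) (hf : ∀ s a, s + a = m → f s a / qPoch q q s =
      ∑ p ∈ antidiagonal s, c p.1 (p.2 + a) / (qPoch q q p.1 * qPoch q q p.2)) :
    ∑ p ∈ antidiagonal m, jumpWeight q μ ρ p.1 p.2 * f p.1 p.2 =
      qPoch q q m * ∑ p ∈ antidiagonal m, μ ^ p.1 * qPoch ρ q p.1 / qPoch (μ * ρ) q p.1 *
        c p.1 p.2 / (qPoch q q p.1 * qPoch q q p.2) := by
  have h1 : ∀ p ∈ antidiagonal m, jumpWeight q μ ρ p.1 p.2 * f p.1 p.2 =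
      qPoch q q m / qPoch (μ * ρ) q m *
      ∑ r ∈ antidiagonal p.1, (μ ^ (r.1 + r.2) * qPoch ρ q (r.1 + r.2) * qPoch μ q p.2 *
        c r.1 (r.2 + p.2) / (qPoch q q r.1 * qPoch q q r.2 * qPoch q q p.2)) := by
    intro p hp
    have hp' := HasAntidiagonal.mem_antidiagonal.mp hp
    have h2 : jumpWeight q μ ρ p.1 p.2 * f p.1 p.2 = qPoch q q m / qPoch (μ * ρ) q m *
        (μ ^ p.1 * qPoch ρ q p.1 * qPoch μ q p.2 / qPoch q q p.2 * (f p.1 p.2 / qPoch q q p.1)) := by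
      rw [jumpWeight, hp']
      have := hq p.1
      have := hq p.2
      field_simp
    rw [h2, hf p.1 p.2 hp', mul_sum]
    congr 1
    refine sum_congr rfl fun r hr => ?_
    rw [HasAntidiagonal.mem_antidiagonal.mp hr]
    have := hq r.1
    have := hq r.2
    have := hq p.2
    field_simp
  rw [sum_congr rfl h1, ← mul_sum,
    sum_antidiagonal_assoc (fun k l a => μ ^ (k + l) * qPoch ρ q (k + l) * qPoch μ q a *
        c k (l + a) / (qPoch q q k * qPoch q q l * qPoch q q a)), mul_sum, mul_sum]
  refine sum_congr rfl fun p hp => ?_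
  have h3 : ∀ r ∈ antidiagonal p.2,
      μ ^ (p.1 + r.1) * qPoch ρ q (p.1 + r.1) * qPoch μ q r.2 * c p.1 (r.1 + r.2) /
        (qPoch q q p.1 * qPoch q q r.1 * qPoch q q r.2) =
      μ ^ p.1 * qPoch ρ q p.1 * c p.1 p.2 / qPoch q q p.1 *
        (μ ^ r.1 * qPoch (ρ * q ^ p.1) q r.1 * qPoch μ q r.2 /
          (qPoch q q r.1 * qPoch q q r.2)) := by
    intro r hr
    rw [HasAntidiagonal.mem_antidiagonal.mp hr, qPoch_add, pow_add]
    have := hq r.1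
    have := hq r.2
    have := hq p.1
    field_simp
  rw [sum_congr rfl h3, ← mul_sum, sum_antidiagonal_qPoch hq, ← mul_assoc μ,
    ← HasAntidiagonal.mem_antidiagonal.mp hp, qPoch_add (μ * ρ)]
  have := hq p.1
  have := hq p.2
  have h5 := hν (p.1 + p.2)
  rw [qPoch_add] at h5
  have := left_ne_zero_of_mul h5
  have := right_ne_zero_of_mul h5
  field_simp

/-- The identity `(μy;q)_m = ∑_s φ(s|m) (y;q)_s (νq^s y;q)_{m-s}`, which makes the nested contour
integrals satisfy the duality recursion. -/
theorem sum_jumpWeight_mul_qPoch (hq : ∀ n, qPoch q q n ≠ 0) (μ ρ : K)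
    (hν : ∀ n, qPoch (μ * ρ) q n ≠ 0) (y : K) (m : ℕ) :
    ∑ p ∈ antidiagonal m, jumpWeight q μ ρ p.1 p.2 *
      (qPoch y q p.1 * qPoch (μ * ρ * y * q ^ p.1) q p.2) = qPoch (μ * y) q m := by
  have hA : ∀ k, shiftCoeff q (μ * ρ * y) (μ * y) k * qPoch (μ * ρ) q k =
      μ ^ k * qPoch ρ q k * shiftCoeff q (μ * ρ * y) y k := by
    intro k
    rw [shiftCoeff, shiftCoeff, qPoch, qPoch, ← card_range k, ← prod_const, card_range,
      ← prod_mul_distrib, ← prod_mul_distrib, ← prod_mul_distrib]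
    exact prod_congr rfl fun i _ => by ring
  rw [sum_jumpWeight_mul hq μ ρ hν (fun s a => qPoch y q s * qPoch (μ * ρ * y * q ^ s) q a)
    (fun k M => shiftCoeff q (μ * ρ * y) y k * qPoch (μ * ρ * y * q ^ k) q M)]
  · have h := sum_antidiagonal_shiftCoeff hq (μ * ρ * y) (μ * y) m
    rw [eq_div_iff (hq m), mul_comm] at h
    rw [← h]
    congr 1
    refine sum_congr rfl fun p _ => ?_
    have h1 := hA p.1
    have := hν p.1
    have := hq p.1
    have := hq p.2
    field_simp
    linear_combination (-qPoch (μ * ρ * y * q ^ p.1) q p.2) * h1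
  · intro s a _
    have h := sum_antidiagonal_shiftCoeff hq (μ * ρ * y) y s
    rw [mul_div_right_comm, ← h, sum_mul]
    refine sum_congr rfl fun p hp => ?_
    rw [← HasAntidiagonal.mem_antidiagonal.mp hp, qPoch_add _ q p.2 a, pow_add, ← mul_assoc (μ * ρ * y)]
    ring

/-- The right side of the duality relation, expanded so that it is linear in the `q`-factorial
moments of the jump distribution; here `Y` stands for `X q^g` with the gap `g`. -/
theorem sum_jumpWeight_mul_qPow (hq : ∀ n, qPoch q q n ≠ 0) (μ ρ : K)
    (hν : ∀ n, qPoch (μ * ρ) q n ≠ 0) (X Y : K) (m : ℕ) :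
    ∑ p ∈ antidiagonal m, jumpWeight q μ ρ p.1 p.2 *
      (qPow q X 1 p.2 * qPow q Y (q ^ p.2) p.1) =
    qPoch q q m * ∑ p ∈ antidiagonal m, μ ^ p.1 * qPoch ρ q p.1 / qPoch (μ * ρ) q p.1 *
        (qPow q Y X p.1 * qPow q X 1 p.2) / (qPoch q q p.1 * qPoch q q p.2) := by
  refine sum_jumpWeight_mul hq μ ρ hν (fun s a => qPow q X 1 a * qPow q Y (q ^ a) s)
    (fun k M => qPow q Y X k * qPow q X 1 M) m ?_
  intro s a _
  have h := sum_antidiagonal_qPow hq Y X (q ^ a) s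
  rw [mul_div_assoc, ← h, mul_sum]
  refine sum_congr rfl fun p _ => ?_
  rw [add_comm p.2 a, qPow_add q X 1 a, mul_one]
  ring

/-- The `q`-factorial moments of the jump distribution. -/
theorem sum_jumpWeight_mul_qPow_pow (hq : ∀ n, qPoch q q n ≠ 0) (μ ρ : K)
    (hν : ∀ n, qPoch (μ * ρ) q n ≠ 0) (g k : ℕ) :
    ∑ p ∈ antidiagonal g, jumpWeight q μ ρ p.1 p.2 * qPow q (q ^ p.1) 1 k =
      μ ^ k * qPoch ρ q k / qPoch (μ * ρ) q k * qPow q (q ^ g) 1 k := by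
  -- `P_k(q^j, 1)` vanishes for `k > j` and is a multiple of `(q;q)_j / (q;q)_{j-k}` otherwise
  have hv : ∀ j, j < k → qPow q (q ^ j) 1 k = 0 := fun j hj =>
    prod_eq_zero (mem_range.mpr hj) (by ring)
  have hm : ∀ l, qPow q (q ^ (k + l)) 1 k * qPoch q q l =
      (∏ i ∈ range k, -q ^ i) * qPoch q q (k + l) := by
    intro l
    have : qPoch q q (k + l) = qPoch q q l * ∏ i ∈ range k, (1 - q ^ (l + k - i)) := by
      rw [add_comm k l, qPoch, prod_range_add, ← qPoch]
      congr 1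
      rw [← prod_range_reflect]
      refine prod_congr rfl fun i hi => ?_
      have := mem_range.mp hi
      rw [← pow_succ']
      congr 2
      omega
    rw [this, qPow, mul_comm (qPoch q q l), ← mul_assoc, ← prod_mul_distrib]
    congr 1
    refine prod_congr rfl fun i hi => ?_
    have := mem_range.mp hi
    have h2 : k + l = i + (l + k - i) := by omega
    rw [h2, pow_add]
    have h3 : i + (l + k - i) - i = l + k - i := by omega
    ring
  rw [sum_jumpWeight_mul hq μ ρ hν (fun s _ => qPow q (q ^ s) 1 k)
    (fun k' M => if k' = k then (∏ i ∈ range k, -q ^ i) * qPoch q q k else 0)]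
  · by_cases hkg : k ≤ g
    · obtain ⟨l, rfl⟩ := Nat.exists_eq_add_of_le hkg
      rw [sum_eq_single (k, l)]
      · have h1 := hm l
        have := hq l
        have := hq k
        have := hν k
        simp only [if_true]
        field_simp
        linear_combination (-μ ^ k * qPoch ρ q k) * h1
      · rintro ⟨a, b⟩ hp hne
        have : a ≠ k := by
          rintro rfl
          apply hne
          have := HasAntidiagonal.mem_antidiagonal.mp hp
          simp only [Prod.mk.injEq, true_and]
          simp only at this
          omega
        simp [this]
      · intro h
        exact absurd (HasAntidiagonal.mem_antidiagonal.mpr (show (k, l).1 + (k, l).2 = k + l from rfl)) h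
    · rw [hv g (by omega), mul_zero, sum_eq_zero, mul_zero]
      intro p hp
      have := HasAntidiagonal.mem_antidiagonal.mp hp
      rw [if_neg (by omega)]
      simp
  · intro s a _
    by_cases hks : k ≤ s
    · obtain ⟨l, rfl⟩ := Nat.exists_eq_add_of_le hks
      rw [sum_eq_single (k, l)]
      · have h1 := hm l
        have := hq l
        have := hq k
        have := hq (k + l)
        simp only [if_true]
        field_simp
        linear_combination h1
      · rintro ⟨a, b⟩ hp hne
        have : a ≠ k := by
          rintro rfl
          apply hne
          have := HasAntidiagonal.mem_antidiagonal.mp hp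
          simp only [Prod.mk.injEq, true_and]
          simp only at this
          omega
        simp [this]
      · intro h
        exact absurd (HasAntidiagonal.mem_antidiagonal.mpr (show (k, l).1 + (k, l).2 = k + l from rfl)) h
    · rw [hv s (by omega), zero_div, sum_eq_zero]
      intro p hp
      have := HasAntidiagonal.mem_antidiagonal.mp hp
      rw [if_neg (by omega)]
      simp

/-- The left side of the duality relation, expanded in `q`-factorial moments of `x = q^j`. -/
theorem qPow_mul_expand (hq : ∀ n, qPoch q q n ≠ 0) (X x : K) (m : ℕ) :
    qPow q (X * x) 1 m = qPoch q q m * ∑ p ∈ antidiagonal m,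
      X ^ p.1 * qPow q x 1 p.1 * qPow q X 1 p.2 / (qPoch q q p.1 * qPoch q q p.2) := by
  have h := sum_antidiagonal_qPow hq (X * x) X 1 m
  rw [eq_div_iff (hq m), mul_comm] at h
  rw [← h]
  congr 1
  refine sum_congr rfl fun p _ => ?_
  rw [← qPow_mul_left, mul_one]

end Field

/-! ### Infinite `q`-products -/

section NormedField

variable {𝕜 : Type*} [NormedField 𝕜] [CompleteSpace 𝕜] {q : 𝕜}

omit [CompleteSpace 𝕜] in
theorem summable_norm_qPochInf (hq : ‖q‖ < 1) (a : 𝕜) : Summable fun i : ℕ => ‖-(a * q ^ i)‖ := by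
  simp only [norm_neg, norm_mul, norm_pow]
  exact (summable_geometric_of_lt_one (norm_nonneg _) hq).mul_left _

theorem multipliable_qPochInf (hq : ‖q‖ < 1) (a : 𝕜) : Multipliable fun i : ℕ => 1 - a * q ^ i := by
  simpa only [sub_eq_add_neg] using multipliable_one_add_of_summable (summable_norm_qPochInf hq a)

theorem tendsto_qPoch (hq : ‖q‖ < 1) (a : 𝕜) :
    Tendsto (fun n => qPoch a q n) atTop (𝓝 (qPochInf a q)) :=
  (multipliable_qPochInf hq a).hasProd.tendsto_prod_nat

theorem qPochInf_eq_mul (hq : ‖q‖ < 1) (a : 𝕜) (n : ℕ) :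
    qPochInf a q = qPoch a q n * qPochInf (a * q ^ n) q := by
  refine tendsto_nhds_unique ((tendsto_add_atTop_iff_nat n).mpr (tendsto_qPoch hq a)) ?_
  simp_rw [add_comm _ n, qPoch_add]
  exact (tendsto_qPoch hq (a * q ^ n)).const_mul _

theorem qPochInf_eq_one_sub_mul (hq : ‖q‖ < 1) (a : 𝕜) :
    qPochInf a q = (1 - a) * qPochInf (q * a) q := by
  rw [qPochInf_eq_mul hq a 1, pow_one, mul_comm a q]
  simp [qPoch]

theorem qPochInf_ne_zero (hq : ‖q‖ < 1) {a : 𝕜} (h : ∀ i : ℕ, a * q ^ i ≠ 1) :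
    qPochInf a q ≠ 0 := by
  simp only [qPochInf, sub_eq_add_neg]
  exact tprod_one_add_ne_zero_of_summable
    (fun i hi => h i (by rw [← sub_eq_add_neg, sub_eq_zero] at hi; exact hi.symm))
    (summable_norm_qPochInf hq a)

theorem qPochInf_ne_zero_of_norm_lt (hq : ‖q‖ < 1) {a : 𝕜} (ha : ‖a‖ < 1) :
    qPochInf a q ≠ 0 := by
  refine qPochInf_ne_zero hq fun i hi => ?_
  have : ‖a * q ^ i‖ < 1 := by
    rw [norm_mul, norm_pow]
    exact mul_lt_one_of_nonneg_of_lt_one_left (norm_nonneg _) ha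
      (pow_le_one₀ (norm_nonneg _) hq.le)
  rw [hi, norm_one] at this
  exact lt_irrefl _ this

omit [CompleteSpace 𝕜] in
theorem norm_qPoch_le (hq : ‖q‖ < 1) (a : 𝕜) (n : ℕ) :
    ‖qPoch a q n‖ ≤ Real.exp (‖a‖ / (1 - ‖q‖)) := by
  calc ‖qPoch a q n‖ ≤ ∏ i ∈ range n, (1 + ‖a‖ * ‖q‖ ^ i) := by
        rw [qPoch, norm_prod]
        refine prod_le_prod (fun _ _ => norm_nonneg _) fun i _ => ?_
        refine (norm_sub_le _ _).trans ?_
        rw [norm_one, norm_mul, norm_pow]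
    _ ≤ Real.exp (∑ i ∈ range n, ‖a‖ * ‖q‖ ^ i) := by
        rw [Real.exp_sum]
        refine prod_le_prod (fun _ _ => by positivity) fun i _ => ?_
        rw [add_comm]
        exact Real.add_one_le_exp _
    _ ≤ Real.exp (‖a‖ / (1 - ‖q‖)) := by
        rw [← mul_sum, div_eq_mul_inv, ← tsum_geometric_of_lt_one (norm_nonneg _) hq]
        gcongr
        exact (summable_geometric_of_lt_one (norm_nonneg _) hq).sum_le_tsum _
          fun _ _ => by positivity

end NormedField

/-- `w ↦ (w;q)_∞` is entire. -/
theorem differentiable_qPochInf {q : ℂ} (hq : ‖q‖ < 1) :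
    Differentiable ℂ fun w : ℂ => qPochInf w q := by
  intro w
  have hU : IsOpen (Metric.ball (0 : ℂ) (‖w‖ + 1)) := Metric.isOpen_ball
  have h := Summable.hasProdLocallyUniformlyOn_nat_one_add (f := fun (i : ℕ) (x : ℂ) => -(x * q ^ i))
    (K := Metric.ball (0 : ℂ) (‖w‖ + 1)) (u := fun i => (‖w‖ + 1) * ‖q‖ ^ i) hU
    ((summable_geometric_of_lt_one (norm_nonneg _) hq).mul_left _)
    (Eventually.of_forall fun n x hx => by
      rw [norm_neg, norm_mul, norm_pow]
      gcongr
      exact (mem_ball_zero_iff.mp hx).le) (fun i => by fun_prop)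
  have hd := h.tendstoLocallyUniformlyOn_finsetRange.differentiableOn
    (Eventually.of_forall fun n => DifferentiableOn.fun_finsetProd fun i _ => by fun_prop) hU
  have := hd.differentiableAt (hU.mem_nhds (mem_ball_zero_iff.mpr (by linarith)))
  simpa only [qPochInf, sub_eq_add_neg] using this

/-! ### The jump distribution -/

section Real

variable {q : ℝ}

theorem qPoch_pos (hq0 : 0 ≤ q) (hq1 : q < 1) {a : ℝ} (ha : a < 1) (n : ℕ) :
    0 < qPoch a q n := by
  refine prod_pos fun i _ => ?_
  have h1 : q ^ i ≤ 1 := pow_le_one₀ hq0 hq1.le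
  have h2 : 0 ≤ q ^ i := pow_nonneg hq0 i
  rcases le_or_gt a 0 with h | h
  · nlinarith
  · nlinarith

theorem qPoch_nonneg (hq0 : 0 ≤ q) (hq1 : q < 1) {a : ℝ} (ha : a ≤ 1) (n : ℕ) :
    0 ≤ qPoch a q n := by
  refine prod_nonneg fun i _ => ?_
  have h1 : q ^ i ≤ 1 := pow_le_one₀ hq0 hq1.le
  have h2 : 0 ≤ q ^ i := pow_nonneg hq0 i
  rcases le_or_gt a 0 with h | h
  · nlinarith
  · nlinarith

theorem qPoch_le_one (hq0 : 0 ≤ q) (hq1 : q < 1) {a : ℝ} (ha0 : 0 ≤ a) (ha : a ≤ 1) (n : ℕ) :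
    qPoch a q n ≤ 1 := by
  refine prod_le_one (fun i _ => ?_) fun i _ => ?_
  · have h1 : q ^ i ≤ 1 := pow_le_one₀ hq0 hq1.le
    have h2 : 0 ≤ q ^ i := pow_nonneg hq0 i
    nlinarith
  · have : 0 ≤ a * q ^ i := by positivity
    linarith

theorem qPochInf_le_qPoch (hq0 : 0 ≤ q) (hq1 : q < 1) {a : ℝ} (ha0 : 0 ≤ a) (ha : a ≤ 1)
    (n : ℕ) : qPochInf a q ≤ qPoch a q n := by
  have hq : ‖q‖ < 1 := by rwa [Real.norm_of_nonneg hq0]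
  refine le_of_tendsto (tendsto_qPoch hq a) (eventually_atTop.mpr ⟨n, fun m hm => ?_⟩)
  obtain ⟨k, rfl⟩ := Nat.exists_eq_add_of_le hm
  rw [qPoch_add]
  refine mul_le_of_le_one_right (qPoch_nonneg hq0 hq1 ha n) (qPoch_le_one hq0 hq1 (by positivity) ?_ k)
  exact mul_le_one₀ ha (by positivity) (pow_le_one₀ hq0 hq1.le)

theorem qPochInf_pos (hq0 : 0 ≤ q) (hq1 : q < 1) {a : ℝ} (ha0 : 0 ≤ a) (ha : a < 1) :
    0 < qPochInf a q := by
  have hq : ‖q‖ < 1 := by rwa [Real.norm_of_nonneg hq0]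
  refine lt_of_le_of_ne (ge_of_tendsto' (tendsto_qPoch hq a)
    fun n => (qPoch_pos hq0 hq1 ha n).le) (Ne.symm ?_)
  exact qPochInf_ne_zero_of_norm_lt hq (by rwa [Real.norm_of_nonneg ha0])

variable {μ ν : ℝ}

/-- This includes the case `μ = ν = 0`, in which `ν / μ` is read as `0`. -/
theorem mul_div_self_of_le (hν : 0 ≤ ν) (hνμ : ν ≤ μ) : μ * (ν / μ) = ν := by
  rcases eq_or_ne μ 0 with h | h
  · subst h
    simp [le_antisymm hνμ hν]
  · field_simp

theorem jumpProb_eq_jumpWeight (hν : 0 ≤ ν) (hνμ : ν ≤ μ) (s a : ℕ) :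
    jumpProb q μ ν (s + a) s = jumpWeight q μ (ν / μ) s a := by
  rw [jumpProb, if_pos (Nat.le_add_right s a), jumpWeight, mul_div_self_of_le hν hνμ,
    Nat.add_sub_cancel_left]
  ring

variable (hq0 : 0 < q) (hq1 : q < 1) (hν : 0 ≤ ν) (hνμ : ν ≤ μ) (hμ : μ < 1)
include hq0 hq1 hν hνμ

theorem jumpProb_nonneg (hμ : μ < 1) (m j : ℕ) : 0 ≤ jumpProb q μ ν m j := by
  have h1 : ν / μ ≤ 1 := div_le_one_of_le₀ hνμ (hν.trans hνμ)
  rw [jumpProb]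
  split_ifs
  · have := qPoch_nonneg hq0.le hq1 h1 j
    have := (qPoch_pos hq0.le hq1 hμ (m - j)).le
    have := (qPoch_pos hq0.le hq1 (hνμ.trans_lt hμ) m).le
    have := (qPoch_pos hq0.le hq1 hq1 m).le
    have := (qPoch_pos hq0.le hq1 hq1 j).le
    have := (qPoch_pos hq0.le hq1 hq1 (m - j)).le
    have := hν.trans hνμ
    positivity
  · exact le_rfl

theorem jumpProbTop_nonneg (hμ : μ < 1) (j : ℕ) : 0 ≤ jumpProbTop q μ ν j := by
  have h1 : ν / μ ≤ 1 := div_le_one_of_le₀ hνμ (hν.trans hνμ)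
  have := qPoch_nonneg hq0.le hq1 h1 j
  have := (qPochInf_pos hq0.le hq1 (hν.trans hνμ) hμ).le
  have := (qPochInf_pos hq0.le hq1 hν (hνμ.trans_lt hμ)).le
  have := (qPoch_pos hq0.le hq1 hq1 j).le
  have := hν.trans hνμ
  rw [jumpProbTop]
  positivity

/-- A geometric bound uniform in the gap, which dominates the limit `m → ∞`. -/
theorem jumpProb_le (hμ : μ < 1) (m j : ℕ) :
    jumpProb q μ ν m j ≤ μ ^ j * (1 / qPochInf ν q * (1 / (qPochInf q q * qPochInf q q))) := by
  have h1 : ν / μ ≤ 1 := div_le_one_of_le₀ hνμ (hν.trans hνμ)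
  have h1' : 0 ≤ ν / μ := div_nonneg hν (hν.trans hνμ)
  have hμ0 := hν.trans hνμ
  have hνp := qPochInf_pos hq0.le hq1 hν (hνμ.trans_lt hμ)
  have hqp := qPochInf_pos hq0.le hq1 hq0.le hq1
  rw [jumpProb]
  split_ifs
  · rw [mul_assoc]
    have a1 := qPoch_nonneg hq0.le hq1 h1 j
    have a2 := (qPoch_pos hq0.le hq1 hμ (m - j)).le
    have a3 := (qPoch_pos hq0.le hq1 hq1 m).le
    have a4 := (qPoch_pos hq0.le hq1 hq1 j).le
    have a5 := (qPoch_pos hq0.le hq1 hq1 (m - j)).le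
    gcongr
    · exact mul_le_one₀ (qPoch_le_one hq0.le hq1 h1' h1 j) a2 (qPoch_le_one hq0.le hq1 hμ0 hμ.le _)
    · exact qPochInf_le_qPoch hq0.le hq1 hν (hνμ.trans hμ.le) m
    · exact qPoch_le_one hq0.le hq1 hq0.le hq1.le m
    · exact qPochInf_le_qPoch hq0.le hq1 hq0.le hq1.le j
    · exact qPochInf_le_qPoch hq0.le hq1 hq0.le hq1.le (m - j)
  · positivity

theorem tendsto_jumpProb (hμ : μ < 1) (j : ℕ) :
    Tendsto (fun m => jumpProb q μ ν m j) atTop (𝓝 (jumpProbTop q μ ν j)) := by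
  have hq : ‖q‖ < 1 := by rwa [Real.norm_of_nonneg hq0.le]
  have hνp := qPochInf_pos hq0.le hq1 hν (hνμ.trans_lt hμ)
  have hqp := qPochInf_pos hq0.le hq1 hq0.le hq1
  have hj := qPoch_pos hq0.le hq1 hq1 j
  rw [← tendsto_add_atTop_iff_nat j]
  have h : ∀ m, jumpProb q μ ν (m + j) j = μ ^ j * (qPoch (ν / μ) q j * qPoch μ q m /
      qPoch ν q (m + j)) * (qPoch q q (m + j) / (qPoch q q j * qPoch q q m)) := by
    intro m
    rw [jumpProb, if_pos (Nat.le_add_left j m), Nat.add_sub_cancel]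
  simp_rw [h]
  have e : jumpProbTop q μ ν j = μ ^ j * (qPoch (ν / μ) q j * qPochInf μ q / qPochInf ν q) *
      (qPochInf q q / (qPoch q q j * qPochInf q q)) := by
    rw [jumpProbTop]
    field_simp
  rw [e]
  have t1 := tendsto_qPoch hq μ
  have t2 := (tendsto_add_atTop_iff_nat j).mpr (tendsto_qPoch hq ν)
  have t3 := (tendsto_add_atTop_iff_nat j).mpr (tendsto_qPoch hq q)
  have t4 := tendsto_qPoch hq q
  exact (((t1.const_mul _).div t2 hνp.ne').const_mul _).mul (t3.div (t4.const_mul _)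
    (by positivity))

/-- The `q`-factorial moments of the jump distribution at a finite gap. -/
theorem hasSum_jumpProb_qPow (hμ : μ < 1) (m k : ℕ) :
    HasSum (fun j => jumpProb q μ ν m j * qPow q (q ^ j) 1 k)
      (μ ^ k * qPoch (ν / μ) q k / qPoch ν q k * qPow q (q ^ m) 1 k) := by
  have h := sum_jumpWeight_mul_qPow_pow (q := q) (fun n => (qPoch_pos hq0.le hq1 hq1 n).ne') μ
    (ν / μ) (fun n => by
      rw [mul_div_self_of_le hν hνμ]
      exact (qPoch_pos hq0.le hq1 (hνμ.trans_lt hμ) n).ne') m k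
  rw [mul_div_self_of_le hν hνμ] at h
  rw [← h, Nat.sum_antidiagonal_eq_sum_range_succ_mk]
  have h2 : ∀ j ∈ range m.succ, jumpWeight q μ (ν / μ) j (m - j) * qPow q (q ^ j) 1 k =
      jumpProb q μ ν m j * qPow q (q ^ j) 1 k := by
    intro j hj
    rw [← jumpProb_eq_jumpWeight hν hνμ, Nat.add_sub_cancel' (Nat.lt_succ_iff.mp (mem_range.mp hj))]
  rw [sum_congr rfl h2]
  refine hasSum_sum_of_ne_finset_zero fun j hj => ?_
  rw [jumpProb, if_neg (by simpa using hj), zero_mul]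

omit hν hνμ in
theorem abs_qPow_pow_le (j k : ℕ) : |qPow q (q ^ j) 1 k| ≤ 1 := by
  rw [qPow, abs_prod]
  refine prod_le_one (fun _ _ => abs_nonneg _) fun i _ => ?_
  have h1 : q ^ i ≤ 1 := pow_le_one₀ hq0.le hq1.le
  have h2 : 0 ≤ q ^ i := pow_nonneg hq0.le i
  have h3 : q ^ j ≤ 1 := pow_le_one₀ hq0.le hq1.le
  have h4 : 0 ≤ q ^ j := pow_nonneg hq0.le j
  rw [abs_le]
  constructor <;> linarith

/-- The `q`-factorial moments of the jump distribution at an infinite gap, as the limit of those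
at finite gaps. -/
theorem hasSum_jumpProbTop_qPow (hμ : μ < 1) (k : ℕ) :
    HasSum (fun j => jumpProbTop q μ ν j * qPow q (q ^ j) 1 k)
      (μ ^ k * qPoch (ν / μ) q k / qPoch ν q k * qPow q 0 1 k) := by
  have hμ0 := hν.trans hνμ
  set C := 1 / qPochInf ν q * (1 / (qPochInf q q * qPochInf q q)) with hC
  have hsum : Summable fun j : ℕ => μ ^ j * C :=
    (summable_geometric_of_lt_one hμ0 hμ).mul_right _
  have hb : ∀ m j, ‖jumpProb q μ ν m j * qPow q (q ^ j) 1 k‖ ≤ μ ^ j * C := by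
    intro m j
    rw [norm_mul, Real.norm_of_nonneg (jumpProb_nonneg hq0 hq1 hν hνμ hμ m j)]
    calc _ ≤ jumpProb q μ ν m j * 1 := mul_le_mul_of_nonneg_left (abs_qPow_pow_le hq0 hq1 j k)
          (jumpProb_nonneg hq0 hq1 hν hνμ hμ m j)
      _ ≤ _ := by rw [mul_one]; exact jumpProb_le hq0 hq1 hν hνμ hμ m j
  have hlim : ∀ j, Tendsto (fun m => jumpProb q μ ν m j * qPow q (q ^ j) 1 k) atTop
      (𝓝 (jumpProbTop q μ ν j * qPow q (q ^ j) 1 k)) := fun j =>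
    (tendsto_jumpProb hq0 hq1 hν hνμ hμ j).mul_const _
  have h1 := tendsto_tsum_of_dominated_convergence hsum hlim
    (Eventually.of_forall fun m j => hb m j)
  have h2 : Tendsto (fun m : ℕ => μ ^ k * qPoch (ν / μ) q k / qPoch ν q k * qPow q (q ^ m) 1 k)
      atTop (𝓝 (μ ^ k * qPoch (ν / μ) q k / qPoch ν q k * qPow q 0 1 k)) := by
    refine Tendsto.const_mul _ ?_
    simp only [qPow]
    exact tendsto_finsetProd _ fun i _ =>
      (tendsto_pow_atTop_nhds_zero_of_lt_one hq0.le hq1).sub_const _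
  simp_rw [(hasSum_jumpProb_qPow hq0 hq1 hν hνμ hμ _ k).tsum_eq] at h1
  rw [tendsto_nhds_unique h2 h1]
  refine Summable.hasSum (hsum.of_norm_bounded fun j => ?_)
  exact le_of_tendsto (hlim j).norm (Eventually.of_forall fun m => hb m j)

/-- A distribution `φ` on jump sizes has `q`-gap `γ` if its `q`-factorial moments are those of the
jump distribution at gap `g`, where `γ = q^g`, with `γ = 0` for the infinite gap. -/
def HasQGap (q μ ν γ : ℝ) (φ : ℕ → ℝ) : Prop :=
  ∀ k, HasSum (fun j => φ j * qPow q (q ^ j) 1 k)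
    (μ ^ k * qPoch (ν / μ) q k / qPoch ν q k * qPow q γ 1 k)

omit hq0 hq1 hν hνμ in
theorem HasQGap.hasSum_one {γ : ℝ} {φ : ℕ → ℝ} (h : HasQGap q μ ν γ φ) : HasSum φ 1 := by
  simpa [qPow_zero, qPoch_zero] using h 0

/-- The duality relation: averaging `∏_{i<m} (X q^j - q^i c)` over the jump `j` of a particle with
`q`-gap `γ` amounts to moving a random number `s` of `m` dual particles, distributed
according to `φ(s|m)`, to the site ahead. -/
theorem HasQGap.hasSum_qPow (hμ : μ < 1) {γ : ℝ} {φ : ℕ → ℝ} (h : HasQGap q μ ν γ φ)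
    (X : ℝ) {c : ℝ} (hc : c ≠ 0) (m : ℕ) :
    HasSum (fun j => φ j * qPow q (X * q ^ j) c m)
      (∑ p ∈ antidiagonal m, jumpWeight q μ (ν / μ) p.1 p.2 *
        (qPow q X c p.2 * qPow q (X * γ) (q ^ p.2 * c) p.1)) := by
  have hqp : ∀ n, qPoch q q n ≠ 0 := fun n => (qPoch_pos hq0.le hq1 hq1 n).ne'
  have hνp : ∀ n, qPoch ν q n ≠ 0 := fun n => (qPoch_pos hq0.le hq1 (hνμ.trans_lt hμ) n).ne'
  -- both sides are homogeneous of degree `m`, so that one may take `c = 1`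
  suffices key : ∀ X : ℝ, HasSum (fun j => φ j * qPow q (X * q ^ j) 1 m)
      (∑ p ∈ antidiagonal m, jumpWeight q μ (ν / μ) p.1 p.2 *
        (qPow q X 1 p.2 * qPow q (X * γ) (q ^ p.2) p.1)) by
    have h1 := (key (X / c)).mul_left (c ^ m)
    convert! h1 using 1
    · funext j
      rw [mul_left_comm, ← qPow_mul_left]
      congr 2
      · field_simp
      · ring
    · rw [mul_sum]
      refine sum_congr rfl fun p hp => ?_
      have e1 := qPow_mul_left q c (X / c) 1 p.2
      have e2 := qPow_mul_left q c (X / c * γ) (q ^ p.2) p.1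
      rw [mul_one, mul_div_cancel₀ _ hc] at e1
      rw [← mul_assoc c, mul_div_cancel₀ _ hc, mul_comm c] at e2
      rw [← HasAntidiagonal.mem_antidiagonal.mp hp, pow_add, e1, e2]
      ring
  intro X
  rw [sum_jumpWeight_mul_qPow hqp μ (ν / μ) (by rwa [mul_div_self_of_le hν hνμ])]
  simp_rw [qPow_mul_expand hqp X, mul_left_comm (φ _) (qPoch q q m)]
  refine HasSum.mul_left _ ?_
  simp_rw [mul_sum]
  refine hasSum_sum fun p _ => ?_
  have h1 := (h p.1).mul_left (X ^ p.1 * qPow q X 1 p.2 / (qPoch q q p.1 * qPoch q q p.2))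
  convert! h1 using 1
  · funext j
    ring
  · have : qPow q (X * γ) X p.1 = X ^ p.1 * qPow q γ 1 p.1 := by
      rw [← qPow_mul_left, mul_one]
    rw [this, mul_div_self_of_le hν hνμ]
    ring

end Real

/-! ### One step of the process -/

section OneStep

variable {q μ ν : ℝ} {N : ℕ}

/-- The number of empty sites ahead of a particle, as seen by the transition probabilities; the
value at the leading particle is irrelevant. -/
def gap (x : Config N) (i : Fin N) : ℕ :=
  (x ⟨i.val - 1, lt_of_le_of_lt (Nat.sub_le _ _) i.isLt⟩ - x i - 1).toNat

/-- The `q`-gap ahead of a particle: `q^g` at a gap of `g` empty sites, and `0` at the infinite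
gap of the leading particle. -/
def qGap (q : ℝ) (x : Config N) (i : Fin N) : ℝ :=
  if i.val = 0 then 0 else q ^ gap x i

/-- The law of the new position of the particle with index `i`, given the configuration. -/
def jumpMeasure (q μ ν : ℝ) (x : Config N) (i : Fin N) : Measure ℤ :=
  Measure.sum fun j : ℕ =>
    ENNReal.ofReal (particleJumpProb q μ ν x i j) • Measure.dirac (x i + (j : ℤ))

/-- The admissible configurations: strictly decreasing, with each particle at or ahead of
its initial position. -/
def IsAdmissible (x : Config N) : Prop :=
  (∀ i : Fin N, i.val ≠ 0 → x i < x ⟨i.val - 1, lt_of_le_of_lt (Nat.sub_le _ _) i.isLt⟩) ∧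
    ∀ i : Fin N, -((i.val : ℤ) + 1) ≤ x i

variable (hq0 : 0 < q) (hq1 : q < 1) (hν : 0 ≤ ν) (hνμ : ν ≤ μ) (hμ : μ < 1)
include hq0 hq1 hν hνμ hμ

theorem particleJumpProb_nonneg (x : Config N) (i : Fin N) (j : ℕ) :
    0 ≤ particleJumpProb q μ ν x i j := by
  rw [particleJumpProb]
  split_ifs
  · exact jumpProbTop_nonneg hq0 hq1 hν hνμ hμ j
  · exact jumpProb_nonneg hq0 hq1 hν hνμ hμ _ j

theorem hasQGap_particleJumpProb (x : Config N) (i : Fin N) :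
    HasQGap q μ ν (qGap q x i) (particleJumpProb q μ ν x i) := by
  intro k
  by_cases h : i.val = 0
  · simpa only [particleJumpProb, qGap, if_pos h] using
      hasSum_jumpProbTop_qPow hq0 hq1 hν hνμ hμ k
  · simp only [particleJumpProb, qGap, if_neg h]
    exact hasSum_jumpProb_qPow hq0 hq1 hν hνμ hμ (gap x i) k

theorem isProbabilityMeasure_jumpMeasure (x : Config N) (i : Fin N) :
    IsProbabilityMeasure (jumpMeasure q μ ν x i) := by
  have h := (hasQGap_particleJumpProb hq0 hq1 hν hνμ hμ x i).hasSum_one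
  refine ⟨?_⟩
  rw [jumpMeasure, Measure.sum_apply _ MeasurableSet.univ]
  simp only [Measure.smul_apply, measure_univ, smul_eq_mul, mul_one]
  rw [← ENNReal.ofReal_tsum_of_nonneg (particleJumpProb_nonneg hq0 hq1 hν hνμ hμ x i) h.summable,
    h.tsum_eq, ENNReal.ofReal_one]

omit hq0 hq1 hν hνμ hμ in
theorem jumpMeasure_singleton (x : Config N) (i : Fin N) (z : ℤ) :
    jumpMeasure q μ ν x i {z} =
      ENNReal.ofReal (if x i ≤ z then particleJumpProb q μ ν x i (z - x i).toNat else 0) := by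
  rw [jumpMeasure, Measure.sum_apply _ (measurableSet_singleton z)]
  simp only [Measure.smul_apply, smul_eq_mul, Measure.dirac_apply' _ (measurableSet_singleton z)]
  split_ifs with h
  · rw [tsum_eq_single (z - x i).toNat]
    · rw [Int.toNat_of_nonneg (by omega)]
      simp
    · intro j hj
      have : x i + (j : ℤ) ≠ z := by omega
      simp [this]
  · rw [ENNReal.ofReal_zero, ENNReal.tsum_eq_zero]
    intro j
    have : x i + (j : ℤ) ≠ z := by omega
    simp [this]

theorem hasSum_integral_jumpMeasure (x : Config N) (i : Fin N) {f : ℤ → ℝ} {C S : ℝ}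
    (hf : ∀ j : ℕ, |f (x i + j)| ≤ C)
    (hS : HasSum (fun j : ℕ => particleJumpProb q μ ν x i j * f (x i + j)) S) :
    ∫ y, f y ∂jumpMeasure q μ ν x i = S := by
  have hnn := particleJumpProb_nonneg hq0 hq1 hν hνμ hμ x i
  have h1 := (hasQGap_particleJumpProb hq0 hq1 hν hνμ hμ x i).hasSum_one
  have hint : Integrable f (jumpMeasure q μ ν x i) := by
    refine integrable_sum_measure (fun j => ?_) ?_
    · exact (integrable_dirac (by simp)).smul_measure ENNReal.ofReal_ne_top
    · refine (h1.summable.mul_right C).of_nonneg_of_le (fun j => integral_nonneg fun _ =>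
        norm_nonneg _) fun j => ?_
      rw [integral_smul_measure, integral_dirac, ENNReal.toReal_ofReal (hnn j), smul_eq_mul]
      exact mul_le_mul_of_nonneg_left (hf j) (hnn j)
  have h2 := hasSum_integral_measure hint
  refine h2.unique ?_
  convert! hS using 1
  funext j
  rw [integral_smul_measure, integral_dirac, ENNReal.toReal_ofReal (hnn j), smul_eq_mul]

omit hq0 hq1 hν hνμ hμ in
theorem tasepLaw_singleton (t : ℕ) (y : Config N) :
    tasepLaw q μ ν N t {y} = tasepMass q μ ν N t y := by
  rw [tasepLaw, Measure.sum_apply _ (measurableSet_singleton y), tsum_eq_single y]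
  · simp
  · intro x hx
    simp [hx]

theorem pi_jumpMeasure_singleton (x y : Config N) :
    Measure.pi (jumpMeasure q μ ν x) {y} = ENNReal.ofReal (tasepStep q μ ν x y) := by
  have := isProbabilityMeasure_jumpMeasure hq0 hq1 hν hνμ hμ x
  rw [Measure.pi_singleton, tasepStep, ENNReal.ofReal_prod_of_nonneg]
  · exact prod_congr rfl fun i _ => jumpMeasure_singleton x i (y i)
  · intro i _
    split_ifs
    · exact particleJumpProb_nonneg hq0 hq1 hν hνμ hμ x i _
    · exact le_rfl

/-- The law at time `t + 1` is obtained from that at time `t` by moving all particles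
independently. -/
theorem tasepLaw_succ (t : ℕ) :
    tasepLaw q μ ν N (t + 1) =
      (tasepLaw q μ ν N t).bind fun x => Measure.pi (jumpMeasure q μ ν x) := by
  refine Measure.ext_of_singleton fun y => ?_
  rw [tasepLaw_singleton, Measure.bind_apply (measurableSet_singleton y)
    Measurable.of_discrete.aemeasurable]
  simp_rw [pi_jumpMeasure_singleton hq0 hq1 hν hνμ hμ]
  rw [tasepLaw, lintegral_sum_measure, tasepMass]
  refine tsum_congr fun x => ?_
  rw [lintegral_smul_measure, lintegral_dirac, smul_eq_mul]

omit hq0 hq1 hν hνμ hμ in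
theorem tasepLaw_zero : tasepLaw q μ ν N 0 = Measure.dirac (stepConfig N) := by
  refine Measure.ext_of_singleton fun y => ?_
  rw [tasepLaw_singleton, tasepMass, Measure.dirac_apply' _ (measurableSet_singleton y)]
  by_cases h : y = stepConfig N
  · simp [h]
  · simp [h, Ne.symm h]

theorem isProbabilityMeasure_tasepLaw (t : ℕ) : IsProbabilityMeasure (tasepLaw q μ ν N t) := by
  induction t with
  | zero =>
    rw [tasepLaw_zero]
    infer_instance
  | succ t ih =>
    rw [tasepLaw_succ hq0 hq1 hν hνμ hμ]
    refine isProbabilityMeasure_bind Measurable.of_discrete.aemeasurable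
      (Eventually.of_forall fun x => ?_)
    have := isProbabilityMeasure_jumpMeasure hq0 hq1 hν hνμ hμ x
    infer_instance

theorem integral_tasepLaw_succ {f : Config N → ℝ} {t : ℕ}
    (hf : Integrable f (tasepLaw q μ ν N (t + 1))) :
    ∫ y, f y ∂tasepLaw q μ ν N (t + 1) =
      ∫ x, ∫ y, f y ∂Measure.pi (jumpMeasure q μ ν x) ∂tasepLaw q μ ν N t := by
  have := isProbabilityMeasure_tasepLaw (N := N) hq0 hq1 hν hνμ hμ t
  let κ : Kernel (Config N) (Config N) :=
    ⟨fun x => Measure.pi (jumpMeasure q μ ν x), Measurable.of_discrete⟩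
  have : IsMarkovKernel κ := ⟨fun x => by
    have := isProbabilityMeasure_jumpMeasure hq0 hq1 hν hνμ hμ x
    change IsProbabilityMeasure (Measure.pi (jumpMeasure q μ ν x))
    infer_instance⟩
  rw [tasepLaw_succ hq0 hq1 hν hνμ hμ] at hf ⊢
  change Integrable f (κ ∘ₘ tasepLaw q μ ν N t) at hf
  change ∫ y, f y ∂(κ ∘ₘ tasepLaw q μ ν N t) = ∫ x, ∫ y, f y ∂κ x ∂tasepLaw q μ ν N t
  rw [Measure.comp_eq_comp_const_apply] at hf ⊢
  rw [Kernel.integral_comp hf, Kernel.const_apply]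

omit hq0 hq1 hν hνμ hμ in
theorem IsAdmissible.of_tasepStep_ne_zero {x y : Config N} (hadm : IsAdmissible x)
    (hstep : tasepStep q μ ν x y ≠ 0) : IsAdmissible y := by
  have hfac := fun i => prod_ne_zero_iff.mp hstep i (mem_univ i)
  have hle : ∀ i, x i ≤ y i := fun i => by
    by_contra hc
    exact hfac i (if_neg hc)
  refine ⟨fun i hi => ?_, fun i => (hadm.2 i).trans (hle i)⟩
  have h1 := hfac i
  rw [if_pos (hle i), particleJumpProb, if_neg hi, jumpProb] at h1
  have h2 : (y i - x i).toNat ≤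
      (x ⟨i.val - 1, lt_of_le_of_lt (Nat.sub_le _ _) i.isLt⟩ - x i - 1).toNat := by
    by_contra hc
    exact h1 (if_neg hc)
  have h3 := hle i
  have h4 := hle ⟨i.val - 1, lt_of_le_of_lt (Nat.sub_le _ _) i.isLt⟩
  have h5 := hadm.1 i hi
  omega

omit hq0 hq1 hν hνμ hμ in
theorem isAdmissible_of_tasepMass_ne_zero (t : ℕ) {y : Config N}
    (h : tasepMass q μ ν N t y ≠ 0) : IsAdmissible y := by
  induction t generalizing y with
  | zero =>
    rw [tasepMass] at h
    have hy : y = stepConfig N := by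
      by_contra hy
      exact h (if_neg hy)
    subst hy
    refine ⟨fun i hi => ?_, fun i => le_rfl⟩
    simp only [stepConfig]
    omega
  | succ t ih =>
    rw [tasepMass] at h
    obtain ⟨x, hx⟩ : ∃ x, tasepMass q μ ν N t x * ENNReal.ofReal (tasepStep q μ ν x y) ≠ 0 := by
      by_contra hc
      push Not at hc
      exact h (ENNReal.tsum_eq_zero.mpr hc)
    exact (ih (left_ne_zero_of_mul hx)).of_tasepStep_ne_zero
      fun h0 => hx (by rw [h0]; simp)

omit hq0 hq1 hν hνμ hμ in
theorem ae_isAdmissible (t : ℕ) : ∀ᵐ x ∂tasepLaw q μ ν N t, IsAdmissible x := by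
  rw [tasepLaw, Measure.ae_sum_iff]
  intro x
  by_cases h : tasepMass q μ ν N t x = 0
  · simp [h]
  · refine Measure.ae_smul_measure ?_ _
    rw [ae_dirac_eq]
    exact isAdmissible_of_tasepMass_ne_zero t h

end OneStep

/-! ### Duality for the observables -/

section Duality

/-- Under a product of probability measures, a function of one coordinate is independent of a
function that does not depend on this coordinate. -/
theorem integral_pi_mul_of_update {ι : Type*} [Fintype ι] [DecidableEq ι] {α : ι → Type*}
    [∀ i, MeasurableSpace (α i)] [∀ i, Countable (α i)] [∀ i, MeasurableSingletonClass (α i)]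
    (P : ∀ i, Measure (α i)) [∀ i, IsProbabilityMeasure (P i)] (i : ι) (f : α i → ℝ)
    (h : (∀ i, α i) → ℝ) (hh : ∀ y z, (∀ j, j ≠ i → y j = z j) → h y = h z) :
    ∫ y, f (y i) * h y ∂Measure.pi P = (∫ z, f z ∂P i) * ∫ y, h y ∂Measure.pi P := by
  have hne : ∀ j, Nonempty (α j) := fun j => (inferInstance : NeZero (P j)).1 |> fun h0 => by
    by_contra hc
    rw [not_nonempty_iff] at hc
    exact h0 (Measure.eq_zero_of_isEmpty _)
  let ext : (∀ j : (({i}ᶜ : Finset ι) : Finset ι), α j) → ∀ j, α j := fun z j =>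
    if hj : j ∈ ({i}ᶜ : Finset ι) then z ⟨j, hj⟩ else Classical.choice (hne j)
  have hind := (iIndepFun_pi (μ := P) (X := fun _ => id)
    fun j => aemeasurable_id).indepFun_finset ({i} : Finset ι) {i}ᶜ disjoint_compl_right
      (fun j => measurable_pi_apply j)
  have hind2 := hind.comp (φ := fun z => f (z ⟨i, mem_singleton_self i⟩)) (ψ := fun z => h (ext z))
    Measurable.of_discrete Measurable.of_discrete
  have hext : ∀ y : ∀ j, α j, h (ext fun j => y j) = h y := by
    intro y
    refine hh _ _ fun j hj => ?_
    simp [ext, hj]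
  have h1 := hind2.integral_fun_mul_eq_mul_integral
    (Measurable.of_discrete.aestronglyMeasurable) (Measurable.of_discrete.aestronglyMeasurable)
  simp only [Function.comp_def, id, hext] at h1
  rw [h1]
  congr 1
  exact integral_comp_eval (μ := P) (i := i) (f := f) Measurable.of_discrete.aestronglyMeasurable

variable {q μ ν : ℝ} {N : ℕ}

/-- The quantity `q^{x_n + n}` attached to the particle labelled `n`; it vanishes for the virtual
particle `x_0 = +∞`. -/
def qPos (q : ℝ) (x : Config N) (n : ℕ) : ℝ :=
  if h : 1 ≤ n ∧ n ≤ N then q ^ (x ⟨n - 1, by omega⟩ + n) else 0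

/-- The observable `∏_{j<k} (q^{x_{n_j} + n_j} - q^j)` of `k` dual particles at the sites `n_j`, in
which the factors with `j < p` refer to the configuration `x` before a step, the others to the
configuration `y` after this step. -/
def mixedObs (q : ℝ) (x y : Config N) (k p : ℕ) (n : ℕ → ℕ) : ℝ :=
  ∏ j ∈ range k, ((if j < p then qPos q x (n j) else qPos q y (n j)) - q ^ j)

/-- The positions of the dual particles after the last ones of the cluster `p, …, p + m - 1`, from
the one with index `p + a` on, have moved from their site to the one ahead. -/
def moveCluster (n : ℕ → ℕ) (p a m : ℕ) (j : ℕ) : ℕ :=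
  if p + a ≤ j ∧ j < p + m then n j - 1 else n j

theorem qPos_congr (q : ℝ) {x y : Config N} {n : ℕ}
    (h : ∀ l : Fin N, l.val + 1 = n → x l = y l) : qPos q x n = qPos q y n := by
  unfold qPos
  split_ifs with hn
  · rw [h ⟨n - 1, by omega⟩ (by simp only; omega)]
  · rfl

theorem qPos_succ (q : ℝ) (x : Config N) (l : Fin N) :
    qPos q x (l.val + 1) = q ^ (x l + (l.val + 1 : ℕ)) := by
  rw [qPos, dif_pos ⟨by omega, by omega⟩]
  congr

theorem IsAdmissible.qPos_nonneg (hq0 : 0 < q) (x : Config N) (n : ℕ) :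
    0 ≤ qPos q x n := by
  unfold qPos
  split_ifs with hn
  · positivity
  · exact le_rfl

theorem IsAdmissible.qPos_le_one (hq0 : 0 < q) (hq1 : q < 1) {x : Config N} (hx : IsAdmissible x)
    (n : ℕ) : qPos q x n ≤ 1 := by
  unfold qPos
  split_ifs with hn
  · have h := hx.2 ⟨n - 1, by omega⟩
    have h2 : 0 ≤ x ⟨n - 1, by omega⟩ + n := by
      simp only at h
      omega
    lift x ⟨n - 1, by omega⟩ + (n : ℤ) to ℕ using h2 with e he
    rw [zpow_natCast]
    exact pow_le_one₀ hq0.le hq1.le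
  · exact zero_le_one

theorem abs_mixedObs_le (hq0 : 0 < q) (hq1 : q < 1) {x y : Config N} (hx : IsAdmissible x)
    (hy : IsAdmissible y) (k p : ℕ) (n : ℕ → ℕ) : |mixedObs q x y k p n| ≤ 1 := by
  rw [mixedObs, abs_prod]
  refine prod_le_one (fun _ _ => abs_nonneg _) fun j _ => ?_
  have h1 : q ^ j ≤ 1 := pow_le_one₀ hq0.le hq1.le
  have h2 : 0 ≤ q ^ j := pow_nonneg hq0.le j
  rw [abs_le]
  split_ifs
  · have h3 := IsAdmissible.qPos_nonneg hq0 x (n j)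
    have h4 := hx.qPos_le_one hq0 hq1 (n j)
    constructor <;> linarith
  · have h3 := IsAdmissible.qPos_nonneg hq0 y (n j)
    have h4 := hy.qPos_le_one hq0 hq1 (n j)
    constructor <;> linarith

/-- The `q`-gap relates the positions of neighbouring particles. -/
theorem IsAdmissible.qPos_mul_qGap (hq0 : 0 < q) {x : Config N} (hx : IsAdmissible x)
    (l : Fin N) : qPos q x (l.val + 1) * qGap q x l = qPos q x l.val := by
  rw [qPos_succ, qGap]
  split_ifs with h
  · rw [mul_zero, qPos, dif_neg (by omega)]
  · have h1 := hx.1 l h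
    have h2 : ((l.val : ℕ)) = (⟨l.val - 1, lt_of_le_of_lt (Nat.sub_le _ _) l.isLt⟩ : Fin N).val + 1 := by
      simp only
      omega
    conv_rhs => rw [h2]
    rw [qPos_succ, gap, ← zpow_natCast, Int.toNat_of_nonneg (by omega), ← zpow_add₀ hq0.ne']
    congr 1
    push_cast
    have h3 : ((l.val - 1 : ℕ) : ℤ) = l.val - 1 := by omega
    rw [h3]
    ring

/-- The average of a mixed observable over one step from `x`. -/
def condObs (q μ ν : ℝ) (x : Config N) (k p : ℕ) (n : ℕ → ℕ) : ℝ :=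
  ∫ y, mixedObs q x y k p n ∂Measure.pi (jumpMeasure q μ ν x)

/-- The expectation of a mixed observable. -/
def meanObs (q μ ν : ℝ) (N t k p : ℕ) (n : ℕ → ℕ) : ℝ :=
  ∫ x, condObs q μ ν x k p n ∂tasepLaw q μ ν N t

/-- The mixed observable after the step of a cluster: `a` factors stay at the site `i`, and `s`
factors have moved to `i - 1`; all of them refer to the configuration before the step. -/
theorem mixedObs_cluster (q : ℝ) (x y : Config N) (p s a r i : ℕ) (n : ℕ → ℕ)
    (hn : ∀ j < s + a, n (p + j) = i) :
    mixedObs q x y (p + (s + a) + r) (p + (s + a)) (moveCluster n p a (s + a)) =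
      (∏ j ∈ range p, (qPos q x (n j) - q ^ j)) *
        (qPow q (qPos q x i) (q ^ p) a * qPow q (qPos q x (i - 1)) (q ^ a * q ^ p) s) *
        ∏ j ∈ range r, (qPos q y (n (p + (s + a) + j)) - q ^ (p + (s + a) + j)) := by
  rw [mixedObs, prod_range_add, prod_range_add, add_comm s a, prod_range_add, add_comm a s]
  congr 1
  · congr 1
    · refine prod_congr rfl fun j hj => ?_
      have := mem_range.mp hj
      rw [if_pos (by omega), moveCluster, if_neg (by omega)]
    · congr 1
      · rw [qPow]
        refine prod_congr rfl fun j hj => ?_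
        have := mem_range.mp hj
        rw [if_pos (by omega), moveCluster, if_neg (by omega), hn j (by omega)]
        ring
      · rw [qPow]
        refine prod_congr rfl fun j hj => ?_
        have := mem_range.mp hj
        rw [if_pos (by omega), moveCluster, if_pos (by omega), hn (a + j) (by omega)]
        ring
  · refine prod_congr rfl fun j hj => ?_
    rw [if_neg (by omega), moveCluster, if_neg (by omega)]

variable (hq0 : 0 < q) (hq1 : q < 1) (hν : 0 ≤ ν) (hνμ : ν ≤ μ) (hμ : μ < 1)
include hq0 hq1 hν hνμ hμ

theorem integral_qPow_jumpMeasure {x : Config N} (hx : IsAdmissible x) (l : Fin N) {c : ℝ}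
    (hc : c ≠ 0) (m : ℕ) :
    ∫ z, qPow q (q ^ (z + ((l.val + 1 : ℕ) : ℤ))) c m ∂jumpMeasure q μ ν x l =
      ∑ w ∈ antidiagonal m, jumpWeight q μ (ν / μ) w.1 w.2 *
        (qPow q (qPos q x (l.val + 1)) c w.2 * qPow q (qPos q x l.val) (q ^ w.2 * c) w.1) := by
  have h := (hasQGap_particleJumpProb hq0 hq1 hν hνμ hμ x l).hasSum_qPow hq0 hq1 hν hνμ hμ
    (qPos q x (l.val + 1)) hc m
  rw [hx.qPos_mul_qGap hq0 l] at h
  have hX : ∀ j : ℕ, q ^ (x l + (j : ℤ) + ((l.val + 1 : ℕ) : ℤ)) = qPos q x (l.val + 1) * q ^ j := by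
    intro j
    rw [qPos_succ, ← zpow_natCast, ← zpow_add₀ hq0.ne']
    congr 1
    ring
  refine hasSum_integral_jumpMeasure hq0 hq1 hν hνμ hμ x l (C := (qPos q x (l.val + 1) + |c|) ^ m)
    (fun j => ?_) ?_
  · rw [hX, qPow, abs_prod, ← card_range m, ← prod_const, card_range]
    refine prod_le_prod (fun _ _ => abs_nonneg _) fun i _ => ?_
    have h0 := IsAdmissible.qPos_nonneg hq0 x (l.val + 1)
    have h1 : q ^ j ≤ 1 := pow_le_one₀ hq0.le hq1.le
    have h2 : 0 ≤ q ^ j := pow_nonneg hq0.le j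
    have h3 : q ^ i ≤ 1 := pow_le_one₀ hq0.le hq1.le
    have h4 : 0 ≤ q ^ i := pow_nonneg hq0.le i
    refine (abs_sub _ _).trans (add_le_add ?_ ?_)
    · rw [abs_of_nonneg (by positivity)]
      exact mul_le_of_le_one_right h0 h1
    · rw [abs_mul, abs_of_nonneg h4]
      exact mul_le_of_le_one_left (abs_nonneg c) h3
  · simpa only [hX] using h

/-- Averaging over the jump of the particle `i`, which carries the cluster `p, …, p + m - 1` of dual
particles. The later dual particles sit at smaller labels, so that their factors do not involve the
jump of the particle `i`; the averages over the other jumps remain. -/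
theorem condObs_cluster {x : Config N} (hx : IsAdmissible x) (p m r i : ℕ) (n : ℕ → ℕ)
    (hi : 1 ≤ i) (hiN : i ≤ N) (hn : ∀ j < m, n (p + j) = i) (hn' : ∀ j < r, n (p + m + j) < i) :
    condObs q μ ν x (p + m + r) p n = ∑ w ∈ antidiagonal m, jumpWeight q μ (ν / μ) w.1 w.2 *
      condObs q μ ν x (p + m + r) (p + m) (moveCluster n p w.2 m) := by
  have := isProbabilityMeasure_jumpMeasure hq0 hq1 hν hνμ hμ x
  let l : Fin N := ⟨i - 1, by omega⟩
  have hl : l.val + 1 = i := by simp only [l]; omega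
  have hl' : l.val = i - 1 := rfl
  set h : Config N → ℝ := fun y => ∏ j ∈ range r, (qPos q y (n (p + m + j)) - q ^ (p + m + j))
    with hh
  set A : ℝ := ∏ j ∈ range p, (qPos q x (n j) - q ^ j) with hA
  have e1 : ∀ y, mixedObs q x y (p + m + r) p n =
      A * (qPow q (q ^ (y l + ((l.val + 1 : ℕ) : ℤ))) (q ^ p) m * h y) := by
    intro y
    rw [mixedObs, prod_range_add, prod_range_add, hA, hh, mul_assoc]
    congr 1
    · refine prod_congr rfl fun j hj => ?_
      rw [if_pos (mem_range.mp hj)]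
    · congr 1
      · rw [qPow]
        refine prod_congr rfl fun j hj => ?_
        rw [if_neg (by omega), hn j (mem_range.mp hj), ← hl, qPos_succ, pow_add, mul_comm (q ^ p)]
      · refine prod_congr rfl fun j _ => ?_
        rw [if_neg (by omega)]
  have e2 : ∀ w ∈ antidiagonal m,
      condObs q μ ν x (p + m + r) (p + m) (moveCluster n p w.2 m) =
      A * (qPow q (qPos q x i) (q ^ p) w.2 * qPow q (qPos q x (i - 1)) (q ^ w.2 * q ^ p) w.1) *
        ∫ y, h y ∂Measure.pi (jumpMeasure q μ ν x) := by
    intro w hw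
    have hw' := HasAntidiagonal.mem_antidiagonal.mp hw
    subst hw'
    rw [condObs]
    simp_rw [mixedObs_cluster q x _ p w.1 w.2 r i n hn]
    rw [integral_const_mul]
  rw [sum_congr rfl fun w hw => by rw [e2 w hw], condObs]
  simp_rw [e1]
  rw [integral_const_mul, integral_pi_mul_of_update (jumpMeasure q μ ν x) l
    (fun z => qPow q (q ^ (z + ((l.val + 1 : ℕ) : ℤ))) (q ^ p) m) h,
    integral_qPow_jumpMeasure hq0 hq1 hν hνμ hμ hx l (pow_ne_zero p hq0.ne'), hl, hl', sum_mul,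
    mul_sum]
  · refine sum_congr rfl fun w _ => ?_
    ring
  · intro y z hyz
    refine prod_congr rfl fun j hj => ?_
    have := hn' j (mem_range.mp hj)
    rw [qPos_congr q fun l' hl'' => hyz l' ?_]
    rintro rfl
    omega

theorem abs_condObs_le {x : Config N} (hx : IsAdmissible x) (k p : ℕ) (n : ℕ → ℕ) :
    |condObs q μ ν x k p n| ≤ 1 := by
  have := isProbabilityMeasure_jumpMeasure hq0 hq1 hν hνμ hμ x
  have hy : ∀ᵐ y ∂Measure.pi (jumpMeasure q μ ν x), ‖mixedObs q x y k p n‖ ≤ 1 := by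
    rw [ae_iff_of_countable]
    intro y hy
    refine abs_mixedObs_le hq0 hq1 hx (hx.of_tasepStep_ne_zero (q := q) (μ := μ) (ν := ν) ?_) k p n
    rw [pi_jumpMeasure_singleton hq0 hq1 hν hνμ hμ] at hy
    exact fun h0 => hy (by rw [h0, ENNReal.ofReal_zero])
  simpa [condObs] using norm_integral_le_of_norm_le_const hy

theorem integrable_condObs (t k p : ℕ) (n : ℕ → ℕ) :
    Integrable (fun x : Config N => condObs q μ ν x k p n) (tasepLaw q μ ν N t) := by
  have := isProbabilityMeasure_tasepLaw (N := N) hq0 hq1 hν hνμ hμ t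
  refine Integrable.of_bound Measurable.of_discrete.aestronglyMeasurable 1 ?_
  filter_upwards [ae_isAdmissible (q := q) (μ := μ) (ν := ν) (N := N) t] with x hx
  exact abs_condObs_le hq0 hq1 hν hνμ hμ hx k p n

/-- The duality relation for expectations. Together with the boundary conditions
`meanObs_succ_of_eq_zero`, `meanObs_zero_right` and `meanObs_time_zero` it determines `meanObs`. -/
theorem meanObs_cluster (t p m r i : ℕ) (n : ℕ → ℕ) (hi : 1 ≤ i) (hiN : i ≤ N)
    (hn : ∀ j < m, n (p + j) = i) (hn' : ∀ j < r, n (p + m + j) < i) :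
    meanObs q μ ν N t (p + m + r) p n = ∑ w ∈ antidiagonal m, jumpWeight q μ (ν / μ) w.1 w.2 *
      meanObs q μ ν N t (p + m + r) (p + m) (moveCluster n p w.2 m) := by
  simp only [meanObs]
  simp_rw [← integral_const_mul]
  rw [← integral_finsetSum]
  · refine integral_congr_ae ?_
    filter_upwards [ae_isAdmissible (q := q) (μ := μ) (ν := ν) (N := N) t] with x hx
    exact condObs_cluster hq0 hq1 hν hνμ hμ hx p m r i n hi hiN hn hn'
  · intro w _
    exact (integrable_condObs hq0 hq1 hν hνμ hμ t _ _ _).const_mul _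

omit hq0 hq1 hν hνμ hμ in
/-- A factor attached to the virtual particle `x_0 = +∞` is constant. -/
theorem meanObs_succ_of_eq_zero (t k p : ℕ) (n : ℕ → ℕ) (hn : n k = 0) :
    meanObs q μ ν N t (k + 1) p n = -q ^ k * meanObs q μ ν N t k p n := by
  have h0 : ∀ x : Config N, qPos q x 0 = 0 := fun x => by rw [qPos, dif_neg (by omega)]
  simp only [meanObs, condObs]
  simp_rw [← integral_const_mul]
  refine integral_congr_ae (Eventually.of_forall fun x => integral_congr_ae
    (Eventually.of_forall fun y => ?_))
  simp only [mixedObs, prod_range_succ, hn, h0, ite_self]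
  ring

omit hq0 hq1 hν hνμ hμ in
theorem meanObs_of_le (t k p : ℕ) (hp : k ≤ p) (n : ℕ → ℕ) :
    meanObs q μ ν N t k p n = meanObs q μ ν N t k k n := by
  simp only [meanObs, condObs]
  refine integral_congr_ae (Eventually.of_forall fun x => integral_congr_ae
    (Eventually.of_forall fun y => prod_congr rfl fun j hj => ?_))
  have := mem_range.mp hj
  rw [if_pos this, if_pos (by omega)]

theorem meanObs_self (t k : ℕ) (n : ℕ → ℕ) :
    meanObs q μ ν N t k k n =
      ∫ x, ∏ j ∈ range k, (qPos q x (n j) - q ^ j) ∂tasepLaw q μ ν N t := by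
  simp only [meanObs, condObs]
  refine integral_congr_ae (Eventually.of_forall fun x => ?_)
  have := isProbabilityMeasure_jumpMeasure hq0 hq1 hν hνμ hμ x
  have : ∀ y, mixedObs q x y k k n = ∏ j ∈ range k, (qPos q x (n j) - q ^ j) := fun y =>
    prod_congr rfl fun j hj => by rw [if_pos (mem_range.mp hj)]
  simp only [this, integral_const, probReal_univ, one_smul]

/-- A step with no factor before it is a full step of the chain. -/
theorem meanObs_zero_right (t k : ℕ) (n : ℕ → ℕ) :
    meanObs q μ ν N t k 0 n = meanObs q μ ν N (t + 1) k k n := by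
  have := isProbabilityMeasure_tasepLaw (N := N) hq0 hq1 hν hνμ hμ (t + 1)
  rw [meanObs_self hq0 hq1 hν hνμ hμ, integral_tasepLaw_succ hq0 hq1 hν hνμ hμ]
  · simp only [meanObs, condObs]
    refine integral_congr_ae (Eventually.of_forall fun x => integral_congr_ae
      (Eventually.of_forall fun y => prod_congr rfl fun j _ => ?_))
    rw [if_neg (by omega)]
  · refine Integrable.of_bound Measurable.of_discrete.aestronglyMeasurable 1 ?_
    filter_upwards [ae_isAdmissible (q := q) (μ := μ) (ν := ν) (N := N) (t + 1)] with x hx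
    have h := abs_mixedObs_le hq0 hq1 hx hx k 0 n
    simpa [mixedObs, abs_prod] using h

/-- At time zero the first factor vanishes. -/
theorem meanObs_time_zero (k : ℕ) (hk : 1 ≤ k) (n : ℕ → ℕ) (hn : 1 ≤ n 0) (hnN : n 0 ≤ N) :
    meanObs q μ ν N 0 k k n = 0 := by
  rw [meanObs_self hq0 hq1 hν hνμ hμ, tasepLaw_zero, integral_dirac]
  refine prod_eq_zero (mem_range.mpr hk) ?_
  rw [qPos, dif_pos ⟨hn, hnN⟩, stepConfig]
  have : (-(((n 0 - 1 : ℕ) : ℤ) + 1) + (n 0 : ℤ)) = 0 := by omega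
  rw [this]
  simp

end Duality

/-! ### Averages over a power of a circle -/

section Torus

variable {c : ℂ} {r : ℝ} {k : ℕ}

/-- The `k`-fold contour integral `∮⋯∮ F(w) ∏ dw_a/(2πi)` over a circle. -/
def torusAvg (c : ℂ) (r : ℝ) (k : ℕ) (F : (Fin k → ℂ) → ℂ) : ℂ :=
  ((2 * (Real.pi : ℂ) * Complex.I)⁻¹) ^ k * torusIntegral F (fun _ => c) (fun _ => r)

/-- The `k`-th power of a circle, as a subset of `ℂ^k`. -/
def torusSet (c : ℂ) (r : ℝ) (k : ℕ) : Set (Fin k → ℂ) := {w | ∀ i, w i ∈ Metric.sphere c r}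

theorem torusMap_mem_torusSet (hr : 0 ≤ r) (θ : Fin k → ℝ) :
    torusMap (fun _ => c) (fun _ => r) θ ∈ torusSet c r k := fun i => by
  have := circleMap_mem_sphere c hr (θ i)
  simpa [torusMap, circleMap] using this

theorem continuous_torusMap : Continuous (torusMap (fun _ : Fin k => c) (fun _ => r)) := by
  unfold torusMap
  fun_prop

theorem torusIntegrable_of_continuousOn (hr : 0 ≤ r) {F : (Fin k → ℂ) → ℂ}
    (hF : ContinuousOn F (torusSet c r k)) : TorusIntegrable F (fun _ => c) (fun _ => r) := by
  have h : Continuous fun θ : Fin k → ℝ => F (torusMap (fun _ => c) (fun _ => r) θ) :=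
    hF.comp_continuous continuous_torusMap (torusMap_mem_torusSet hr)
  exact h.continuousOn.integrableOn_compact isCompact_Icc

theorem torusAvg_congr (hr : 0 ≤ r) {F G : (Fin k → ℂ) → ℂ}
    (h : ∀ w ∈ torusSet c r k, F w = G w) : torusAvg c r k F = torusAvg c r k G := by
  simp only [torusAvg, torusIntegral]
  congr 1
  refine integral_congr_ae (Eventually.of_forall fun θ => ?_)
  simp only [h _ (torusMap_mem_torusSet hr θ)]

theorem torusAvg_const_mul (a : ℂ) (F : (Fin k → ℂ) → ℂ) :
    torusAvg c r k (fun w => a * F w) = a * torusAvg c r k F := by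
  rw [torusAvg, torusAvg, torusIntegral_const_mul]
  ring

theorem torusAvg_sum (hr : 0 ≤ r) {ι : Type*} (s : Finset ι) (F : ι → (Fin k → ℂ) → ℂ)
    (hF : ∀ i ∈ s, ContinuousOn (F i) (torusSet c r k)) :
    torusAvg c r k (fun w => ∑ i ∈ s, F i w) = ∑ i ∈ s, torusAvg c r k (F i) := by
  simp only [torusAvg, torusIntegral]
  rw [← mul_sum, ← integral_finsetSum]
  · congr 2
    funext θ
    rw [smul_sum]
  · intro i hi
    exact (torusIntegrable_of_continuousOn hr (hF i hi)).function_integrable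

theorem torusAvg_neg (F : (Fin k → ℂ) → ℂ) :
    torusAvg c r k (fun w => -F w) = -torusAvg c r k F := by
  simpa using torusAvg_const_mul (c := c) (r := r) (-1) F

theorem torusAvg_sub (hr : 0 ≤ r) {F G : (Fin k → ℂ) → ℂ} (hF : ContinuousOn F (torusSet c r k))
    (hG : ContinuousOn G (torusSet c r k)) :
    torusAvg c r k (fun w => F w - G w) = torusAvg c r k F - torusAvg c r k G := by
  rw [torusAvg, torusIntegral_sub (torusIntegrable_of_continuousOn hr hF)
    (torusIntegrable_of_continuousOn hr hG), mul_sub]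
  rfl

theorem torusAvg_comp_perm (σ : Equiv.Perm (Fin k)) (F : (Fin k → ℂ) → ℂ) :
    torusAvg c r k (fun w => F (w ∘ σ)) = torusAvg c r k F := by
  simp only [torusAvg, torusIntegral]
  congr 1
  have hmp := volume_measurePreserving_piCongrLeft (fun _ : Fin k => ℝ) σ.symm
  have hap : ∀ θ : Fin k → ℝ, MeasurableEquiv.piCongrLeft (fun _ : Fin k => ℝ) σ.symm θ = θ ∘ σ := by
    intro θ
    funext i
    obtain ⟨j, rfl⟩ := σ.symm.surjective i
    simp [MeasurableEquiv.coe_piCongrLeft, Equiv.piCongrLeft_apply_apply]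
  have hpre : (MeasurableEquiv.piCongrLeft (fun _ : Fin k => ℝ) σ.symm) ⁻¹'
      (Set.Icc (0 : Fin k → ℝ) fun _ => 2 * Real.pi) = Set.Icc 0 fun _ => 2 * Real.pi := by
    ext θ
    simp only [Set.mem_preimage, hap, Set.mem_Icc, Pi.le_def, Function.comp_apply]
    constructor
    · rintro ⟨h1, h2⟩
      refine ⟨fun i => ?_, fun i => ?_⟩
      · simpa using h1 (σ.symm i)
      · simpa using h2 (σ.symm i)
    · rintro ⟨h1, h2⟩
      exact ⟨fun i => h1 (σ i), fun i => h2 (σ i)⟩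
  conv_rhs => rw [← hmp.setIntegral_preimage_emb (MeasurableEquiv.measurableEmbedding _), hpre]
  refine setIntegral_congr_fun measurableSet_Icc fun θ _ => ?_
  simp only [hap, Function.comp_apply]
  congr 1
  exact (Equiv.prod_comp σ fun i => (r : ℂ) * Complex.exp (θ i * Complex.I) * Complex.I).symm

/-- Fubini's theorem: the integral over the coordinate `i` may be performed first. -/
theorem torusAvg_succ (hr : 0 ≤ r) (i : Fin (k + 1)) {F : (Fin (k + 1) → ℂ) → ℂ}
    (hF : ContinuousOn F (torusSet c r (k + 1))) :
    torusAvg c r (k + 1) F =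
      torusAvg c r k fun y => (2 * (Real.pi : ℂ) * Complex.I)⁻¹ *
        ∮ z in C(c, r), F (i.insertNth z y) := by
  have hf := torusIntegrable_of_continuousOn hr hF
  set e : ℝ × (Fin k → ℝ) ≃ᵐ (Fin (k + 1) → ℝ) :=
    (MeasurableEquiv.piFinSuccAbove (fun _ => ℝ) i).symm
  have hem : MeasurePreserving e :=
    (volume_preserving_piFinSuccAbove (fun _ : Fin (k + 1) => ℝ) i).symm _
  have heπ : (e ⁻¹' Set.Icc 0 fun _ => 2 * Real.pi) =
      Set.Icc 0 (2 * Real.pi) ×ˢ Set.Icc (0 : Fin k → ℝ) fun _ => 2 * Real.pi :=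
    ((Fin.insertNthOrderIso (fun _ => ℝ) i).preimage_Icc _ _).trans (Set.Icc_prod_eq _ _)
  rw [torusAvg, torusAvg, torusIntegral_const_mul, pow_succ, mul_assoc]
  congr 2
  rw [torusIntegral, ← hem.map_eq, setIntegral_map_equiv, heπ, Measure.volume_eq_prod,
    ← Measure.prod_restrict, integral_prod_symm, torusIntegral]
  · refine setIntegral_congr_fun measurableSet_Icc fun Θ _ => ?_
    rw [circleIntegral_def_Icc, ← integral_smul]
    refine setIntegral_congr_fun measurableSet_Icc fun θ _ => ?_
    have h1 : torusMap (fun _ => c) (fun _ => r) (e (θ, Θ)) =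
        i.insertNth (circleMap c r θ) (torusMap (fun _ => c) (fun _ => r) Θ) := by
      funext j
      refine Fin.succAboveCases i ?_ (fun j => ?_) j
      · simp [e, torusMap, circleMap, MeasurableEquiv.piFinSuccAbove_symm_apply, Fin.insertNthEquiv]
      · simp [e, torusMap, MeasurableEquiv.piFinSuccAbove_symm_apply, Fin.insertNthEquiv]
    have h2 : ∏ j, (r : ℂ) * Complex.exp ((e (θ, Θ) j : ℝ) * Complex.I) * Complex.I =
        deriv (circleMap c r) θ * ∏ j, (r : ℂ) * Complex.exp (Θ j * Complex.I) * Complex.I := by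
      rw [i.prod_univ_succAbove]
      simp [e, MeasurableEquiv.piFinSuccAbove_symm_apply, Fin.insertNthEquiv, deriv_circleMap,
        circleMap]
    simp only [h1, h2, smul_eq_mul]
    ring
  · have := hf.function_integrable
    rw [← hem.integrableOn_comp_preimage e.measurableEmbedding, heπ] at this
    rw [Measure.prod_restrict]
    exact this

end Torus

/-! ### Circle integrals of functions holomorphic outside the circle -/

/-- The integral over a circle of a function holomorphic outside the circle, which is
`o(1/z)` at infinity, vanishes. -/
theorem circleIntegral_eq_zero_of_exterior {c : ℂ} {r : ℝ} (hr : 0 < r) {f : ℂ → ℂ}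
    (hf : ∀ z, z ∉ Metric.ball c r → DifferentiableAt ℂ f z)
    (hlim : Tendsto (fun z => ‖z - c‖ * ‖f z‖) (Bornology.cobounded ℂ) (𝓝 0)) :
    ∮ z in C(c, r), f z = 0 := by
  have heq : ∀ R, r ≤ R → ∮ z in C(c, R), f z = ∮ z in C(c, r), f z := fun R hR =>
    Complex.circleIntegral_eq_of_differentiable_on_annulus_off_countable hr hR
      (s := ∅) Set.countable_empty
      (fun z hz => (hf z hz.2).continuousAt.continuousWithinAt)
      (fun z hz => hf z fun hb => hz.1.2 (Metric.ball_subset_closedBall hb))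
  rw [← norm_le_zero_iff]
  refine le_of_forall_pos_le_add fun ε hε => ?_
  have hε' : 0 < ε / (2 * Real.pi) := by positivity
  have h1 : ∀ᶠ z in Bornology.cobounded ℂ, ‖z - c‖ * ‖f z‖ < ε / (2 * Real.pi) :=
    hlim.eventually (gt_mem_nhds hε')
  obtain ⟨M, -, hM⟩ := (Metric.hasBasis_cobounded_compl_closedBall c).eventually_iff.mp h1
  set R := max r (M + 1) with hR
  have hRr : r ≤ R := le_max_left _ _
  have hR0 : 0 < R := hr.trans_le hRr
  rw [← heq R hRr]
  have hb : ∀ z ∈ Metric.sphere c R, ‖f z‖ ≤ ε / (2 * Real.pi) / R := by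
    intro z hz
    have hz' : ‖z - c‖ = R := by rwa [← dist_eq_norm]
    have : z ∈ (Metric.closedBall c M)ᶜ := by
      rw [Set.mem_compl_iff, Metric.mem_closedBall, dist_eq_norm, hz', not_le]
      have := le_max_right r (M + 1)
      linarith
    have h2 := hM this
    simp only [hz'] at h2
    rw [le_div_iff₀ hR0, mul_comm]
    exact h2.le
  have h3 := circleIntegral.norm_integral_le_of_norm_le_const hR0.le hb
  rw [zero_add]
  refine h3.trans (le_of_eq ?_)
  field_simp

/-! ### The nested integrals and their exchange relation -/

section Nested

/-- The factor `∏_{a<b} (w_a - w_b) / (w_a - q w_b)`. -/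
def crossWeight (q : ℂ) {k : ℕ} (w : Fin k → ℂ) : ℂ :=
  ∏ i, ∏ j, if i < j then (w i - w j) / (w i - q * w j) else 1

/-- The integral of `crossWeight` times a product of functions of one variable. All variables run
over the same circle around `0`: then `q w` is inside the circle for `w` on it, so that the poles of
the cross terms are harmless and no nested contours are needed. -/
def nestedInt (q c : ℂ) (r : ℝ) (k : ℕ) (ρ : ℕ → ℂ → ℂ) : ℂ :=
  torusAvg c r k fun w => crossWeight q w * ∏ j, ρ j.val (w j)

variable {q : ℝ} {c : ℂ} {r : ℝ} {k : ℕ}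

/-- A disc containing `0` is mapped into its interior by multiplication with `q`. -/
theorem mul_mem_ball (hq0 : 0 < q) (hq1 : q < 1) (h0 : (0 : ℂ) ∈ Metric.ball c r) {z : ℂ}
    (hz : z ∈ Metric.closedBall c r) : (q : ℂ) * z ∈ Metric.ball c r := by
  rw [Metric.mem_ball, dist_eq_norm] at h0 ⊢
  rw [Metric.mem_closedBall, dist_eq_norm] at hz
  have e : (q : ℂ) * z - c = (q : ℂ) * (z - c) + ((1 - q : ℝ) : ℂ) * (0 - c) := by
    push_cast
    ring
  rw [e]
  refine (norm_add_le _ _).trans_lt ?_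
  rw [norm_mul, norm_mul, Complex.norm_real, Complex.norm_real, Real.norm_of_nonneg hq0.le,
    Real.norm_of_nonneg (by linarith)]
  nlinarith

theorem sub_mul_ne_zero (hq0 : 0 < q) (hq1 : q < 1) (h0 : (0 : ℂ) ∈ Metric.ball c r) {w z : ℂ}
    (hw : w ∉ Metric.ball c r) (hz : z ∈ Metric.closedBall c r) : w - (q : ℂ) * z ≠ 0 := fun h =>
  hw (by rw [sub_eq_zero.mp h]; exact mul_mem_ball hq0 hq1 h0 hz)

theorem notMem_ball_of_mem_sphere {z : ℂ} (hz : z ∈ Metric.sphere c r) : z ∉ Metric.ball c r := by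
  rw [Metric.mem_sphere] at hz
  rw [Metric.mem_ball, hz]
  exact lt_irrefl _

theorem continuousOn_crossWeight (hq0 : 0 < q) (hq1 : q < 1) (h0 : (0 : ℂ) ∈ Metric.ball c r) :
    ContinuousOn (crossWeight (q : ℂ) (k := k)) (torusSet c r k) := by
  unfold crossWeight
  refine continuousOn_finsetProd _ fun i _ => continuousOn_finsetProd _ fun j _ => ?_
  split_ifs
  · refine ContinuousOn.div (by fun_prop) (by fun_prop) fun w hw => ?_
    exact sub_mul_ne_zero hq0 hq1 h0 (notMem_ball_of_mem_sphere (hw i))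
      (Metric.sphere_subset_closedBall (hw j))
  · fun_prop

theorem continuousOn_prod_coord {ρ : ℕ → ℂ → ℂ}
    (hρ : ∀ j, ContinuousOn (ρ j) (Metric.sphere c r)) :
    ContinuousOn (fun w : Fin k → ℂ => ∏ j, ρ j.val (w j)) (torusSet c r k) :=
  continuousOn_finsetProd _ fun j _ =>
    (hρ j).comp (continuous_apply j).continuousOn fun _ hw => hw j

theorem crossWeight_snoc (Q : ℂ) (y : Fin k → ℂ) (z : ℂ) :
    crossWeight Q ((Fin.last k).insertNth z y : Fin (k + 1) → ℂ) =
      crossWeight Q y * ∏ i, (y i - z) / (y i - Q * z) := by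
  rw [crossWeight, crossWeight, Fin.prod_univ_castSucc, ← prod_mul_distrib]
  have h1 : ∀ j : Fin (k + 1), ¬ Fin.last k < j := fun j => not_lt.mpr (Fin.le_last j)
  simp only [h1, if_false, prod_const_one, mul_one]
  refine prod_congr rfl fun i _ => ?_
  rw [Fin.prod_univ_castSucc, if_pos (Fin.castSucc_lt_last i)]
  simp

theorem crossWeight_cons (Q : ℂ) (y : Fin k → ℂ) (z : ℂ) :
    crossWeight Q ((0 : Fin (k + 1)).insertNth z y : Fin (k + 1) → ℂ) =
      (∏ i, (z - y i) / (z - Q * y i)) * crossWeight Q y := by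
  rw [crossWeight, crossWeight, Fin.prod_univ_succ]
  congr 1
  · rw [Fin.prod_univ_succ, if_neg (lt_irrefl _), one_mul]
    refine prod_congr rfl fun i _ => ?_
    rw [if_pos (Fin.succ_pos i)]
    simp
  · refine prod_congr rfl fun i _ => ?_
    rw [Fin.prod_univ_succ, if_neg (Fin.not_lt_zero _), one_mul]
    simp

/-- Exchanging two adjacent arguments only affects one factor of `crossWeight`. -/
theorem crossWeight_swap (Q : ℂ) (w : Fin k → ℂ) (a b : Fin k) (hab : a.val + 1 = b.val)
    (h1 : w a - Q * w b ≠ 0) (h2 : w b - Q * w a ≠ 0) :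
    crossWeight Q (w ∘ Equiv.swap a b) * (w b - Q * w a) =
      -(crossWeight Q w * (w a - Q * w b)) := by
  set f : Fin k × Fin k → ℂ := fun p => (w p.1 - w p.2) / (w p.1 - Q * w p.2) with hf
  set τ := Equiv.swap a b with hτ
  have hne : a ≠ b := fun h => by rw [h] at hab; omega
  have e1 : crossWeight Q w = ∏ p : Fin k × Fin k, if p.1 < p.2 then f p else 1 := by
    rw [crossWeight, Fintype.prod_prod_type]
  have e2 : crossWeight Q (w ∘ τ) =
      ∏ p : Fin k × Fin k, if τ p.1 < τ p.2 then f p else 1 := by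
    rw [crossWeight, Fintype.prod_prod_type, ← Equiv.prod_comp τ]
    refine prod_congr rfl fun i _ => ?_
    rw [← Equiv.prod_comp τ]
    refine prod_congr rfl fun j _ => ?_
    simp [hf, hτ]
  have hmem1 : (a, b) ∈ (univ : Finset (Fin k × Fin k)) := mem_univ _
  have hmem2 : (b, a) ∈ (univ : Finset (Fin k × Fin k)).erase (a, b) := by
    simp [hne, hne.symm]
  -- apart from the two pairs formed by `a` and `b`, the order is preserved
  have hrest : ∏ p ∈ ((univ : Finset (Fin k × Fin k)).erase (a, b)).erase (b, a),
        (if τ p.1 < τ p.2 then f p else 1) =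
      ∏ p ∈ ((univ : Finset (Fin k × Fin k)).erase (a, b)).erase (b, a),
        if p.1 < p.2 then f p else 1 := by
    refine prod_congr rfl fun p hp => ?_
    have hp1 : p ≠ (b, a) := (mem_erase.mp hp).1
    have hp2 : p ≠ (a, b) := (mem_erase.mp (mem_erase.mp hp).2).1
    obtain ⟨i, j⟩ := p
    have hiff : τ i < τ j ↔ i < j := by
      simp only [ne_eq, Prod.mk.injEq, not_and] at hp1 hp2
      rw [hτ, Equiv.swap_apply_def, Equiv.swap_apply_def]
      split_ifs with c1 c2 c3 c4 c5 c6 <;> simp only [Fin.lt_def, Fin.ext_iff] at * <;> omega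
    simp only [hiff]
  have hlt : a < b := by rw [Fin.lt_def]; omega
  rw [e1, e2, ← mul_prod_erase _ _ hmem1, ← mul_prod_erase _ _ hmem2,
    ← mul_prod_erase univ (fun p => if p.1 < p.2 then f p else 1) hmem1,
    ← mul_prod_erase _ (fun p => if p.1 < p.2 then f p else 1) hmem2, hrest]
  simp only [hτ, Equiv.swap_apply_left, Equiv.swap_apply_right, if_pos hlt,
    if_neg (not_lt.mpr hlt.le), hf]
  have g1 := div_mul_cancel₀ (w b - w a) h2
  have g2 := div_mul_cancel₀ (w a - w b) h1
  generalize (∏ p ∈ ((univ : Finset (Fin k × Fin k)).erase (a, b)).erase (b, a),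
    if p.1 < p.2 then (w p.1 - w p.2) / (w p.1 - Q * w p.2) else 1) = C
  linear_combination C * g1 + C * g2

/-- The exchange relation: if the remaining factor is symmetric in two adjacent variables, the
integrand is antisymmetric in these, and the integral vanishes. -/
theorem torusAvg_exchange (hq0 : 0 < q) (hq1 : q < 1) (h0 : (0 : ℂ) ∈ Metric.ball c r)
    (a b : Fin k) (hab : a.val + 1 = b.val) (h : (Fin k → ℂ) → ℂ)
    (hh : ∀ w, h (w ∘ Equiv.swap a b) = h w) :
    torusAvg c r k (fun w => crossWeight (q : ℂ) w * (w a - q * w b) * h w) = 0 := by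
  have hr : 0 ≤ r := (dist_nonneg.trans_lt (Metric.mem_ball.mp h0)).le
  have h1 := torusAvg_comp_perm (c := c) (r := r) (Equiv.swap a b)
    (fun w => crossWeight (q : ℂ) w * (w a - q * w b) * h w)
  have h2 : torusAvg c r k (fun w => crossWeight (q : ℂ) (w ∘ Equiv.swap a b) *
      ((w ∘ Equiv.swap a b) a - q * (w ∘ Equiv.swap a b) b) * h (w ∘ Equiv.swap a b)) =
      torusAvg c r k (fun w => -(crossWeight (q : ℂ) w * (w a - q * w b) * h w)) := by
    refine torusAvg_congr hr fun w hw => ?_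
    have := crossWeight_swap (q : ℂ) w a b hab
      (sub_mul_ne_zero hq0 hq1 h0 (notMem_ball_of_mem_sphere (hw a))
        (Metric.sphere_subset_closedBall (hw b)))
      (sub_mul_ne_zero hq0 hq1 h0 (notMem_ball_of_mem_sphere (hw b))
        (Metric.sphere_subset_closedBall (hw a)))
    simp only [Function.comp_apply, Equiv.swap_apply_left, Equiv.swap_apply_right, hh] at this ⊢
    rw [this]
    ring
  rw [h2, torusAvg_neg] at h1
  exact self_eq_neg.mp h1.symm

/-- A function on the subsets of an interval `{p, …, p + m - 1}` that gains a factor `Q` when an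
element moves down by one is determined by its values at initial segments. -/
theorem eq_pow_mul_of_exchange (Q : ℂ) (p m : ℕ) (lam : Finset ℕ → ℂ)
    (hlam : ∀ S j, S ⊆ Ico p (p + m) → p ≤ j → j + 1 < p + m → j ∉ S → j + 1 ∉ S →
      lam (insert j S) = Q * lam (insert (j + 1) S)) :
    ∃ κ : ℕ → ℂ, ∀ S ⊆ Ico p (p + m),
      lam S = Q ^ (∑ j ∈ S, (p + m - 1 - j)) * κ S.card ∨ Q = 0 := by
  by_cases hQ : Q = 0
  · exact ⟨0, fun S _ => Or.inr hQ⟩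
  refine ⟨fun s => lam (Ico p (p + s)) / Q ^ (∑ j ∈ Ico p (p + s), (p + m - 1 - j)), ?_⟩
  -- the normalised values are constant along moves `j + 1 ↦ j`, by induction on the sum of `S`
  suffices h : ∀ n, ∀ S ⊆ Ico p (p + m), ∑ j ∈ S, j = n →
      lam S / Q ^ (∑ j ∈ S, (p + m - 1 - j)) =
        lam (Ico p (p + S.card)) / Q ^ (∑ j ∈ Ico p (p + S.card), (p + m - 1 - j)) by
    intro S hS
    left
    beta_reduce
    rw [← h _ S hS rfl, mul_div_cancel₀ _ (pow_ne_zero _ hQ)]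
  intro n
  induction n using Nat.strong_induction_on with
  | _ n ih =>
    intro S hS hn
    by_cases hdown : ∀ j, p ≤ j → j + 1 ∈ S → j ∈ S
    · have hsub : S ⊆ Ico p (p + S.card) := by
        intro x hx
        have hxp := (mem_Ico.mp (hS hx)).1
        have hall : ∀ d, d ≤ x - p → x - d ∈ S := by
          intro d
          induction d with
          | zero => exact fun _ => hx
          | succ d ihd =>
            intro hd
            have h1 := ihd (by omega)
            refine hdown (x - (d + 1)) (by omega) ?_
            have : x - (d + 1) + 1 = x - d := by omega
            rwa [this]
        have hIcc : Icc p x ⊆ S := fun y hy => by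
          have := mem_Icc.mp hy
          have h2 := hall (x - y) (by omega)
          have : x - (x - y) = y := by omega
          rwa [this] at h2
        have hc := card_le_card hIcc
        rw [Nat.card_Icc] at hc
        rw [mem_Ico]
        omega
      have : S = Ico p (p + S.card) := eq_of_subset_of_card_le hsub (by simp)
      rw [← this]
    · push Not at hdown
      obtain ⟨j, hpj, hj1, hj⟩ := hdown
      have hjm := mem_Ico.mp (hS hj1)
      set S' := S.erase (j + 1) with hS'
      have hS'sub : S' ⊆ Ico p (p + m) := (erase_subset _ _).trans hS
      have hjS' : j ∉ S' := fun h => hj (mem_of_mem_erase h)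
      have hj1S' : j + 1 ∉ S' := notMem_erase _ _
      have hins : insert (j + 1) S' = S := insert_erase hj1
      have hrel := hlam S' j hS'sub hpj hjm.2 hjS' hj1S'
      have hsumS : ∑ i ∈ S, i = (j + 1) + ∑ i ∈ S', i := by rw [← hins, sum_insert hj1S']
      have hsumT : ∑ i ∈ insert j S', i = j + ∑ i ∈ S', i := sum_insert hjS'
      have hcard : (insert j S').card = S.card := by
        rw [← hins, card_insert_of_notMem hjS', card_insert_of_notMem hj1S']
      have h3 := ih (j + ∑ i ∈ S', i) (by omega) (insert j S')
        (insert_subset (mem_Ico.mpr (by omega)) hS'sub) hsumT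
      rw [hcard] at h3
      rw [← h3, hrel, hins, sum_insert hjS', ← hins, sum_insert hj1S', hins]
      have : p + m - 1 - j = (p + m - 1 - (j + 1)) + 1 := by omega
      rw [this, pow_add, pow_add, pow_add]
      field_simp

theorem prod_coord_extend (f : ℕ → ℂ → ℂ) (p m : ℕ) (hk : p + m ≤ k) (ρ : ℕ → ℂ → ℂ)
    (w : Fin k → ℂ) :
    ∏ j : Fin k, ρ j.val (w j) * (if j.val ∈ Ico p (p + m) then f j.val (w j) else 1) =
      (∏ j : Fin k, ρ j.val (w j)) *
        ∏ j ∈ Ico p (p + m), f j (if h : j < k then w ⟨j, h⟩ else 0) := by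
  rw [prod_mul_distrib]
  congr 1
  have h1 : ∀ j : Fin k, (if j.val ∈ Ico p (p + m) then f j.val (w j) else 1) =
      (fun i : ℕ => if i ∈ Ico p (p + m) then f i (if h : i < k then w ⟨i, h⟩ else 0) else 1)
        j.val := by
    intro j
    simp
  rw [prod_congr rfl fun j _ => h1 j, Fin.prod_univ_eq_prod_range
    (fun i : ℕ => if i ∈ Ico p (p + m) then f i (if h : i < k then w ⟨i, h⟩ else 0) else 1) k,
    prod_ite_mem]
  refine prod_congr ?_ fun _ _ => rfl
  rw [inter_eq_right]
  intro j hj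
  have := mem_Ico.mp hj
  exact mem_range.mpr (by omega)

/-- Linear relations between nested integrals with a cluster of equal factors: a product `∏_j (1 -
d_j w_j)` over the cluster may be replaced by a linear combination of such products as soon as this
is true after the substitution `w_j = q^{p+m-1-j} y` with a single variable `y`. Indeed, by the
exchange relation the integral of `∏_{j∈S} w_j` is `∏_{j∈S} q^{p+m-1-j}` times a number that depends
on the cardinality of `S` only. -/
theorem nestedInt_cluster (hq0 : 0 < q) (hq1 : q < 1) (h0 : (0 : ℂ) ∈ Metric.ball c r)
    {ρ : ℕ → ℂ → ℂ} (hρ : ∀ j, ContinuousOn (ρ j) (Metric.sphere c r)) (p m : ℕ) (hk : p + m ≤ k)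
    (hcl : ∀ j ∈ Ico p (p + m), ρ j = ρ p) {ι : Type*} (s : Finset ι) (α : ι → ℂ)
    (d : ℕ → ℂ) (e : ι → ℕ → ℂ)
    (hpoly : ∀ y : ℂ, ∏ j ∈ Ico p (p + m), (1 - d j * (q : ℂ) ^ (p + m - 1 - j) * y) =
      ∑ i ∈ s, α i * ∏ j ∈ Ico p (p + m), (1 - e i j * (q : ℂ) ^ (p + m - 1 - j) * y)) :
    nestedInt q c r k (fun j z => ρ j z * if j ∈ Ico p (p + m) then 1 - d j * z else 1) =
      ∑ i ∈ s, α i *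
        nestedInt q c r k (fun j z => ρ j z * if j ∈ Ico p (p + m) then 1 - e i j * z else 1) := by
  have hr : 0 ≤ r := (dist_nonneg.trans_lt (Metric.mem_ball.mp h0)).le
  set lam : Finset ℕ → ℂ := fun S =>
    nestedInt q c r k (fun j z => ρ j z * if j ∈ S then z else 1) with hlam
  have hlamc : ∀ S : Finset ℕ, ContinuousOn (fun w : Fin k → ℂ => crossWeight (q : ℂ) w *
      ∏ j, (fun j z => ρ j z * if j ∈ S then z else 1) j.val (w j)) (torusSet c r k) := by
    intro S
    refine (continuousOn_crossWeight hq0 hq1 h0).mul (continuousOn_prod_coord (ρ := fun j z =>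
      ρ j z * if j ∈ S then z else 1) fun j => (hρ j).mul ?_)
    split_ifs <;> fun_prop
  -- expansion of a product of linear factors
  have hexp : ∀ d : ℕ → ℂ,
      nestedInt q c r k (fun j z => ρ j z * if j ∈ Ico p (p + m) then 1 - d j * z else 1) =
        ∑ S ∈ (Ico p (p + m)).powerset, (∏ j ∈ S, -d j) * lam S := by
    intro d
    simp only [hlam, nestedInt]
    simp_rw [← torusAvg_const_mul]
    rw [← torusAvg_sum hr]
    · refine torusAvg_congr hr fun w _ => ?_
      rw [prod_coord_extend (fun j z => 1 - d j * z) p m hk]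
      simp only [sub_eq_add_neg]
      rw [prod_one_add, mul_sum, mul_sum]
      refine sum_congr rfl fun S hS => ?_
      have hS' := mem_powerset.mp hS
      have h1 : ∏ j : Fin k, ρ j.val (w j) * (if j.val ∈ S then w j else 1) =
          (∏ j : Fin k, ρ j.val (w j)) * ∏ j ∈ S, (if h : j < k then w ⟨j, h⟩ else 0) := by
        have h2 := prod_coord_extend (fun j z => if j ∈ S then z else 1) p m hk ρ w
        rw [prod_ite_mem, inter_eq_right.mpr hS'] at h2
        rw [← h2]
        refine prod_congr rfl fun j _ => ?_
        congr 1
        by_cases hj : j.val ∈ S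
        · simp [hj, hS' hj]
        · simp [hj]
      have h3 : ∏ j ∈ S, -(d j * (if h : j < k then w ⟨j, h⟩ else 0)) =
          (∏ j ∈ S, -d j) * ∏ j ∈ S, (if h : j < k then w ⟨j, h⟩ else 0) := by
        rw [← prod_mul_distrib]
        exact prod_congr rfl fun _ _ => by ring
      rw [h1, h3]
      ring
    · intro S _
      exact continuousOn_const.mul (hlamc S)
  -- the exchange relation for the coefficients
  have hex : ∀ S j, S ⊆ Ico p (p + m) → p ≤ j → j + 1 < p + m → j ∉ S → j + 1 ∉ S →
      lam (insert j S) = (q : ℂ) * lam (insert (j + 1) S) := by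
    intro S j hS hpj hjm hj hj1
    set a : Fin k := ⟨j, by omega⟩ with ha
    set b : Fin k := ⟨j + 1, by omega⟩ with hb
    have hne : a ≠ b := by simp [ha, hb]
    have hρab : ρ a.val = ρ b.val := by
      rw [hcl a.val (mem_Ico.mpr ⟨hpj, by simp [ha]; omega⟩),
        hcl b.val (mem_Ico.mpr ⟨by simp [hb]; omega, by simpa [hb] using hjm⟩)]
    have hρj : ρ (j + 1) = ρ j := hρab.symm
    set h : (Fin k → ℂ) → ℂ := fun w => ∏ i, ρ i.val (w i) * (if i.val ∈ S then w i else 1) with hh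
    have hsymm : ∀ w, h (w ∘ Equiv.swap a b) = h w := by
      intro w
      simp only [hh]
      rw [← Equiv.prod_comp (Equiv.swap a b)]
      refine prod_congr rfl fun i _ => ?_
      rcases eq_or_ne i a with rfl | hia
      · simp [hρj, ha, hb, hj, hj1]
      · rcases eq_or_ne i b with rfl | hib
        · simp [hρj, ha, hb, hj, hj1]
        · simp [Equiv.swap_apply_of_ne_of_ne hia hib]
    have hz := torusAvg_exchange hq0 hq1 h0 a b rfl h hsymm
    have hins : ∀ (x : Fin k), x.val ∉ S → ∀ w : Fin k → ℂ,
        ∏ i, ρ i.val (w i) * (if i.val ∈ insert x.val S then w i else 1) = w x * h w := by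
      intro x hx w
      rw [hh]
      beta_reduce
      rw [← mul_prod_erase univ _ (mem_univ x), ← mul_prod_erase univ _ (mem_univ x)]
      have : ∀ i ∈ univ.erase x, ρ i.val (w i) * (if i.val ∈ insert x.val S then w i else 1) =
          ρ i.val (w i) * (if i.val ∈ S then w i else 1) := by
        intro i hi
        have hix : i.val ≠ x.val := fun h => (mem_erase.mp hi).1 (Fin.ext h)
        simp [mem_insert, hix]
      rw [prod_congr rfl this]
      simp [hx]
      ring
    have e1 : lam (insert j S) - (q : ℂ) * lam (insert (j + 1) S) = 0 := by
      rw [← hz]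
      simp only [hlam, nestedInt]
      rw [← torusAvg_const_mul]
      have hc2 : ContinuousOn (fun w : Fin k → ℂ => (q : ℂ) * (crossWeight (q : ℂ) w *
          ∏ i, ρ i.val (w i) * if i.val ∈ insert (j + 1) S then w i else 1)) (torusSet c r k) :=
        continuousOn_const.mul (hlamc _)
      refine (torusAvg_sub hr (hlamc _) hc2).symm.trans ?_
      refine torusAvg_congr hr fun w _ => ?_
      have h1 := hins a hj w
      have h2 := hins b hj1 w
      simp only [ha, hb] at h1 h2 ⊢
      rw [h1, h2]
      ring
    exact sub_eq_zero.mp e1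
  obtain ⟨κ, hκ⟩ := eq_pow_mul_of_exchange (q : ℂ) p m lam hex
  have hqne : (q : ℂ) ≠ 0 := by exact_mod_cast hq0.ne'
  have hκ' : ∀ S ⊆ Ico p (p + m), lam S = (q : ℂ) ^ (∑ j ∈ S, (p + m - 1 - j)) * κ S.card :=
    fun S hS => (hκ S hS).resolve_right hqne
  -- the linear functional on polynomials that represents the integrals
  let L : Polynomial ℂ →ₗ[ℂ] ℂ := Polynomial.lsum fun n => (κ n) • LinearMap.id
  have hL : ∀ d : ℕ → ℂ,
      nestedInt q c r k (fun j z => ρ j z * if j ∈ Ico p (p + m) then 1 - d j * z else 1) =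
      L (∏ j ∈ Ico p (p + m),
        (1 - Polynomial.C (d j * (q : ℂ) ^ (p + m - 1 - j)) * Polynomial.X)) := by
    intro d
    rw [hexp d]
    simp only [sub_eq_add_neg]
    rw [prod_one_add, map_sum]
    refine sum_congr rfl fun S hS => ?_
    have h1 : ∏ j ∈ S, -(Polynomial.C (d j * (q : ℂ) ^ (p + m - 1 - j)) * Polynomial.X) =
        Polynomial.monomial S.card (∏ j ∈ S, -(d j * (q : ℂ) ^ (p + m - 1 - j))) := by
      rw [← Polynomial.C_mul_X_pow_eq_monomial, map_prod, ← prod_const, ← prod_mul_distrib]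
      exact prod_congr rfl fun j _ => by rw [map_neg, neg_mul]
    rw [h1, hκ' S (mem_powerset.mp hS)]
    simp only [L, Polynomial.lsum_apply, LinearMap.smul_apply, LinearMap.id_apply, smul_eq_mul]
    rw [Polynomial.sum_monomial_index _ _ (by simp), ← prod_pow_eq_pow_sum]
    have : ∏ j ∈ S, -(d j * (q : ℂ) ^ (p + m - 1 - j)) =
        (∏ j ∈ S, -d j) * ∏ j ∈ S, (q : ℂ) ^ (p + m - 1 - j) := by
      rw [← prod_mul_distrib]
      exact prod_congr rfl fun j _ => by ring
    rw [this]
    ring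
  have hP : ∏ j ∈ Ico p (p + m),
        (1 - Polynomial.C (d j * (q : ℂ) ^ (p + m - 1 - j)) * Polynomial.X) =
      ∑ i ∈ s, α i • ∏ j ∈ Ico p (p + m),
        (1 - Polynomial.C (e i j * (q : ℂ) ^ (p + m - 1 - j)) * Polynomial.X) := by
    refine Polynomial.funext fun y => ?_
    simpa [Polynomial.eval_prod, Polynomial.eval_finsetSum] using hpoly y
  rw [hL, hP, map_sum]
  refine sum_congr rfl fun i _ => ?_
  rw [map_smul, smul_eq_mul, hL]

end Nested

/-! ### The moment formula -/

section Moment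

theorem nestedInt_congr {Q c : ℂ} {r : ℝ} (hr : 0 ≤ r) {k : ℕ} {ρ ρ' : ℕ → ℂ → ℂ}
    (h : ∀ j < k, ∀ z ∈ Metric.sphere c r, ρ j z = ρ' j z) :
    nestedInt Q c r k ρ = nestedInt Q c r k ρ' :=
  torusAvg_congr hr fun w hw => by
    congr 1
    exact prod_congr rfl fun j _ => h j.val j.isLt _ (hw j)

theorem nestedInt_zero (Q c : ℂ) (r : ℝ) (ρ : ℕ → ℂ → ℂ) : nestedInt Q c r 0 ρ = 1 := by
  simp [nestedInt, torusAvg, torusIntegral_dim0, crossWeight]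

theorem continuousOn_crossWeight_mul {q : ℝ} (hq0 : 0 < q) (hq1 : q < 1) {c : ℂ} {r : ℝ}
    (h0 : (0 : ℂ) ∈ Metric.ball c r) {k : ℕ} {ρ : ℕ → ℂ → ℂ}
    (hρ : ∀ j, ContinuousOn (ρ j) (Metric.sphere c r)) :
    ContinuousOn (fun w : Fin k → ℂ => crossWeight (q : ℂ) w * ∏ j, ρ j.val (w j))
      (torusSet c r k) :=
  (continuousOn_crossWeight hq0 hq1 h0).mul (continuousOn_prod_coord hρ)

/-- A last factor `f(z)/z` with `f` holomorphic and `f(0) = 1` integrates to `1`, as the only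
singularity inside the circle is the pole at `0`, where the cross terms are equal to `1`. -/
theorem nestedInt_succ_of_pole {q : ℝ} (hq0 : 0 < q) (hq1 : q < 1) {c : ℂ} {r : ℝ}
    (h0 : (0 : ℂ) ∈ Metric.ball c r) {k : ℕ} {ρ : ℕ → ℂ → ℂ}
    (hρ : ∀ j, ContinuousOn (ρ j) (Metric.sphere c r)) {f : ℂ → ℂ}
    (hf : DifferentiableOn ℂ f (Metric.closedBall c r)) (hf0 : f 0 = 1)
    (hfρ : ∀ z ∈ Metric.sphere c r, ρ k z = f z / z) :
    nestedInt q c r (k + 1) ρ = nestedInt q c r k ρ := by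
  have hr : 0 ≤ r := (dist_nonneg.trans_lt (Metric.mem_ball.mp h0)).le
  have hy0 : ∀ {z : ℂ}, z ∈ Metric.sphere c r → z ≠ 0 := fun hz h =>
    notMem_ball_of_mem_sphere hz (h ▸ h0)
  rw [nestedInt, torusAvg_succ hr (Fin.last k)
    (continuousOn_crossWeight_mul hq0 hq1 h0 hρ), nestedInt]
  refine torusAvg_congr hr fun y hy => ?_
  have hd : DifferentiableOn ℂ (fun z => (∏ i, (y i - z) / (y i - q * z)) * f z)
      (Metric.closedBall c r) := by
    refine DifferentiableOn.mul (DifferentiableOn.fun_finsetProd fun i _ => ?_) hf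
    refine DifferentiableOn.div (by fun_prop) (by fun_prop) fun z hz => ?_
    exact sub_mul_ne_zero hq0 hq1 h0 (notMem_ball_of_mem_sphere (hy i)) hz
  have hC := hd.circleIntegral_sub_inv_smul h0
  have e1 : (∮ z in C(c, r), crossWeight (q : ℂ) ((Fin.last k).insertNth z y : Fin (k + 1) → ℂ) *
      ∏ j : Fin (k + 1), ρ j.val (((Fin.last k).insertNth z y : Fin (k + 1) → ℂ) j)) =
      ∮ z in C(c, r), (crossWeight (q : ℂ) y * ∏ j : Fin k, ρ j.val (y j)) *
        ((z - 0)⁻¹ • ((∏ i, (y i - z) / (y i - q * z)) * f z)) := by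
    refine circleIntegral.integral_congr hr fun z hz => ?_
    rw [crossWeight_snoc, Fin.prod_univ_castSucc]
    simp only [Fin.insertNth_apply_same, Fin.val_last, hfρ z hz, Fin.insertNth_last',
      Fin.snoc_castSucc, Fin.val_castSucc, sub_zero, smul_eq_mul]
    rw [div_eq_mul_inv (f z)]
    ring
  rw [e1, circleIntegral.integral_const_mul, hC]
  have e2 : ∏ i, (y i - 0) / (y i - q * 0) = 1 :=
    prod_eq_one fun i _ => by rw [mul_zero, sub_zero, div_self (hy0 (hy i))]
  rw [e2, hf0, smul_eq_mul, mul_one, mul_one, mul_left_comm, inv_mul_cancel₀ Complex.two_pi_I_ne_zero,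
    mul_one]

theorem tendsto_moebius_cobounded (a b d e : ℂ) (he : e ≠ 0) :
    Tendsto (fun z : ℂ => (a + b * z) / (d + e * z)) (Bornology.cobounded ℂ) (𝓝 (b / e)) := by
  have hi : Tendsto (fun z : ℂ => z⁻¹) (Bornology.cobounded ℂ) (𝓝 0) := tendsto_inv₀_cobounded
  have h1 : Tendsto (fun z : ℂ => (a * z⁻¹ + b) / (d * z⁻¹ + e)) (Bornology.cobounded ℂ)
      (𝓝 ((a * 0 + b) / (d * 0 + e))) :=
    ((hi.const_mul a).add_const b).div ((hi.const_mul d).add_const e) (by simpa using he)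
  simp only [mul_zero, zero_add] at h1
  refine h1.congr' ?_
  filter_upwards [Bornology.eventually_ne_cobounded (0 : ℂ)] with z hz
  rw [← mul_div_mul_right _ _ hz]
  congr 1 <;> field_simp

/-- A first factor holomorphic outside the circle and `o(1/z)` at infinity makes the nested
integral vanish. -/
theorem nestedInt_succ_eq_zero {q : ℝ} (hq0 : 0 < q) (hq1 : q < 1) {c : ℂ} {r : ℝ}
    (h0 : (0 : ℂ) ∈ Metric.ball c r) {k : ℕ} {ρ : ℕ → ℂ → ℂ}
    (hρ : ∀ j, ContinuousOn (ρ j) (Metric.sphere c r)) {f : ℂ → ℂ}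
    (hf : ∀ z, z ∉ Metric.ball c r → DifferentiableAt ℂ f z)
    (hlim : Tendsto (fun z => ‖z - c‖ * ‖f z‖) (Bornology.cobounded ℂ) (𝓝 0))
    (hfρ : ∀ z ∈ Metric.sphere c r, ρ 0 z = f z) :
    nestedInt q c r (k + 1) ρ = 0 := by
  have hr0 : 0 < r := dist_nonneg.trans_lt (Metric.mem_ball.mp h0)
  have hr := hr0.le
  rw [nestedInt, torusAvg_succ hr 0
    (continuousOn_crossWeight_mul hq0 hq1 h0 hρ)]
  have hz : torusAvg c r k (fun _ => 0) = 0 := by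
    simpa using torusAvg_const_mul (c := c) (r := r) (k := k) 0 (fun _ => 0)
  rw [← hz]
  refine torusAvg_congr hr fun y hy => ?_
  have e1 : (∮ z in C(c, r), crossWeight (q : ℂ) ((0 : Fin (k + 1)).insertNth z y : Fin (k + 1) → ℂ) *
      ∏ j : Fin (k + 1), ρ j.val (((0 : Fin (k + 1)).insertNth z y : Fin (k + 1) → ℂ) j)) =
      ∮ z in C(c, r), (crossWeight (q : ℂ) y * ∏ j : Fin k, ρ (j.val + 1) (y j)) *
        ((∏ i, (z - y i) / (z - q * y i)) * f z) := by
    refine circleIntegral.integral_congr hr fun z hz => ?_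
    rw [crossWeight_cons, Fin.prod_univ_succ]
    simp only [Fin.insertNth_zero', Fin.cons_zero, Fin.cons_succ, Fin.val_zero, Fin.val_succ,
      hfρ z hz]
    ring
  have hzero : ∮ z in C(c, r), (∏ i, (z - y i) / (z - q * y i)) * f z = 0 := by
    refine circleIntegral_eq_zero_of_exterior hr0 (fun z hz => ?_) ?_
    · refine DifferentiableAt.mul (DifferentiableAt.fun_finsetProd fun i _ => ?_) (hf z hz)
      refine DifferentiableAt.div (by fun_prop) (by fun_prop) ?_
      exact sub_mul_ne_zero hq0 hq1 h0 hz (Metric.sphere_subset_closedBall (hy i))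
    · have h1 : Tendsto (fun z : ℂ => ∏ i, (z - y i) / (z - q * y i)) (Bornology.cobounded ℂ)
          (𝓝 (∏ _i : Fin k, 1)) := by
        refine tendsto_finsetProd _ fun i _ => ?_
        have := tendsto_moebius_cobounded (-y i) 1 (-(q * y i)) 1 one_ne_zero
        rw [div_one] at this
        exact this.congr fun z => by ring
      rw [prod_const_one] at h1
      have h2 := (h1.norm).mul hlim
      rw [mul_zero] at h2
      refine h2.congr fun z => ?_
      rw [norm_mul]
      ring
  rw [e1, circleIntegral.integral_const_mul, hzero, mul_zero, mul_zero]

/-- The factor `((1-νz)/(1-z))^n ((1-μz)/(1-νz))^e / (z(1-νz))` of the moment formula, for a dual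
particle at the site `n` and the time `e`. -/
def stepFactor (μ ν : ℝ) (n e : ℕ) (z : ℂ) : ℂ :=
  ((1 - ν * z) / (1 - z)) ^ n * ((1 - μ * z) / (1 - ν * z)) ^ e / (z * (1 - ν * z))

/-- The nested contour integral with factors `stepFactor (n_j) (e_j)`. -/
def stepInt (q μ ν : ℝ) (c : ℂ) (r : ℝ) (k : ℕ) (n e : ℕ → ℕ) : ℂ :=
  (∏ j ∈ range k, -(q : ℂ) ^ j) * nestedInt q c r k fun j => stepFactor μ ν (n j) (e j)

variable {q μ ν : ℝ} {N : ℕ} {c : ℂ} {r : ℝ}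

theorem one_sub_mul_ne_zero (hout : ν ≠ 0 → (ν : ℂ)⁻¹ ∉ Metric.closedBall c r) {z : ℂ}
    (hz : z ∈ Metric.closedBall c r) : 1 - (ν : ℂ) * z ≠ 0 := by
  intro h
  have h1 : (ν : ℂ) * z = 1 := (sub_eq_zero.mp h).symm
  have h2 : ν ≠ 0 := by
    rintro rfl
    simp at h1
  exact hout h2 (by rwa [inv_eq_of_mul_eq_one_right h1])

theorem continuousOn_stepFactor (h0 : (0 : ℂ) ∈ Metric.ball c r) (h1 : (1 : ℂ) ∈ Metric.ball c r)
    (hout : ν ≠ 0 → (ν : ℂ)⁻¹ ∉ Metric.closedBall c r) (n e : ℕ) :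
    ContinuousOn (stepFactor μ ν n e) (Metric.sphere c r) := by
  have hν : ∀ z ∈ Metric.sphere c r, 1 - (ν : ℂ) * z ≠ 0 := fun z hz =>
    one_sub_mul_ne_zero hout (Metric.sphere_subset_closedBall hz)
  have hz0 : ∀ z ∈ Metric.sphere c r, z ≠ 0 := fun z hz h =>
    notMem_ball_of_mem_sphere hz (h ▸ h0)
  have hz1 : ∀ z ∈ Metric.sphere c r, 1 - z ≠ 0 := fun z hz h =>
    notMem_ball_of_mem_sphere hz (sub_eq_zero.mp h ▸ h1)
  unfold stepFactor
  refine ContinuousOn.div (ContinuousOn.mul (ContinuousOn.pow (ContinuousOn.div (by fun_prop)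
    (by fun_prop) hz1) _) (ContinuousOn.pow (ContinuousOn.div (by fun_prop)
    (by fun_prop) hν) _)) (by fun_prop) fun z hz => mul_ne_zero (hz0 z hz) (hν z hz)

theorem stepInt_congr (hr : 0 ≤ r) {k : ℕ} {n e e' : ℕ → ℕ} (h : ∀ j < k, e j = e' j) :
    stepInt q μ ν c r k n e = stepInt q μ ν c r k n e' := by
  rw [stepInt, stepInt, nestedInt_congr hr]
  intro j hj z _
  rw [h j hj]

/-- The boundary condition `meanObs_succ_of_eq_zero` for the nested integrals. -/
theorem stepInt_succ_of_eq_zero (hq0 : 0 < q) (hq1 : q < 1) (h0 : (0 : ℂ) ∈ Metric.ball c r)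
    (h1 : (1 : ℂ) ∈ Metric.ball c r) (hout : ν ≠ 0 → (ν : ℂ)⁻¹ ∉ Metric.closedBall c r)
    (k : ℕ) (n e : ℕ → ℕ) (hn : n k = 0) :
    stepInt q μ ν c r (k + 1) n e = -(q : ℂ) ^ k * stepInt q μ ν c r k n e := by
  rw [stepInt, stepInt, prod_range_succ]
  rw [nestedInt_succ_of_pole hq0 hq1 h0 (fun j => continuousOn_stepFactor h0 h1 hout _ _)
    (f := fun z => ((1 - μ * z) / (1 - ν * z)) ^ (e k) / (1 - ν * z))]
  · ring
  · have : ∀ z ∈ Metric.closedBall c r, 1 - (ν : ℂ) * z ≠ 0 := fun z => one_sub_mul_ne_zero hout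
    refine DifferentiableOn.div (DifferentiableOn.fun_pow (DifferentiableOn.div (by fun_prop)
      (by fun_prop) this) _) (by fun_prop) this
  · simp
  · intro z _
    rw [stepFactor, hn, pow_zero, one_mul, div_div, mul_comm z]

/-- The initial condition `meanObs_time_zero` for the nested integrals: at time `0` the first
variable has no pole outside the circle, the point `1/ν` included. -/
theorem stepInt_time_zero (hq0 : 0 < q) (hq1 : q < 1) (h0 : (0 : ℂ) ∈ Metric.ball c r)
    (h1 : (1 : ℂ) ∈ Metric.ball c r) (hout : ν ≠ 0 → (ν : ℂ)⁻¹ ∉ Metric.closedBall c r)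
    (k : ℕ) (n e : ℕ → ℕ) (hn : 1 ≤ n 0) (he : e 0 = 0) :
    stepInt q μ ν c r (k + 1) n e = 0 := by
  obtain ⟨m, hm⟩ : ∃ m, n 0 = m + 1 := ⟨n 0 - 1, by omega⟩
  rw [stepInt, nestedInt_succ_eq_zero hq0 hq1 h0
    (fun j => continuousOn_stepFactor h0 h1 hout _ _)
    (f := fun z => ((1 - ν * z) / (1 - z)) ^ m * (1 / (1 - z) * (1 / z))), mul_zero]
  · intro z hz
    have hz0 : z ≠ 0 := fun h => hz (h ▸ h0)
    have hz1 : 1 - z ≠ 0 := fun h => hz (sub_eq_zero.mp h ▸ h1)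
    refine DifferentiableAt.mul (DifferentiableAt.fun_pow (DifferentiableAt.div (by fun_prop)
      (by fun_prop) hz1) _) ((DifferentiableAt.div (by fun_prop) (by fun_prop)
      hz1).mul (DifferentiableAt.div (by fun_prop) (by fun_prop) hz0))
  · have t1 := (tendsto_moebius_cobounded 1 (-ν) 1 (-1) (by simp)).pow m
    have t2 := tendsto_moebius_cobounded (-c) 1 0 1 one_ne_zero
    have t3 := tendsto_moebius_cobounded 1 0 1 (-1) (by simp)
    have t := ((t1.mul t2).mul t3).norm
    rw [zero_div, mul_zero, norm_zero] at t
    refine t.congr fun z => ?_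
    rw [← norm_mul]
    congr 1
    simp only [← sub_eq_add_neg, neg_mul, one_mul, zero_add, zero_mul, add_zero]
    ring
  · intro z hz
    have hz0 : z ≠ 0 := fun h => notMem_ball_of_mem_sphere hz (h ▸ h0)
    have hz1 : 1 - z ≠ 0 := fun h => notMem_ball_of_mem_sphere hz (sub_eq_zero.mp h ▸ h1)
    have hzν := one_sub_mul_ne_zero hout (Metric.sphere_subset_closedBall hz)
    rw [stepFactor, hm, he, pow_zero, mul_one, pow_succ]
    field_simp

theorem prod_Ico_eq_qPoch (Q x : ℂ) (p m : ℕ) :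
    ∏ j ∈ Ico p (p + m), (1 - x * Q ^ (p + m - 1 - j)) = qPoch x Q m := by
  rw [qPoch, prod_Ico_eq_prod_range, add_tsub_cancel_left, ← prod_range_reflect]
  refine prod_congr rfl fun j hj => ?_
  have := mem_range.mp hj
  congr 3
  omega

theorem qPoch_add_mul_pow (Q x : ℂ) (s a p m : ℕ) (h : s + a = m) :
    ∏ j ∈ Ico p (p + a), (1 - x * Q ^ (p + m - 1 - j)) = qPoch (x * Q ^ s) Q a := by
  rw [← prod_Ico_eq_qPoch Q (x * Q ^ s) p a]
  refine prod_congr rfl fun j hj => ?_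
  have := mem_Ico.mp hj
  rw [mul_assoc, ← pow_add]
  congr 3
  omega

theorem ofReal_qPoch (a : ℝ) (n : ℕ) : ((qPoch a q n : ℝ) : ℂ) = qPoch (a : ℂ) q n := by
  simp [qPoch]

theorem ofReal_jumpWeight (ρ : ℝ) (s a : ℕ) :
    ((jumpWeight q μ ρ s a : ℝ) : ℂ) = jumpWeight (q : ℂ) μ ρ s a := by
  simp [jumpWeight, ofReal_qPoch]

/-- The nested integrals satisfy the same recursion `meanObs_cluster` as the expectations. Up to
common factors, a later time puts a factor `1 - μ w`, and a move to the next site a factor `1 - w`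
in place of `1 - ν w`, so that `nestedInt_cluster` reduces the claim to `sum_jumpWeight_mul_qPoch`.
-/
theorem stepInt_cluster (hq0 : 0 < q) (hq1 : q < 1) (hν : 0 ≤ ν) (hνμ : ν ≤ μ) (hμ : μ < 1)
    (h0 : (0 : ℂ) ∈ Metric.ball c r)
    (h1 : (1 : ℂ) ∈ Metric.ball c r) (hout : ν ≠ 0 → (ν : ℂ)⁻¹ ∉ Metric.closedBall c r)
    (t p m k i : ℕ) (hk : p + m ≤ k) (n : ℕ → ℕ) (hi : 1 ≤ i) (hn : ∀ j < m, n (p + j) = i) :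
    stepInt q μ ν c r k n (fun j => if p ≤ j then t + 1 else t) =
      ∑ w ∈ HasAntidiagonal.antidiagonal m, ((jumpWeight q μ (ν / μ) w.1 w.2 : ℝ) : ℂ) *
        stepInt q μ ν c r k (moveCluster n p w.2 m) (fun j => if p + m ≤ j then t + 1 else t) := by
  have hr : 0 ≤ r := (dist_nonneg.trans_lt (Metric.mem_ball.mp h0)).le
  set ρ : ℕ → ℂ → ℂ := fun j z => if j ∈ Ico p (p + m) then
    stepFactor μ ν i t z * (1 / (1 - ν * z))
    else stepFactor μ ν (n j) (if p ≤ j then t + 1 else t) z with hρdef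
  have hν' : ∀ z ∈ Metric.sphere c r, 1 - (ν : ℂ) * z ≠ 0 := fun z hz =>
    one_sub_mul_ne_zero hout (Metric.sphere_subset_closedBall hz)
  have hρ : ∀ j, ContinuousOn (ρ j) (Metric.sphere c r) := by
    intro j
    simp only [hρdef]
    split_ifs
    · exact (continuousOn_stepFactor h0 h1 hout _ _).mul
        (ContinuousOn.div (by fun_prop) (by fun_prop) hν')
    all_goals exact continuousOn_stepFactor h0 h1 hout _ _
  have hcl : ∀ j ∈ Ico p (p + m), ρ j = ρ p := by
    intro j hj
    have hj' := mem_Ico.mp hj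
    have : p ∈ Ico p (p + m) := mem_Ico.mpr (by omega)
    simp only [hρdef, hj, this, if_true]
  have hqn : ∀ n, qPoch (q : ℂ) (q : ℂ) n ≠ 0 := fun n => by
    rw [← ofReal_qPoch]
    exact_mod_cast (qPoch_pos hq0.le hq1 hq1 n).ne'
  have hμν : (μ : ℂ) * ((ν / μ : ℝ) : ℂ) = ν := by
    rw [← Complex.ofReal_mul, mul_div_self_of_le hν hνμ]
  have hνn : ∀ n, qPoch ((μ : ℂ) * ((ν / μ : ℝ) : ℂ)) (q : ℂ) n ≠ 0 := fun n => by
    rw [hμν, ← ofReal_qPoch]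
    exact_mod_cast (qPoch_pos hq0.le hq1 (hνμ.trans_lt hμ) n).ne'
  have key := nestedInt_cluster hq0 hq1 h0 hρ p m hk hcl (HasAntidiagonal.antidiagonal m)
    (fun w => ((jumpWeight q μ (ν / μ) w.1 w.2 : ℝ) : ℂ)) (fun _ => μ)
    (fun w j => if p + w.2 ≤ j then 1 else ν) (by
      intro y
      have e1 : ∏ j ∈ Ico p (p + m), (1 - (μ : ℂ) * (q : ℂ) ^ (p + m - 1 - j) * y) =
          qPoch ((μ : ℂ) * y) q m := by
        rw [← prod_Ico_eq_qPoch _ _ p m]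
        exact prod_congr rfl fun j _ => by ring
      rw [e1, ← sum_jumpWeight_mul_qPoch hqn (μ : ℂ) ((ν / μ : ℝ) : ℂ) hνn]
      refine sum_congr rfl fun w hw => ?_
      have hw' := HasAntidiagonal.mem_antidiagonal.mp hw
      rw [ofReal_jumpWeight]
      congr 1
      rw [hμν, ← prod_Ico_consecutive _ (show p ≤ p + w.2 by omega)
        (show p + w.2 ≤ p + m by omega), mul_comm]
      congr 1
      · rw [← qPoch_add_mul_pow (q : ℂ) ((ν : ℂ) * y) w.1 w.2 p m hw']
        refine prod_congr rfl fun j hj => ?_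
        have := mem_Ico.mp hj
        rw [if_neg (by omega)]
        ring
      · have hpm : p + m = p + w.2 + w.1 := by omega
        rw [hpm, ← prod_Ico_eq_qPoch (q : ℂ) y (p + w.2) w.1]
        refine prod_congr rfl fun j hj => ?_
        have := mem_Ico.mp hj
        rw [if_pos (by omega)]
        ring)
  have e1 : nestedInt q c r k (fun j => stepFactor μ ν (n j) (if p ≤ j then t + 1 else t)) =
      nestedInt q c r k (fun j z => ρ j z * if j ∈ Ico p (p + m) then 1 - μ * z else 1) := by
    refine nestedInt_congr hr fun j hj z hz => ?_
    simp only [hρdef]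
    split_ifs with c1 c2 c3
    · have := mem_Ico.mp c2
      obtain ⟨d, rfl⟩ : ∃ d, j = p + d := ⟨j - p, by omega⟩
      rw [hn d (by omega), stepFactor, stepFactor, pow_succ]
      ring
    · rw [mul_one]
    · have := mem_Ico.mp c3
      omega
    · rw [mul_one]
  have e2 : ∀ w ∈ HasAntidiagonal.antidiagonal m,
      nestedInt q c r k (fun j => stepFactor μ ν (moveCluster n p w.2 m j)
        (if p + m ≤ j then t + 1 else t)) =
      nestedInt q c r k (fun j z => ρ j z * if j ∈ Ico p (p + m) then
        1 - (if p + w.2 ≤ j then 1 else (ν : ℂ)) * z else 1) := by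
    intro w hw
    have hw' := HasAntidiagonal.mem_antidiagonal.mp hw
    refine nestedInt_congr hr fun j hj z hz => ?_
    have hz0 : z ≠ 0 := fun h => notMem_ball_of_mem_sphere hz (h ▸ h0)
    have hz1 : 1 - z ≠ 0 := fun h => notMem_ball_of_mem_sphere hz (sub_eq_zero.mp h ▸ h1)
    have hzν := hν' z hz
    simp only [hρdef, moveCluster]
    by_cases c1 : j ∈ Ico p (p + m)
    · have c1' := mem_Ico.mp c1
      obtain ⟨d, rfl⟩ : ∃ d, j = p + d := ⟨j - p, by omega⟩
      have hnd := hn d (by omega)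
      rw [if_neg (by omega : ¬ p + m ≤ p + d)]
      simp only [c1, if_true]
      by_cases c2 : p + w.2 ≤ p + d
      · rw [if_pos ⟨c2, c1'.2⟩, if_pos c2, hnd]
        obtain ⟨i', rfl⟩ : ∃ i', i = i' + 1 := ⟨i - 1, by omega⟩
        rw [add_tsub_cancel_right, stepFactor, stepFactor, pow_succ]
        field_simp
      · rw [if_neg (fun h => c2 h.1), if_neg c2, hnd]
        field_simp
    · have c1' : ¬ (p ≤ j ∧ j < p + m) := fun h => c1 (mem_Ico.mpr h)
      simp only [c1, if_false, mul_one]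
      rw [if_neg (by omega)]
      congr 1
      split_ifs <;> omega
  simp only [stepInt]
  rw [e1, key, mul_sum]
  refine sum_congr rfl fun w hw => ?_
  rw [e2 w hw]
  ring

/-- The expectations `meanObs` are nested contour integrals: both sides satisfy the same recursion
and boundary conditions. The induction is on the time, then on the number `k` of dual particles,
then on the number `k - p` of those which have not made the current step. -/
theorem meanObs_eq_stepInt (hq0 : 0 < q) (hq1 : q < 1) (hν : 0 ≤ ν) (hνμ : ν ≤ μ) (hμ : μ < 1)
    (h0 : (0 : ℂ) ∈ Metric.ball c r)
    (h1 : (1 : ℂ) ∈ Metric.ball c r) (hout : ν ≠ 0 → (ν : ℂ)⁻¹ ∉ Metric.closedBall c r)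
    (t k p : ℕ) (hp : p ≤ k) (n : ℕ → ℕ) (hn : ∀ j, j + 1 < k → n (j + 1) ≤ n j)
    (hN : ∀ j < k, n j ≤ N) :
    ((meanObs q μ ν N t k p n : ℝ) : ℂ) =
      stepInt q μ ν c r k n (fun j => if p ≤ j then t + 1 else t) := by
  have hr : 0 ≤ r := (dist_nonneg.trans_lt (Metric.mem_ball.mp h0)).le
  induction t generalizing k p n with
  | zero | succ t iht =>
    induction k generalizing p n with
    | zero =>
      have := isProbabilityMeasure_tasepLaw hq0 hq1 hν hνμ hμ (N := N)
      obtain rfl : p = 0 := by omega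
      rw [meanObs_self hq0 hq1 hν hνμ hμ]
      simp [stepInt, nestedInt_zero]
    | succ k ihk =>
      obtain ⟨d, hd⟩ : ∃ d, d = k + 1 - p := ⟨_, rfl⟩
      induction d using Nat.strong_induction_on generalizing p n with
      | _ d ihd =>
        by_cases hnk : n k = 0
        · rw [stepInt_succ_of_eq_zero hq0 hq1 h0 h1 hout k n _ hnk,
            meanObs_succ_of_eq_zero _ k p n hnk]
          push_cast
          congr 1
          rcases Nat.lt_or_ge k p with hpk | hpk
          · rw [meanObs_of_le _ k p hpk.le, ihk k le_rfl n (fun j hj => hn j (by omega))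
              (fun j hj => hN j (by omega))]
            refine stepInt_congr hr fun j hj => ?_
            rw [if_neg (by omega), if_neg (by omega)]
          · exact ihk p hpk n (fun j hj => hn j (by omega)) (fun j hj => hN j (by omega))
        have hanti : ∀ i j, i ≤ j → j < k + 1 → n j ≤ n i := by
          intro i j hij
          induction j, hij using Nat.le_induction with
          | base => exact fun _ => le_rfl
          | succ j hij ihj => exact fun hj => (hn j hj).trans (ihj (by omega))
        have hpos : ∀ j < k + 1, 1 ≤ n j := fun j hj => by
          have := hanti j k (by omega) (by omega)
          omega
        rcases hp.eq_or_lt with rfl | hpk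
        · first
          | rw [meanObs_time_zero hq0 hq1 hν hνμ hμ (k + 1) (by omega) n (hpos 0 (by omega))
              (hN 0 (by omega)), stepInt_time_zero hq0 hq1 h0 h1 hout k n _ (hpos 0 (by omega))
              (by simp)]
            simp
          | rw [← meanObs_zero_right hq0 hq1 hν hνμ hμ, iht (k + 1) 0 (by omega) n hn hN]
            refine stepInt_congr hr fun j hj => ?_
            rw [if_pos (by omega), if_neg (by omega)]
        -- the maximal cluster of sites equal to `n p`
        classical
        have hex : ∃ m, p + m = k + 1 ∨ n (p + m) ≠ n p := ⟨k + 1 - p, Or.inl (by omega)⟩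
        set m := Nat.find hex with hm
        have hmin : ∀ j < m, p + j ≠ k + 1 ∧ n (p + j) = n p := fun j hj => by
          simpa [not_or] using Nat.find_min hex hj
        have hm1 : 1 ≤ m := by
          by_contra hcon
          have : m = 0 := by omega
          have hs := Nat.find_spec hex
          rw [← hm, this] at hs
          simp at hs
          omega
        have hmk : p + m ≤ k + 1 := by
          by_contra hcon
          exact (hmin (k + 1 - p) (by omega)).1 (by omega)
        obtain ⟨s, hs⟩ : ∃ s, k + 1 = p + m + s := ⟨k + 1 - (p + m), by omega⟩
        have hlt : ∀ j < s, n (p + m + j) < n p := by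
          intro j hj
          have h2 : n (p + m) ≠ n p := (Nat.find_spec hex).resolve_left (by rw [← hm]; omega)
          have h3 := hanti p (p + m) (by omega) (by omega)
          have h4 := hanti (p + m) (p + m + j) (by omega) (by omega)
          omega
        rw [stepInt_cluster hq0 hq1 hν hνμ hμ h0 h1 hout _ p m (k + 1) (n p) hmk n
          (hpos p (by omega)) (fun j hj => (hmin j hj).2), hs,
          meanObs_cluster hq0 hq1 hν hνμ hμ _ p m s (n p) n (hpos p (by omega)) (hN p (by omega))
          (fun j hj => (hmin j hj).2) hlt]
        push_cast
        refine sum_congr rfl fun w hw => ?_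
        have hw' := HasAntidiagonal.mem_antidiagonal.mp hw
        congr 1
        rw [← hs]
        refine ihd (k + 1 - (p + m)) (by omega) (p + m) hmk (moveCluster n p w.2 m)
          (fun j hj => ?_) (fun j hj => ?_) rfl
        · have hnj := hn j hj
          simp only [moveCluster]
          split_ifs with c1 c2 c2
          · omega
          · omega
          · rcases Nat.lt_or_ge (j + 1) (p + m) with c3 | c3
            · omega
            · have h2 := hlt 0 (by omega)
              have h3 : j + 1 = p + m + 0 := by omega
              have h4 := (hmin (j - p) (by omega)).2
              have h5 : p + (j - p) = j := by omega
              rw [h5] at h4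
              rw [h3]
              omega
          · exact hnj
        · have := hN j hj
          simp only [moveCluster]
          split_ifs <;> omega

/-- The formula for the `q`-factorial moments of `q^{x_n + n}`. -/
theorem integral_prod_qPos_sub (hq0 : 0 < q) (hq1 : q < 1) (hν : 0 ≤ ν) (hνμ : ν ≤ μ) (hμ : μ < 1)
    (h0 : (0 : ℂ) ∈ Metric.ball c r)
    (h1 : (1 : ℂ) ∈ Metric.ball c r) (hout : ν ≠ 0 → (ν : ℂ)⁻¹ ∉ Metric.closedBall c r)
    (t k n : ℕ) (hn : n ≤ N) :
    ((∫ x : Config N, ∏ j ∈ range k, (qPos q x n - q ^ j) ∂(tasepLaw q μ ν N t) : ℝ) : ℂ) =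
      (∏ j ∈ range k, -(q : ℂ) ^ j) * nestedInt q c r k fun _ => stepFactor μ ν n t := by
  have hr : 0 ≤ r := (dist_nonneg.trans_lt (Metric.mem_ball.mp h0)).le
  rw [← meanObs_self hq0 hq1 hν hνμ hμ t k (fun _ => n), meanObs_eq_stepInt hq0 hq1 hν hνμ hμ h0 h1
    hout t k k le_rfl (fun _ => n) (fun _ _ => le_rfl) (fun _ _ => hn),
    stepInt_congr hr (e' := fun _ => t) fun j hj => if_neg (by omega), stepInt]

end Moment

/-! ### Symmetrization of the nested integrand -/

section Symmetrization

/-- The symmetric weight `∏_{a≠b} (w_a - w_b) / (w_a - q w_b)`. -/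
def symWeight (Q : ℂ) {k : ℕ} (w : Fin k → ℂ) : ℂ :=
  ∏ i, ∏ j, if i = j then 1 else (w i - w j) / (w i - Q * w j)

theorem symWeight_cons (Q : ℂ) {k : ℕ} (w : Fin (k + 1) → ℂ) :
    symWeight Q w = (∏ j : Fin k, (w 0 - w j.succ) / (w 0 - Q * w j.succ)) *
      (∏ j : Fin k, (w j.succ - w 0) / (w j.succ - Q * w 0)) * symWeight Q fun j => w j.succ := by
  rw [symWeight, symWeight, Fin.prod_univ_succ, mul_assoc]
  congr 1
  · rw [Fin.prod_univ_succ, if_pos rfl, one_mul]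
    exact prod_congr rfl fun j _ => if_neg (Fin.succ_ne_zero j).symm
  · rw [← prod_mul_distrib]
    refine prod_congr rfl fun i _ => ?_
    rw [Fin.prod_univ_succ, if_neg (Fin.succ_ne_zero i)]
    congr 1
    refine prod_congr rfl fun j _ => ?_
    simp only [Fin.succ_inj]

theorem symWeight_comp_perm (Q : ℂ) {k : ℕ} (w : Fin k → ℂ) (σ : Equiv.Perm (Fin k)) :
    symWeight Q (w ∘ σ) = symWeight Q w := by
  rw [symWeight, symWeight]
  conv_rhs => rw [← Equiv.prod_comp σ]
  refine prod_congr rfl fun i _ => ?_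
  rw [← Equiv.prod_comp σ (fun j => if σ i = j then 1 else (w (σ i) - w j) / (w (σ i) - Q * w j))]
  exact prod_congr rfl fun j _ => by simp

theorem symWeight_eq_zero (Q : ℂ) {k : ℕ} (w : Fin k → ℂ) (hw : ¬Function.Injective w) :
    symWeight Q w = 0 := by
  simp only [Function.Injective, not_forall] at hw
  obtain ⟨i, j, hij, hne⟩ := hw
  refine prod_eq_zero (mem_univ i) (prod_eq_zero (mem_univ j) ?_)
  rw [if_neg hne, hij, sub_self, zero_div]

theorem crossWeight_eq_zero (Q : ℂ) {k : ℕ} (w : Fin k → ℂ) (hw : ¬Function.Injective w) :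
    crossWeight Q w = 0 := by
  simp only [Function.Injective, not_forall] at hw
  obtain ⟨i, j, hij, hne⟩ := hw
  rcases lt_or_gt_of_ne hne with h | h
  · refine prod_eq_zero (mem_univ i) (prod_eq_zero (mem_univ j) ?_)
    rw [if_pos h, hij, sub_self, zero_div]
  · refine prod_eq_zero (mem_univ j) (prod_eq_zero (mem_univ i) ?_)
    rw [if_pos h, hij, sub_self, zero_div]

/-- The Cauchy determinant `det[1/(w_a - q w_b)]`, by elimination of the first column. -/
theorem det_inv_sub_mul (Q : ℂ) {k : ℕ} (w : Fin k → ℂ) (hw : ∀ a b, w a - Q * w b ≠ 0) :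
    Matrix.det (Matrix.of fun a b => 1 / (w a - Q * w b)) =
      (∏ i : Fin k, Q ^ i.val / ((1 - Q) * w i)) * symWeight Q w := by
  induction k with
  | zero => simp [symWeight]
  | succ k ih =>
    have h00 : (1 - Q) * w 0 ≠ 0 := by
      have := hw 0 0
      rwa [show (1 - Q) * w 0 = w 0 - Q * w 0 by ring]
    set B : Matrix (Fin (k + 1)) (Fin (k + 1)) ℂ := Matrix.of fun a b =>
      if a = 0 then 1 / (w a - Q * w b) else
        1 / (w a - Q * w b) - (w 0 - Q * w 0) / (w a - Q * w 0) * (1 / (w 0 - Q * w b)) with hB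
    have hdet : Matrix.det (Matrix.of fun a b => 1 / (w a - Q * w b)) = B.det := by
      refine Matrix.det_eq_of_forall_row_eq_smul_add_const
        (fun a => if a = 0 then 0 else (w 0 - Q * w 0) / (w a - Q * w 0)) 0 (by simp) ?_
      intro i j
      simp only [hB, Matrix.of_apply]
      by_cases hi : i = 0
      · simp [hi]
      · simp [hi]
    rw [hdet, Matrix.det_succ_column_zero, Fin.sum_univ_succ, sum_eq_zero, add_zero]
    · have hsub : (B.submatrix (Fin.succAbove 0) Fin.succ) = Matrix.of fun i j =>
          ((w i.succ - w 0) / (w i.succ - Q * w 0)) * (Matrix.of (fun i' j' =>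
            (Q * (w 0 - w j'.succ) / (w 0 - Q * w j'.succ)) *
            (Matrix.of fun a b : Fin k => 1 / (w a.succ - Q * w b.succ)) i' j') i j) := by
        ext i j
        simp only [hB, Matrix.submatrix_apply, Fin.succAbove_zero, Matrix.of_apply,
          Fin.succ_ne_zero, if_false]
        have e1 := hw i.succ j.succ
        have e2 := hw i.succ 0
        have e3 := hw 0 j.succ
        field_simp
        ring
      rw [hsub, Matrix.det_mul_column, Matrix.det_mul_row, ih _ fun a b => hw a.succ b.succ,
        symWeight_cons, Fin.prod_univ_succ]
      have e1 : ∏ j : Fin k, Q * (w 0 - w j.succ) / (w 0 - Q * w j.succ) =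
          Q ^ k * ∏ j : Fin k, (w 0 - w j.succ) / (w 0 - Q * w j.succ) := by
        simp_rw [mul_div_assoc]
        rw [prod_mul_distrib, prod_const, card_univ, Fintype.card_fin]
      have e2 : ∏ i : Fin k, Q ^ i.succ.val / ((1 - Q) * w i.succ) =
          Q ^ k * ∏ i : Fin k, Q ^ i.val / ((1 - Q) * w i.succ) := by
        simp_rw [Fin.val_succ, pow_succ', mul_div_assoc]
        rw [prod_mul_distrib, prod_const, card_univ, Fintype.card_fin]
      rw [e1, e2]
      simp only [hB, Matrix.of_apply, if_true, Fin.val_zero, pow_zero, one_mul]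
      rw [show w 0 - Q * w 0 = (1 - Q) * w 0 by ring]
      ring
    · intro i _
      have e2 := hw i.succ 0
      have e3 := hw 0 0
      simp only [hB, Matrix.of_apply, Fin.succ_ne_zero, if_false]
      have : 1 / (w i.succ - Q * w 0) -
          (w 0 - Q * w 0) / (w i.succ - Q * w 0) * (1 / (w 0 - Q * w 0)) = 0 := by
        rw [div_mul_div_comm, mul_one, mul_comm (w i.succ - Q * w 0), div_mul_cancel_left₀ e3,
          one_div, sub_self]
      rw [this, mul_zero, zero_mul]

/-- The value at `0` of `∏_j (w_j - Q x) - ∏_j (Q w_j - Q x)`, by Lagrange interpolation at the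
nodes `w_i`; the leading terms cancel, so that the degree is less than the number of nodes. -/
theorem sum_prod_erase_div (Q : ℂ) (hQ : Q ≠ 0) {k : ℕ} (w : Fin k → ℂ)
    (hw : Function.Injective w) (hw0 : ∀ i, w i ≠ 0) :
    (1 - Q) * ∑ i, ∏ j ∈ univ.erase i, (w j - Q * w i) / (w j - w i) = 1 - Q ^ k := by
  have hQ' : -Q ≠ 0 := neg_ne_zero.mpr hQ
  set A : Polynomial ℂ := ∏ j, (Polynomial.C (-Q) * Polynomial.X + Polynomial.C (w j)) with hA
  set B : Polynomial ℂ := ∏ j, (Polynomial.C (-Q) * Polynomial.X + Polynomial.C (Q * w j)) with hB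
  have hdA : A.degree = k := by
    rw [hA, Polynomial.degree_prod]
    simp [Polynomial.degree_linear hQ', -map_neg]
  have hdB : B.degree = k := by
    rw [hB, Polynomial.degree_prod]
    simp [Polynomial.degree_linear hQ', -map_neg, -map_mul]
  have hlc : A.leadingCoeff = B.leadingCoeff := by
    rw [hA, hB, Polynomial.leadingCoeff_prod, Polynomial.leadingCoeff_prod]
    exact prod_congr rfl fun j _ => by
      rw [Polynomial.leadingCoeff_linear hQ', Polynomial.leadingCoeff_linear hQ']
  have hA0 : A ≠ 0 := fun h => by
    rw [h, Polynomial.degree_zero] at hdA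
    exact absurd hdA (by simp)
  have hdeg : (A - B).degree < (univ : Finset (Fin k)).card := by
    rw [card_univ, Fintype.card_fin, ← hdA]
    exact Polynomial.degree_sub_lt_left (hdA.trans hdB.symm) hA0 hlc
  have h1 := Lagrange.eq_interpolate (s := univ) (v := w) hw.injOn hdeg
  have h2 := congrArg (Polynomial.eval 0) h1
  rw [Lagrange.interpolate_apply] at h2
  have eA : ∀ x, A.eval x = ∏ j, (w j - Q * x) := fun x => by
    rw [hA, Polynomial.eval_prod]
    exact prod_congr rfl fun j _ => by simp; ring
  have eB : ∀ x, B.eval x = Q ^ k * ∏ j, (w j - x) := fun x => by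
    rw [hB, Polynomial.eval_prod, show Q ^ k = ∏ _j : Fin k, Q by simp,
      ← prod_mul_distrib]
    exact prod_congr rfl fun j _ => by simp; ring
  have hP : ∏ j, w j ≠ 0 := prod_ne_zero_iff.mpr fun i _ => hw0 i
  have e3 : ∀ i, Polynomial.eval 0 (Polynomial.C ((A - B).eval (w i)) * Lagrange.basis univ w i) =
      (∏ j, w j) * ((1 - Q) * ∏ j ∈ univ.erase i, (w j - Q * w i) / (w j - w i)) := by
    intro i
    rw [Polynomial.eval_mul, Polynomial.eval_C, Polynomial.eval_sub, eA, eB,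
      prod_eq_zero (f := fun j => w j - w i) (mem_univ i) (sub_self _), mul_zero, sub_zero,
      ← mul_prod_erase univ _ (mem_univ i), ← mul_prod_erase univ w (mem_univ i),
      Lagrange.basis, Polynomial.eval_prod]
    have : ∏ j ∈ univ.erase i, Polynomial.eval 0 (Lagrange.basisDivisor (w i) (w j)) =
        ∏ j ∈ univ.erase i, w j / (w j - w i) := by
      refine prod_congr rfl fun j hj => ?_
      have hne : w j - w i ≠ 0 := sub_ne_zero.mpr fun h => (mem_erase.mp hj).1 (hw h)
      have hne' : w i - w j ≠ 0 := sub_ne_zero.mpr fun h => (mem_erase.mp hj).1 (hw h.symm)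
      simp [Lagrange.basisDivisor]
      field_simp
      ring
    rw [this, prod_div_distrib, prod_div_distrib]
    ring
  rw [Polynomial.eval_finsetSum, sum_congr rfl fun i _ => e3 i, ← mul_sum, ← mul_sum,
    Polynomial.eval_sub, eA, eB] at h2
  simp only [mul_zero, sub_zero] at h2
  have h4 : (∏ j, w j) * (1 - Q ^ k) = (∏ j, w j) *
      ((1 - Q) * ∑ i, ∏ j ∈ univ.erase i, (w j - Q * w i) / (w j - w i)) := by
    rw [← h2]; ring
  exact (mul_left_cancel₀ hP h4).symm

theorem crossWeight_succ (Q : ℂ) {k : ℕ} (w : Fin (k + 1) → ℂ) :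
    crossWeight Q w = (∏ j : Fin k, (w 0 - w j.succ) / (w 0 - Q * w j.succ)) *
      crossWeight Q fun j => w j.succ := by
  have := crossWeight_cons Q (fun j : Fin k => w j.succ) (w 0)
  rwa [show ((0 : Fin (k + 1)).insertNth (w 0) (fun j : Fin k => w j.succ) : Fin (k + 1) → ℂ) = w
    by rw [Fin.insertNth_zero']; exact Fin.cons_self_tail w] at this

/-- The symmetrization of `crossWeight` is a multiple of the weight of the Cauchy determinant. The
sum is taken over the value `i` of the permutation at `0` first; `sum_prod_erase_div` sums over `i`
last. -/
theorem sum_perm_crossWeight (Q : ℂ) (hQ : Q ≠ 0) {k : ℕ} (w : Fin k → ℂ)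
    (hw : ∀ a b, w a - Q * w b ≠ 0) :
    (1 - Q) ^ k * ∑ σ : Equiv.Perm (Fin k), crossWeight Q (w ∘ σ) = qPoch Q Q k * symWeight Q w := by
  by_cases hinj : Function.Injective w
  swap
  · rw [symWeight_eq_zero Q w hinj, sum_eq_zero, mul_zero, mul_zero]
    intro σ _
    refine crossWeight_eq_zero Q _ fun h => hinj ?_
    have := h.comp σ.symm.injective
    rwa [Function.comp_assoc, Equiv.self_comp_symm, Function.comp_id] at this
  induction k with
  | zero => simp [symWeight, crossWeight, qPoch]
  | succ k ih =>
    have hw0 : ∀ i, w i ≠ 0 := fun i h => hw i i (by rw [h]; ring)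
    rw [← Equiv.sum_comp Equiv.Perm.decomposeFin.symm, Fintype.sum_prod_type]
    have e1 : ∀ (i : Fin (k + 1)), (1 - Q) ^ k * ∑ τ : Equiv.Perm (Fin k),
        crossWeight Q (w ∘ Equiv.Perm.decomposeFin.symm (i, τ)) =
        (qPoch Q Q k * symWeight Q w) *
          ∏ j ∈ univ.erase i, (w j - Q * w i) / (w j - w i) := by
      intro i
      set v : Fin k → ℂ := fun x => w (Equiv.swap 0 i x.succ) with hv
      have h1 : ∀ τ : Equiv.Perm (Fin k), crossWeight Q (w ∘ Equiv.Perm.decomposeFin.symm (i, τ)) =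
          (∏ j, (w i - v j) / (w i - Q * v j)) * crossWeight Q (v ∘ τ) := by
        intro τ
        rw [crossWeight_succ]
        simp only [Function.comp_apply, Equiv.Perm.decomposeFin_symm_apply_zero,
          Equiv.Perm.decomposeFin_symm_apply_succ]
        rw [← Equiv.prod_comp τ (fun j => (w i - v j) / (w i - Q * v j))]
        rfl
      simp_rw [h1]
      rw [← mul_sum, mul_left_comm, ih v (fun a b => hw _ _)
        (hinj.comp ((Equiv.swap 0 i).injective.comp (Fin.succ_injective k)))]
      have h2 : symWeight Q w = (∏ j : Fin k, (w i - v j) / (w i - Q * v j)) *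
          (∏ j : Fin k, (v j - w i) / (v j - Q * w i)) * symWeight Q v := by
        rw [← symWeight_comp_perm Q w (Equiv.swap 0 i), symWeight_cons]
        simp only [Function.comp_apply, Equiv.swap_apply_left]
        rfl
      have h3 : ∏ j ∈ univ.erase i, (w j - Q * w i) / (w j - w i) =
          ∏ j : Fin k, (v j - Q * w i) / (v j - w i) := by
        symm
        refine prod_bij (fun j _ => Equiv.swap 0 i j.succ) (fun j _ => ?_) (fun a _ b _ h => ?_)
          (fun b hb => ?_) (fun j _ => rfl)
        · rw [mem_erase]
          refine ⟨fun h => ?_, mem_univ _⟩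
          have := congrArg (Equiv.swap 0 i) h
          rw [Equiv.swap_apply_self, Equiv.swap_apply_right] at this
          exact Fin.succ_ne_zero j this
        · exact Fin.succ_injective k ((Equiv.swap 0 i).injective h)
        · have hb' := (mem_erase.mp hb).1
          have : Equiv.swap 0 i b ≠ 0 := fun h => hb' (by
            have := congrArg (Equiv.swap 0 i) h
            rwa [Equiv.swap_apply_self, Equiv.swap_apply_left] at this)
          obtain ⟨j, hj⟩ := Fin.exists_succ_eq.mpr this
          exact ⟨j, mem_univ _, by rw [hj, Equiv.swap_apply_self]⟩
      have h4 : (∏ j : Fin k, (v j - w i) / (v j - Q * w i)) *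
          ∏ j : Fin k, (v j - Q * w i) / (v j - w i) = 1 := by
        rw [← prod_mul_distrib]
        refine prod_eq_one fun j _ => ?_
        have hne : v j - w i ≠ 0 := sub_ne_zero.mpr fun h => by
          have h5 := congrArg (Equiv.swap 0 i) (hinj h)
          rw [Equiv.swap_apply_self, Equiv.swap_apply_right] at h5
          exact Fin.succ_ne_zero j h5
        have hne' : v j - Q * w i ≠ 0 := hw _ _
        rw [div_mul_div_comm, mul_comm (v j - Q * w i), div_self (mul_ne_zero hne hne')]
      rw [h2, h3]
      linear_combination (-(qPoch Q Q k * (∏ j : Fin k, (w i - v j) / (w i - Q * v j)) *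
        symWeight Q v)) * h4
    rw [pow_succ', mul_assoc, mul_sum, sum_congr rfl fun i _ => e1 i, ← mul_sum, mul_left_comm,
      sum_prod_erase_div Q hQ w hinj hw0, qPoch_succ, pow_succ']
    ring

end Symmetrization

/-! ### Generalities on Fredholm determinants on circles -/

section Fredholm

variable {c : ℂ} {r : ℝ} {K K' : ℂ → ℂ → ℂ}

theorem fredholmTerm_eq_torusAvg (K : ℂ → ℂ → ℂ) (c : ℂ) (r : ℝ) (k : ℕ) :
    fredholmTerm K c r k = ((k.factorial : ℂ))⁻¹ *
      torusAvg c r k fun w => Matrix.det (Matrix.of fun a b => K (w a) (w b)) := by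
  rw [fredholmTerm, torusAvg, mul_assoc]

theorem continuousOn_det_kernel
    (hK : ContinuousOn (fun p : ℂ × ℂ => K p.1 p.2) (Metric.sphere c r ×ˢ Metric.sphere c r))
    (k : ℕ) : ContinuousOn (fun w : Fin k → ℂ => Matrix.det (Matrix.of fun a b => K (w a) (w b)))
      (torusSet c r k) := by
  rw [continuousOn_iff_continuous_domRestrict]
  refine Continuous.matrix_det (continuous_matrix fun a b => ?_)
  exact hK.comp_continuous (f := fun w : torusSet c r k => ((w : Fin k → ℂ) a, (w : Fin k → ℂ) b))
    (((continuous_apply a).comp continuous_subtype_val).prodMk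
      ((continuous_apply b).comp continuous_subtype_val)) fun w => ⟨w.2 a, w.2 b⟩

/-- For a continuous kernel only the convergence of the series is to be checked. -/
theorem hasFredholmDet_of_continuousOn (hr : 0 ≤ r)
    (hK : ContinuousOn (fun p : ℂ × ℂ => K p.1 p.2) (Metric.sphere c r ×ˢ Metric.sphere c r))
    (hs : Summable (fredholmTerm K c r)) : HasFredholmDet K c r where
  memLp := by
    have hc : Continuous fun θ : ℝ × ℝ => K (circleMap c r θ.1) (circleMap c r θ.2) :=
      hK.comp_continuous (f := fun θ : ℝ × ℝ => (circleMap c r θ.1, circleMap c r θ.2))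
        (by fun_prop)
        fun θ => ⟨circleMap_mem_sphere c hr _, circleMap_mem_sphere c hr _⟩
    obtain ⟨C, hC⟩ := ((isCompact_sphere c r).prod (isCompact_sphere c r)).exists_bound_of_continuousOn
      hK
    have : IsFiniteMeasure ((volume : Measure (ℝ × ℝ)).restrict
        (Set.Icc 0 (2 * Real.pi) ×ˢ Set.Icc 0 (2 * Real.pi))) :=
      isFiniteMeasure_restrict.mpr (isCompact_Icc.prod isCompact_Icc).measure_lt_top.ne
    exact MemLp.of_bound hc.aestronglyMeasurable C (Eventually.of_forall fun θ =>
      hC (circleMap c r θ.1, circleMap c r θ.2) ⟨circleMap_mem_sphere c hr _, circleMap_mem_sphere c hr _⟩)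
  integrable k := torusIntegrable_of_continuousOn hr (continuousOn_det_kernel hK k)
  summable := hs

theorem ae_torusMap_notMem {B : Set ℂ} (hB : B.Countable) (hr : r ≠ 0) (k : ℕ) :
    ∀ᵐ θ : Fin k → ℝ, ∀ a, circleMap c r (θ a) ∉ B := by
  rw [ae_all_iff]
  intro a
  have h : ∀ᵐ x : ℝ, circleMap c r x ∉ B := (hB.preimage_circleMap c hr).ae_notMem volume
  exact (Measure.quasiMeasurePreserving_eval (fun _ : Fin k => (volume : Measure ℝ)) a).ae h

/-- Fredholm determinants do not see the values of the kernel on countably many points. -/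
theorem HasFredholmDet.congr_countable (hr : 0 < r) {B : Set ℂ} (hB : B.Countable)
    (h : ∀ w ∈ Metric.sphere c r \ B, ∀ w' ∈ Metric.sphere c r \ B, K w w' = K' w w')
    (hK : HasFredholmDet K c r) :
    HasFredholmDet K' c r ∧ fredholmDet K' c r = fredholmDet K c r := by
  have hdet : ∀ k, ∀ᵐ θ : Fin k → ℝ,
      Matrix.det (Matrix.of fun a b => K (torusMap (fun _ => c) (fun _ => r) θ a)
        (torusMap (fun _ => c) (fun _ => r) θ b)) =
      Matrix.det (Matrix.of fun a b => K' (torusMap (fun _ => c) (fun _ => r) θ a)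
        (torusMap (fun _ => c) (fun _ => r) θ b)) := by
    intro k
    filter_upwards [ae_torusMap_notMem (c := c) hB hr.ne' k] with θ hθ
    congr 1
    ext a b
    exact h _ ⟨torusMap_mem_torusSet hr.le θ a, hθ a⟩ _ ⟨torusMap_mem_torusSet hr.le θ b, hθ b⟩
  have hterm : fredholmTerm K' c r = fredholmTerm K c r := by
    funext k
    rw [fredholmTerm, fredholmTerm, torusIntegral, torusIntegral]
    congr 1
    refine integral_congr_ae (ae_restrict_of_ae ?_)
    filter_upwards [hdet k] with θ hθ
    rw [hθ]
  refine ⟨⟨?_, fun k => ?_, hterm ▸ hK.summable⟩, by rw [fredholmDet, fredholmDet, hterm]⟩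
  · refine (memLp_congr_ae (ae_restrict_of_ae ?_)).mp hK.memLp
    have h1 : ∀ᵐ x : ℝ, circleMap c r x ∉ B := (hB.preimage_circleMap c hr.ne').ae_notMem volume
    have h2 : ∀ᵐ θ : ℝ × ℝ, circleMap c r θ.1 ∉ B := Measure.quasiMeasurePreserving_fst.ae h1
    have h3 : ∀ᵐ θ : ℝ × ℝ, circleMap c r θ.2 ∉ B := Measure.quasiMeasurePreserving_snd.ae h1
    filter_upwards [h2, h3] with θ h2 h3
    exact h _ ⟨circleMap_mem_sphere c hr.le _, h2⟩ _ ⟨circleMap_mem_sphere c hr.le _, h3⟩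
  · exact (hK.integrable k).congr (ae_restrict_of_ae (hdet k))

end Fredholm

/-! ### The Cauchy type formula -/

section Cauchy

variable {q μ ν : ℝ} {N : ℕ} {c : ℂ} {r : ℝ} {ζ : ℂ}

/-- The ratio `g(w)/g(qw)` as a rational function. -/
def gRatio (μ ν : ℝ) (n t : ℕ) (w : ℂ) : ℂ :=
  ((1 - ν * w) / (1 - w)) ^ n * ((1 - μ * w) / (1 - ν * w)) ^ t / (1 - ν * w)

/-- The poles and zeros of `g`. -/
def gSingular (q μ ν : ℝ) : Set ℂ :=
  {w | ∃ i : ℕ, w * q ^ i = 1 ∨ ν * w * q ^ i = 1 ∨ μ * w * q ^ i = 1}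

theorem countable_gSingular (q μ ν : ℝ) : (gSingular q μ ν).Countable := by
  have hsub : ∀ a : ℂ, {w : ℂ | a * w = 1}.Subsingleton := fun a x hx y hy => by
    have ha : a ≠ 0 := by
      rintro rfl
      simp at hx
    exact mul_left_cancel₀ ha ((show a * x = 1 from hx).trans (show a * y = 1 from hy).symm)
  have : gSingular q μ ν ⊆ ⋃ i : ℕ, ({w : ℂ | (q : ℂ) ^ i * w = 1} ∪
      ({w : ℂ | (ν * (q : ℂ) ^ i) * w = 1} ∪ {w : ℂ | (μ * (q : ℂ) ^ i) * w = 1})) := by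
    rintro w ⟨i, hi⟩
    refine Set.mem_iUnion.mpr ⟨i, ?_⟩
    rcases hi with h | h | h
    · exact Or.inl (by rw [← h]; simp only [Set.mem_ofPred_eq]; ring)
    · exact Or.inr (Or.inl (by rw [← h]; simp only [Set.mem_ofPred_eq]; ring))
    · exact Or.inr (Or.inr (by rw [← h]; simp only [Set.mem_ofPred_eq]; ring))
  refine Set.Countable.mono this (Set.countable_iUnion fun i => ?_)
  exact (hsub _).countable.union ((hsub _).countable.union (hsub _).countable)

theorem norm_ofReal_lt_one (hq0 : 0 < q) (hq1 : q < 1) : ‖(q : ℂ)‖ < 1 := by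
  rwa [Complex.norm_real, Real.norm_of_nonneg hq0.le]

theorem gFun_div_gFun (hq0 : 0 < q) (hq1 : q < 1) (n t : ℕ) {w : ℂ} (hw : w ∉ gSingular q μ ν) :
    gFun q μ ν n t w / gFun q μ ν n t (q * w) = gRatio μ ν n t w := by
  have hq := norm_ofReal_lt_one hq0 hq1
  simp only [gSingular, Set.mem_ofPred_eq, not_exists, not_or] at hw
  have h1 : qPochInf (q * w) (q : ℂ) ≠ 0 := qPochInf_ne_zero hq fun i h =>
    (hw (i + 1)).1 (by rw [← h]; ring)
  have h2 : qPochInf (q * (ν * w)) (q : ℂ) ≠ 0 := qPochInf_ne_zero hq fun i h =>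
    (hw (i + 1)).2.1 (by rw [← h]; ring)
  have h3 : qPochInf (q * (μ * w)) (q : ℂ) ≠ 0 := qPochInf_ne_zero hq fun i h =>
    (hw (i + 1)).2.2 (by rw [← h]; ring)
  have h4 : 1 - w ≠ 0 := fun h => (hw 0).1 (by rw [sub_eq_zero] at h; rw [← h]; ring)
  have h5 : 1 - ν * w ≠ 0 := fun h => (hw 0).2.1 (by rw [sub_eq_zero] at h; rw [← h]; ring)
  have h6 : 1 - μ * w ≠ 0 := fun h => (hw 0).2.2 (by rw [sub_eq_zero] at h; rw [← h]; ring)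
  rw [gFun, gFun, gRatio, qPochInf_eq_one_sub_mul hq w, qPochInf_eq_one_sub_mul hq (ν * w),
    qPochInf_eq_one_sub_mul hq (μ * w), mul_left_comm (ν : ℂ), mul_left_comm (μ : ℂ)]
  generalize qPochInf (q * w) (q : ℂ) = a at *
  generalize qPochInf (q * (ν * w)) (q : ℂ) = b at *
  generalize qPochInf (q * (μ * w)) (q : ℂ) = d at *
  simp only [div_pow, mul_pow]
  field_simp

/-- Averages against the symmetric weight are nested integrals, by symmetrization. -/
theorem torusAvg_symWeight (hq0 : 0 < q) (hq1 : q < 1) (h0 : (0 : ℂ) ∈ Metric.ball c r) (k : ℕ)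
    {s : ℂ → ℂ} (hs : ContinuousOn s (Metric.sphere c r)) :
    qPoch (q : ℂ) q k * torusAvg c r k (fun w => symWeight (q : ℂ) w * ∏ j, s (w j)) =
      (1 - q : ℂ) ^ k * (k.factorial * nestedInt q c r k fun _ => s) := by
  have hr : 0 ≤ r := (dist_nonneg.trans_lt (Metric.mem_ball.mp h0)).le
  have hqne : (q : ℂ) ≠ 0 := by exact_mod_cast hq0.ne'
  have hcont : ∀ σ : Equiv.Perm (Fin k), ContinuousOn (fun w : Fin k → ℂ =>
      crossWeight (q : ℂ) (w ∘ σ) * ∏ j, s ((w ∘ σ) j)) (torusSet c r k) := by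
    intro σ
    refine (continuousOn_crossWeight_mul hq0 hq1 h0 (ρ := fun _ => s) fun _ => hs).comp
      (f := fun w : Fin k → ℂ => w ∘ σ) ?_ fun w hw i => hw (σ i)
    exact (continuous_pi fun i => continuous_apply (σ i)).continuousOn
  have h1 : ∀ σ : Equiv.Perm (Fin k), torusAvg c r k (fun w : Fin k → ℂ =>
      crossWeight (q : ℂ) (w ∘ σ) * ∏ j, s ((w ∘ σ) j)) = nestedInt q c r k fun _ => s :=
    fun σ => torusAvg_comp_perm σ fun w => crossWeight (q : ℂ) w * ∏ j, s (w j)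
  have h2 : (k.factorial : ℂ) * (nestedInt q c r k fun _ => s) =
      torusAvg c r k (fun w => ∑ σ : Equiv.Perm (Fin k),
        crossWeight (q : ℂ) (w ∘ σ) * ∏ j, s ((w ∘ σ) j)) := by
    rw [torusAvg_sum hr _ _ fun σ _ => hcont σ, sum_congr rfl fun σ _ => h1 σ, sum_const, card_univ,
      Fintype.card_perm, Fintype.card_fin, nsmul_eq_mul]
  rw [h2, ← torusAvg_const_mul, ← torusAvg_const_mul]
  refine torusAvg_congr hr fun w hw => ?_
  have h3 : ∀ σ : Equiv.Perm (Fin k), ∏ j, s ((w ∘ σ) j) = ∏ j, s (w j) := fun σ =>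
    Equiv.prod_comp σ fun j => s (w j)
  simp_rw [h3]
  rw [← sum_mul, ← mul_assoc, ← mul_assoc, sum_perm_crossWeight (q : ℂ) hqne w fun a b =>
    sub_mul_ne_zero hq0 hq1 h0 (notMem_ball_of_mem_sphere (hw a))
      (Metric.sphere_subset_closedBall (hw b))]

/-- The terms of the Cauchy type determinant are the `q`-factorial moments of `q^{x_n + n}`. -/
theorem fredholmTerm_gRatio (hq0 : 0 < q) (hq1 : q < 1) (hν : 0 ≤ ν) (hνμ : ν ≤ μ) (hμ : μ < 1)
    (h0 : (0 : ℂ) ∈ Metric.ball c r)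
    (h1 : (1 : ℂ) ∈ Metric.ball c r) (hout : ν ≠ 0 → (ν : ℂ)⁻¹ ∉ Metric.closedBall c r)
    (t k n : ℕ) (hn : n ≤ N) (ζ : ℂ) :
    fredholmTerm (fun w w' => ζ * (gRatio μ ν n t w / (q * w' - w))) c r k =
      ζ ^ k / qPoch (q : ℂ) q k *
        ((∫ x : Config N, qPow q (qPos q x n) 1 k ∂(tasepLaw q μ ν N t) : ℝ) : ℂ) := by
  have hr : 0 ≤ r := (dist_nonneg.trans_lt (Metric.mem_ball.mp h0)).le
  have hqk : qPoch (q : ℂ) (q : ℂ) k ≠ 0 := by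
    rw [← ofReal_qPoch]
    exact_mod_cast (qPoch_pos hq0.le hq1 hq1 k).ne'
  have hq1' : (1 - q : ℂ) ≠ 0 := by
    exact_mod_cast (sub_pos.mpr hq1).ne'
  have hE : ((∫ x : Config N, qPow q (qPos q x n) 1 k ∂(tasepLaw q μ ν N t) : ℝ) : ℂ) =
      (∏ j ∈ range k, -(q : ℂ) ^ j) * nestedInt q c r k fun _ => stepFactor μ ν n t := by
    rw [← integral_prod_qPos_sub hq0 hq1 hν hνμ hμ h0 h1 hout t k n hn]
    simp only [qPow, mul_one]
  have hdet : ∀ w ∈ torusSet c r k,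
      Matrix.det (Matrix.of fun a b => ζ * (gRatio μ ν n t (w a) / (q * w b - w a))) =
        (ζ ^ k * (∏ j ∈ range k, -(q : ℂ) ^ j) / (1 - q) ^ k) *
          (symWeight (q : ℂ) w * ∏ j, stepFactor μ ν n t (w j)) := by
    intro w hw
    have hne : ∀ a b, w a - q * w b ≠ 0 := fun a b =>
      sub_mul_ne_zero hq0 hq1 h0 (notMem_ball_of_mem_sphere (hw a))
        (Metric.sphere_subset_closedBall (hw b))
    have hw0 : ∀ a, w a ≠ 0 := fun a h => notMem_ball_of_mem_sphere (hw a) (h ▸ h0)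
    have e1 : (Matrix.of fun a b => ζ * (gRatio μ ν n t (w a) / (q * w b - w a))) =
        Matrix.of fun a b => (-(ζ * gRatio μ ν n t (w a))) *
          (Matrix.of fun a b => 1 / (w a - q * w b)) a b := by
      ext a b
      simp only [Matrix.of_apply]
      rw [← neg_sub, div_neg]
      ring
    rw [e1, Matrix.det_mul_column, det_inv_sub_mul _ _ hne]
    have e2 : ∀ a : Fin k, gRatio μ ν n t (w a) = w a * stepFactor μ ν n t (w a) := fun a => by
      rw [gRatio, stepFactor, ← mul_div_assoc, mul_div_mul_left _ _ (hw0 a)]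
    rw [← Fin.prod_univ_eq_prod_range (fun j => -(q : ℂ) ^ j) k]
    have e3 : (ζ ^ k * (∏ i : Fin k, -(q : ℂ) ^ i.val) / (1 - q) ^ k) =
        ∏ i : Fin k, ζ * (-(q : ℂ) ^ i.val) / (1 - q) := by
      rw [prod_div_distrib, prod_mul_distrib]
      simp
    rw [e3, mul_comm (symWeight _ _), ← mul_assoc, ← mul_assoc, ← prod_mul_distrib,
      ← prod_mul_distrib]
    congr 1
    refine prod_congr rfl fun i _ => ?_
    rw [e2]
    have := hw0 i
    field_simp
  have hsym := torusAvg_symWeight hq0 hq1 h0 k (continuousOn_stepFactor (μ := μ) h0 h1 hout n t)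
  rw [fredholmTerm_eq_torusAvg, torusAvg_congr hr hdet, torusAvg_const_mul, hE]
  have hsym' : torusAvg c r k (fun w => symWeight (q : ℂ) w * ∏ j, stepFactor μ ν n t (w j)) =
      (1 - q : ℂ) ^ k * (k.factorial * nestedInt q c r k fun _ => stepFactor μ ν n t) /
        qPoch (q : ℂ) q k := by
    rw [eq_div_iff hqk, mul_comm, hsym]
  rw [hsym']
  have hfac : (k.factorial : ℂ) ≠ 0 := by exact_mod_cast k.factorial_ne_zero
  field_simp

/-- The finite `q`-binomial theorem at the points `q^m`. -/
theorem sum_qPow_pow_div (q ζ : ℂ) (hq : ∀ n, qPoch q q n ≠ 0) (m M : ℕ) (hM : m < M) :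
    ∑ k ∈ range M, ζ ^ k / qPoch q q k * qPow q (q ^ m) 1 k = qPoch ζ q m := by
  have hstep : ∀ m k, qPow q (q ^ (m + 1)) 1 (k + 1) =
      qPow q (q ^ m) 1 (k + 1) - q ^ m * (1 - q ^ (k + 1)) * qPow q (q ^ m) 1 k := by
    intro m k
    have h1 : qPow q (q ^ (m + 1)) 1 (k + 1) = (q ^ (m + 1) - 1) * (q ^ k * qPow q (q ^ m) 1 k) := by
      rw [qPow, prod_range_succ', mul_comm, qPow]
      congr 1
      · ring
      · rw [← card_range k, ← prod_const, card_range, ← prod_mul_distrib]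
        exact prod_congr rfl fun j _ => by ring
    rw [h1, qPow_succ]
    ring
  induction m generalizing M with
  | zero =>
    obtain ⟨M, rfl⟩ : ∃ M', M = M' + 1 := ⟨M - 1, by omega⟩
    rw [sum_range_succ', sum_eq_zero]
    · simp [qPow, qPoch]
    · intro k _
      rw [qPow, prod_range_succ']
      simp
  | succ m ih =>
    obtain ⟨M, rfl⟩ : ∃ M', M = M' + 1 := ⟨M - 1, by omega⟩
    rw [qPoch_succ, ← ih M (by omega), sum_range_succ']
    have h0 : ∀ x : ℂ, qPow q x 1 0 = 1 := fun x => by simp [qPow]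
    have e1 : ∀ k ∈ range M, ζ ^ (k + 1) / qPoch q q (k + 1) * qPow q (q ^ (m + 1)) 1 (k + 1) =
        ζ ^ (k + 1) / qPoch q q (k + 1) * qPow q (q ^ m) 1 (k + 1) -
          (ζ * q ^ m) * (ζ ^ k / qPoch q q k * qPow q (q ^ m) 1 k) := by
      intro k _
      have hk := hq k
      have hk1 := hq (k + 1)
      rw [qPoch_succ] at hk1 ⊢
      have hk2 := right_ne_zero_of_mul hk1
      rw [hstep, mul_sub]
      congr 1
      rw [pow_succ]
      rw [show q * q ^ k = q ^ (k + 1) by ring] at hk2 ⊢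
      field_simp
    rw [sum_congr rfl e1, sum_sub_distrib, ← mul_sum]
    have e2 := ih (M + 1) (by omega)
    rw [sum_range_succ', h0] at e2
    rw [h0]
    have e3 := ih M (by omega)
    linear_combination e2 - e3

/-- This bound makes the series of `q`-moments converge for all `ζ`, not only for small ones. -/
theorem abs_qPow_pow_le_prod (hq0 : 0 < q) (hq1 : q < 1) (m k : ℕ) :
    |qPow q (q ^ m) 1 k| ≤ ∏ j ∈ range k, q ^ j := by
  rw [qPow]
  rcases Nat.lt_or_ge m k with h | h
  · rw [prod_eq_zero (mem_range.mpr h) (by ring), abs_zero]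
    positivity
  · rw [abs_prod]
    refine prod_le_prod (fun _ _ => abs_nonneg _) fun j hj => ?_
    have h1 := mem_range.mp hj
    have h2 : q ^ m ≤ q ^ j := pow_le_pow_of_le_one hq0.le hq1.le (by omega)
    have h3 : 0 < q ^ m := by positivity
    rw [abs_le]
    constructor <;> nlinarith

theorem summable_pow_mul_prod_pow (hq0 : 0 < q) (hq1 : q < 1) (x : ℝ) :
    Summable fun k : ℕ => x ^ k / qPoch q q k * ∏ j ∈ range k, q ^ j := by
  by_cases hx : x = 0
  · refine summable_of_hasFiniteSupport ((Set.finite_singleton 0).subset fun k hk => ?_)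
    by_contra h
    have hk0 : k ≠ 0 := h
    simp [hx, hk0] at hk
  have hpos : ∀ k, qPoch q q k ≠ 0 := fun k => (qPoch_pos hq0.le hq1 hq1 k).ne'
  have hq : q ≠ 0 := hq0.ne'
  refine summable_of_ratio_test_tendsto_lt_one (l := 0) one_pos (Eventually.of_forall fun k =>
    mul_ne_zero (div_ne_zero (pow_ne_zero _ hx) (hpos k))
      (prod_ne_zero_iff.mpr fun j _ => pow_ne_zero _ hq)) ?_
  have h1 : Tendsto (fun k : ℕ => q ^ k) atTop (𝓝 0) := tendsto_pow_atTop_nhds_zero_of_lt_one hq0.le hq1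
  have h2 : Tendsto (fun k : ℕ => |x| * q ^ k / (1 - q * q ^ k)) atTop
      (𝓝 (|x| * 0 / (1 - q * 0))) :=
    (h1.const_mul _).div ((h1.const_mul q).const_sub 1) (by simp)
  rw [mul_zero, zero_div] at h2
  refine h2.congr fun k => ?_
  have h3 : 0 < 1 - q * q ^ k := by
    have := pow_le_one₀ (n := k) hq0.le hq1.le
    have := pow_pos hq0 k
    nlinarith
  rw [← norm_div, qPoch_succ, prod_range_succ, pow_succ]
  have h4 : x ^ k * x / (qPoch q q k * (1 - q * q ^ k)) * ((∏ j ∈ range k, q ^ j) * q ^ k) /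
      (x ^ k / qPoch q q k * ∏ j ∈ range k, q ^ j) = x * q ^ k / (1 - q * q ^ k) := by
    have h5 : (∏ j ∈ range k, q ^ j) ≠ 0 := prod_ne_zero_iff.mpr fun j _ => pow_ne_zero _ hq
    have h6 := hpos k
    have h7 := pow_ne_zero k hx
    have h8 := h3.ne'
    generalize qPoch q q k = A at *
    generalize (∏ j ∈ range k, q ^ j) = B at *
    generalize 1 - q * q ^ k = D at *
    field_simp
  rw [h4, Real.norm_eq_abs, abs_div, abs_mul, abs_of_pos h3, abs_of_pos (pow_pos hq0 k)]

theorem qPochInf_ne_zero_of_forall (hq0 : 0 < q) (hq1 : q < 1)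
    (hζ : ∀ r : ℝ, 0 ≤ r → ζ ≠ (r : ℂ)) : qPochInf ζ (q : ℂ) ≠ 0 := by
  refine qPochInf_ne_zero (norm_ofReal_lt_one hq0 hq1) fun i h => ?_
  refine hζ ((q ^ i)⁻¹) (by positivity) ?_
  push_cast
  exact eq_inv_of_mul_eq_one_left h

theorem eqObservable_eq_div (hq0 : 0 < q) (hq1 : q < 1) (hζ : ∀ r : ℝ, 0 ≤ r → ζ ≠ (r : ℂ))
    (m : ℕ) : eqObservable q ζ m = qPoch ζ (q : ℂ) m / qPochInf ζ (q : ℂ) := by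
  have h := qPochInf_ne_zero_of_forall hq0 hq1 hζ
  rw [qPochInf_eq_mul (norm_ofReal_lt_one hq0 hq1) ζ m] at h ⊢
  rw [eqObservable, zpow_natCast, div_mul_eq_div_div, div_self (left_ne_zero_of_mul h)]

theorem sub_one_lt_of_le {n N : ℕ} (hn : 1 ≤ n) (hnN : n ≤ N) : n - 1 < N :=
  (Nat.sub_lt hn one_pos).trans_le hnN

/-- On the support of the law, the observable is a function of a natural number. -/
theorem ae_exists_eq_natCast (t n : ℕ) (hn : 1 ≤ n) (hnN : n ≤ N) :
    ∀ᵐ x : Config N ∂tasepLaw q μ ν N t, ∃ m : ℕ,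
      x ⟨n - 1, sub_one_lt_of_le hn hnN⟩ + (n : ℤ) = m ∧ qPos q x n = q ^ m := by
  filter_upwards [ae_isAdmissible (q := q) (μ := μ) (ν := ν) (N := N) t] with x hx
  have h := hx.2 ⟨n - 1, sub_one_lt_of_le hn hnN⟩
  have h2 : 0 ≤ x ⟨n - 1, sub_one_lt_of_le hn hnN⟩ + (n : ℤ) := by
    simp only at h
    omega
  refine ⟨(x ⟨n - 1, sub_one_lt_of_le hn hnN⟩ + (n : ℤ)).toNat, (Int.toNat_of_nonneg h2).symm, ?_⟩
  rw [qPos, dif_pos ⟨hn, hnN⟩, ← zpow_natCast, Int.toNat_of_nonneg h2]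

theorem integrable_eqObservable (hq0 : 0 < q) (hq1 : q < 1) (hν : 0 ≤ ν) (hνμ : ν ≤ μ) (hμ : μ < 1)
    (hζ : ∀ r : ℝ, 0 ≤ r → ζ ≠ (r : ℂ)) (t n : ℕ) (hn : 1 ≤ n) (hnN : n ≤ N) :
    Integrable (fun x : Config N => eqObservable q ζ (x ⟨n - 1, sub_one_lt_of_le hn hnN⟩ + n))
      (tasepLaw q μ ν N t) := by
  have := isProbabilityMeasure_tasepLaw hq0 hq1 hν hνμ hμ (N := N) t
  refine Integrable.of_bound (Measurable.of_discrete).aestronglyMeasurable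
    (Real.exp (‖ζ‖ / (1 - ‖(q : ℂ)‖)) / ‖qPochInf ζ (q : ℂ)‖) ?_
  filter_upwards [ae_exists_eq_natCast (q := q) (μ := μ) (ν := ν) t n hn hnN] with x ⟨m, hm, _⟩
  rw [hm, eqObservable_eq_div hq0 hq1 hζ, norm_div]
  gcongr
  exact norm_qPoch_le (norm_ofReal_lt_one hq0 hq1) ζ m

/-- The `q`-Laplace transform as a series of `q`-factorial moments, by the `q`-binomial theorem. -/
theorem hasSum_integral_qPow (hq0 : 0 < q) (hq1 : q < 1) (hν : 0 ≤ ν) (hνμ : ν ≤ μ) (hμ : μ < 1)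
    (hζ : ∀ r : ℝ, 0 ≤ r → ζ ≠ (r : ℂ)) (t n : ℕ) (hn : 1 ≤ n) (hnN : n ≤ N) :
    HasSum (fun k : ℕ => ζ ^ k / qPoch (q : ℂ) q k *
        ((∫ x : Config N, qPow q (qPos q x n) 1 k ∂(tasepLaw q μ ν N t) : ℝ) : ℂ))
      (qPochInf ζ (q : ℂ) *
        ∫ x : Config N, eqObservable q ζ (x ⟨n - 1, sub_one_lt_of_le hn hnN⟩ + n) ∂(tasepLaw q μ ν N t)) := by
  have := isProbabilityMeasure_tasepLaw hq0 hq1 hν hνμ hμ (N := N) t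
  have hinf := qPochInf_ne_zero_of_forall hq0 hq1 hζ
  have hqn : ∀ n, qPoch (q : ℂ) (q : ℂ) n ≠ 0 := fun n => by
    rw [← ofReal_qPoch]
    exact_mod_cast (qPoch_pos hq0.le hq1 hq1 n).ne'
  set F : ℕ → Config N → ℂ := fun k x =>
    ζ ^ k / qPoch (q : ℂ) q k * ((qPow q (qPos q x n) 1 k : ℝ) : ℂ) with hF
  have hae := ae_exists_eq_natCast (q := q) (μ := μ) (ν := ν) (N := N) t n hn hnN
  have hbound : ∀ k, ∀ᵐ x ∂tasepLaw q μ ν N t,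
      ‖F k x‖ ≤ ‖ζ‖ ^ k / qPoch q q k * ∏ j ∈ range k, q ^ j := by
    intro k
    filter_upwards [hae] with x ⟨m, _, hm⟩
    rw [hF]
    simp only
    rw [hm, norm_mul, norm_div, norm_pow, ← ofReal_qPoch, Complex.norm_real, Complex.norm_real,
      Real.norm_of_nonneg (qPoch_pos hq0.le hq1 hq1 k).le]
    have := (qPoch_pos hq0.le hq1 hq1 k).le
    gcongr
    exact abs_qPow_pow_le_prod hq0 hq1 m k
  have hint : ∀ k, Integrable (F k) (tasepLaw q μ ν N t) := fun k =>
    Integrable.of_bound (Measurable.of_discrete).aestronglyMeasurable _ (hbound k)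
  have hsum : Summable fun k => ∫ x, ‖F k x‖ ∂tasepLaw q μ ν N t := by
    refine Summable.of_nonneg_of_le (fun k => integral_nonneg fun x => norm_nonneg _) (fun k => ?_)
      (summable_pow_mul_prod_pow hq0 hq1 ‖ζ‖)
    calc ∫ x, ‖F k x‖ ∂tasepLaw q μ ν N t
        ≤ ∫ _x, ‖ζ‖ ^ k / qPoch q q k * ∏ j ∈ range k, q ^ j ∂tasepLaw q μ ν N t :=
          integral_mono_ae (hint k).norm (integrable_const _) (hbound k)
      _ = _ := by simp
  have h := hasSum_integral_of_summable_integral_norm hint hsum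
  have e1 : ∀ k, ∫ x, F k x ∂tasepLaw q μ ν N t = ζ ^ k / qPoch (q : ℂ) q k *
      ((∫ x : Config N, qPow q (qPos q x n) 1 k ∂(tasepLaw q μ ν N t) : ℝ) : ℂ) := fun k => by
    rw [hF]
    simp only
    rw [integral_const_mul, integral_complex_ofReal]
  have e2 : ∫ x, ∑' k, F k x ∂tasepLaw q μ ν N t = qPochInf ζ (q : ℂ) *
      ∫ x : Config N, eqObservable q ζ (x ⟨n - 1, sub_one_lt_of_le hn hnN⟩ + n) ∂(tasepLaw q μ ν N t) := by
    rw [← integral_const_mul]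
    refine integral_congr_ae ?_
    filter_upwards [hae] with x ⟨m, hm1, hm⟩
    rw [hm1, eqObservable_eq_div hq0 hq1 hζ, mul_div_cancel₀ _ hinf, hF]
    simp only
    rw [hm, tsum_eq_sum (s := range (m + 1))]
    · rw [← sum_qPow_pow_div (q : ℂ) ζ hqn m (m + 1) (by omega)]
      refine sum_congr rfl fun k _ => ?_
      simp [qPow]
    · intro k hk
      rw [mem_range, not_lt] at hk
      rw [qPow, prod_eq_zero (i := m) (mem_range.mpr (by omega)) (by ring)]
      simp
  rw [← e2]
  simp_rw [← e1]
  exact h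

/-- The Cauchy type formula for the rational form of the kernel. -/
theorem hasFredholmDet_gRatio (hq0 : 0 < q) (hq1 : q < 1) (hν : 0 ≤ ν) (hνμ : ν ≤ μ) (hμ : μ < 1)
    (h0 : (0 : ℂ) ∈ Metric.ball c r)
    (h1 : (1 : ℂ) ∈ Metric.ball c r) (hout : ν ≠ 0 → (ν : ℂ)⁻¹ ∉ Metric.closedBall c r)
    (t n : ℕ) (hn : 1 ≤ n) (hnN : n ≤ N) (hζ : ∀ r : ℝ, 0 ≤ r → ζ ≠ (r : ℂ)) :
    HasFredholmDet (fun w w' => ζ * (gRatio μ ν n t w / (q * w' - w))) c r ∧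
    fredholmDet (fun w w' => ζ * (gRatio μ ν n t w / (q * w' - w))) c r = qPochInf ζ (q : ℂ) *
        ∫ x : Config N, eqObservable q ζ (x ⟨n - 1, sub_one_lt_of_le hn hnN⟩ + n) ∂(tasepLaw q μ ν N t) := by
  have hr : 0 ≤ r := (dist_nonneg.trans_lt (Metric.mem_ball.mp h0)).le
  have hS := hasSum_integral_qPow hq0 hq1 hν hνμ hμ hζ t n hn hnN
  simp_rw [← fredholmTerm_gRatio hq0 hq1 hν hνμ hμ h0 h1 hout t _ n hnN ζ] at hS
  refine ⟨hasFredholmDet_of_continuousOn hr ?_ hS.summable, hS.tsum_eq⟩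
  have hz1 : ∀ z ∈ Metric.sphere c r, 1 - z ≠ 0 := fun z hz h =>
    notMem_ball_of_mem_sphere hz (sub_eq_zero.mp h ▸ h1)
  have hzν : ∀ z ∈ Metric.sphere c r, 1 - (ν : ℂ) * z ≠ 0 := fun z hz =>
    one_sub_mul_ne_zero hout (Metric.sphere_subset_closedBall hz)
  unfold gRatio
  refine ContinuousOn.mul (by fun_prop) (ContinuousOn.div (ContinuousOn.div (ContinuousOn.mul
    (ContinuousOn.pow (ContinuousOn.div (by fun_prop) (by fun_prop) fun p hp => hz1 _ hp.1) _)
    (ContinuousOn.pow (ContinuousOn.div (by fun_prop) (by fun_prop) fun p hp => hzν _ hp.1) _))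
    (by fun_prop) fun p hp => hzν _ hp.1) (by fun_prop) fun p hp => ?_)
  have := sub_mul_ne_zero hq0 hq1 h0 (notMem_ball_of_mem_sphere hp.1)
    (Metric.sphere_subset_closedBall hp.2)
  rw [← neg_sub]
  exact neg_ne_zero.mpr this

/-- The Cauchy type formula. The kernels agree off the countable set of poles and zeros of `g`,
where the quotient `g(w)/g(qw)` is a junk value. -/
theorem hasFredholmDet_cauchyKernel (hq0 : 0 < q) (hq1 : q < 1) (hν : 0 ≤ ν) (hνμ : ν ≤ μ)
    (hμ : μ < 1) (h0 : (0 : ℂ) ∈ Metric.ball c r)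
    (h1 : (1 : ℂ) ∈ Metric.ball c r) (hout : ν ≠ 0 → (ν : ℂ)⁻¹ ∉ Metric.closedBall c r)
    (t n : ℕ) (hn : 1 ≤ n) (hnN : n ≤ N) (hζ : ∀ r : ℝ, 0 ≤ r → ζ ≠ (r : ℂ)) :
    HasFredholmDet (fun w w' => ζ * cauchyKernel q μ ν n t w w') c r ∧
    fredholmDet (fun w w' => ζ * cauchyKernel q μ ν n t w w') c r = qPochInf ζ (q : ℂ) *
        ∫ x : Config N, eqObservable q ζ (x ⟨n - 1, sub_one_lt_of_le hn hnN⟩ + n) ∂(tasepLaw q μ ν N t) := by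
  have hr : 0 < r := dist_nonneg.trans_lt (Metric.mem_ball.mp h0)
  obtain ⟨h2, h3⟩ := hasFredholmDet_gRatio hq0 hq1 hν hνμ hμ h0 h1 hout t n hn hnN hζ
  have h4 := h2.congr_countable (K' := fun w w' => ζ * cauchyKernel q μ ν n t w w') hr
    (countable_gSingular q μ ν) fun w hw w' _ => by
      rw [cauchyKernel, gFun_div_gFun hq0 hq1 n t hw.2]
  exact ⟨h4.1, h4.2.trans h3⟩

end Cauchy

/-! ### Fredholm determinants of separable kernels -/

section Separable

/-- The integral `∮ f dz/(2πi)` of a function over a circle. -/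
def circleAvg (c : ℂ) (r : ℝ) (f : ℂ → ℂ) : ℂ :=
  (2 * (Real.pi : ℂ) * Complex.I)⁻¹ * ∮ z in C(c, r), f z

variable {c : ℂ} {r : ℝ}

theorem torusAvg_prod (hr : 0 ≤ r) {k : ℕ} {f : Fin k → ℂ → ℂ}
    (hf : ∀ i, ContinuousOn (f i) (Metric.sphere c r)) :
    torusAvg c r k (fun w => ∏ i, f i (w i)) = ∏ i, circleAvg c r (f i) := by
  have hcont : ∀ {k : ℕ} {f : Fin k → ℂ → ℂ}, (∀ i, ContinuousOn (f i) (Metric.sphere c r)) →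
      ContinuousOn (fun w : Fin k → ℂ => ∏ i, f i (w i)) (torusSet c r k) := fun hf =>
    continuousOn_finsetProd _ fun j _ =>
      (hf j).comp (continuous_apply j).continuousOn fun _ hw => hw j
  induction k with
  | zero => simp [torusAvg, torusIntegral_dim0]
  | succ k ih =>
    rw [torusAvg_succ hr 0 (hcont hf), Fin.prod_univ_succ, ← ih fun i => hf i.succ,
      ← torusAvg_const_mul]
    congr 1
    funext y
    have e : ∮ z in C(c, r), ∏ i, f i (((0 : Fin (k + 1)).insertNth z y : Fin (k + 1) → ℂ) i) =
        (∏ i : Fin k, f i.succ (y i)) * ∮ z in C(c, r), f 0 z := by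
      rw [← circleIntegral.integral_const_mul]
      refine circleIntegral.integral_congr hr fun z _ => ?_
      rw [Fin.prod_univ_succ]
      simp only [Fin.insertNth_zero', Fin.cons_zero, Fin.cons_succ]
      ring
    rw [e, circleAvg]
    ring

variable {u v : ℕ → ℂ → ℂ}

/-- The kernel `∑_{j<M} u_j(w) v_j(w')`. -/
def sepKernel (u v : ℕ → ℂ → ℂ) (M : ℕ) (w w' : ℂ) : ℂ := ∑ j : Fin M, u j w * v j w'

/-- The matrix `∮ v_i u_j dz/(2πi)`. -/
def gramMatrix (u v : ℕ → ℂ → ℂ) (c : ℂ) (r : ℝ) (M : ℕ) : Matrix (Fin M) (Fin M) ℂ :=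
  Matrix.of fun i j => circleAvg c r fun z => v i z * u j z

theorem det_sepKernel (M k : ℕ) (w : Fin k → ℂ) :
    Matrix.det (Matrix.of fun a b => sepKernel u v M (w a) (w b)) =
      ∑ J : Fin k → Fin M, ∑ σ : Equiv.Perm (Fin k), (Equiv.Perm.sign σ : ℂ) *
        ∏ a, (u (J (σ a)) (w (σ a)) * v (J (σ a)) (w a)) := by
  rw [Matrix.det_apply', sum_comm]
  refine sum_congr rfl fun σ _ => ?_
  rw [← mul_sum]
  congr 1
  simp only [Matrix.of_apply, sepKernel]
  rw [prod_univ_sum, Fintype.piFinset_univ, ← Equiv.sum_comp (Equiv.arrowCongr σ.symm (Equiv.refl _))]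
  rfl

/-- In the expansion `det_sepKernel`, index tuples that are not injective do not contribute. -/
theorem sum_sign_mul_prod_eq_zero {M k : ℕ} (w : Fin k → ℂ) (J : Fin k → Fin M)
    (hJ : ¬Function.Injective J) :
    ∑ σ : Equiv.Perm (Fin k), (Equiv.Perm.sign σ : ℂ) *
        ∏ a, (u (J (σ a)) (w (σ a)) * v (J (σ a)) (w a)) = 0 := by
  have h : ∑ σ : Equiv.Perm (Fin k), (Equiv.Perm.sign σ : ℂ) *
        ∏ a, (u (J (σ a)) (w (σ a)) * v (J (σ a)) (w a)) =
      (∏ a, u (J a) (w a)) * Matrix.det (Matrix.of fun a b => v (J a) (w b)) := by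
    rw [Matrix.det_apply', mul_sum]
    refine sum_congr rfl fun σ _ => ?_
    rw [prod_mul_distrib, Equiv.prod_comp σ fun a => u (J a) (w a)]
    simp only [Matrix.of_apply]
    ring
  rw [h]
  simp only [Function.Injective, not_forall] at hJ
  obtain ⟨i, j, hij, hne⟩ := hJ
  rw [Matrix.det_zero_of_row_eq hne (by funext b; simp only [Matrix.of_apply, hij]), mul_zero]

theorem torusAvg_det_sepKernel (hr : 0 ≤ r) (hu : ∀ j, ContinuousOn (u j) (Metric.sphere c r))
    (hv : ∀ j, ContinuousOn (v j) (Metric.sphere c r)) (M k : ℕ) :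
    torusAvg c r k (fun w => Matrix.det (Matrix.of fun a b => sepKernel u v M (w a) (w b))) =
      ∑ J : Fin k → Fin M, ((gramMatrix u v c r M).submatrix J J).det := by
  have hterm : ∀ (J : Fin k → Fin M) (σ : Equiv.Perm (Fin k)) (w : Fin k → ℂ),
      ∏ a, (u (J (σ a)) (w (σ a)) * v (J (σ a)) (w a)) =
        ∏ a, (v (J (σ a)) (w a) * u (J a) (w a)) := by
    intro J σ w
    rw [prod_mul_distrib, prod_mul_distrib, Equiv.prod_comp σ fun a => u (J a) (w a), mul_comm]
  have hc : ∀ (J : Fin k → Fin M) (σ : Equiv.Perm (Fin k)), ContinuousOn (fun w : Fin k → ℂ =>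
      ∏ a, (v (J (σ a)) (w a) * u (J a) (w a))) (torusSet c r k) := fun J σ =>
    continuousOn_finsetProd _ fun j _ => ((hv _).mul (hu _)).comp
      (continuous_apply j).continuousOn fun _ hw => hw j
  have hc' : ∀ (J : Fin k → Fin M) (σ : Equiv.Perm (Fin k)), ContinuousOn (fun w : Fin k → ℂ =>
      (Equiv.Perm.sign σ : ℂ) * ∏ a, (v (J (σ a)) (w a) * u (J a) (w a))) (torusSet c r k) :=
    fun J σ => continuousOn_const.mul (hc J σ)
  simp_rw [det_sepKernel, hterm]
  rw [torusAvg_sum hr]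
  · refine sum_congr rfl fun J _ => ?_
    rw [torusAvg_sum hr _ _ fun σ _ => hc' J σ, Matrix.det_apply']
    refine sum_congr rfl fun σ _ => ?_
    rw [torusAvg_const_mul, torusAvg_prod hr
      (f := fun a z => v (J (σ a)) z * u (J a) z) fun i => (hv _).mul (hu _)]
    rfl
  · intro J _
    exact continuousOn_finsetSum _ fun σ _ => hc' J σ

/-- Sums over tuples of minors are sums over sets of principal minors. -/
theorem sum_det_submatrix {R : Type*} [CommRing R] {M : ℕ} (A : Matrix (Fin M) (Fin M) R) (k : ℕ) :
    ∑ J : Fin k → Fin M, (A.submatrix J J).det =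
      k.factorial * ∑ s ∈ powersetCard k univ,
        (A.submatrix (Subtype.val : s → Fin M) (Subtype.val : s → Fin M)).det := by
  classical
  have hinj : ∀ J : Fin k → Fin M, ¬Function.Injective J → (A.submatrix J J).det = 0 := by
    intro J hJ
    simp only [Function.Injective, not_forall] at hJ
    obtain ⟨i, j, hij, hne⟩ := hJ
    exact Matrix.det_zero_of_row_eq hne (by funext b; simp only [Matrix.submatrix_apply, hij])
  rw [← sum_filter_add_sum_filter_not univ Function.Injective,
    sum_eq_zero (s := univ.filter fun J : Fin k → Fin M => ¬Function.Injective J)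
      (fun J hJ => hinj J (mem_filter.mp hJ).2), add_zero,
    ← sum_fiberwise_of_maps_to (s := univ.filter Function.Injective) (t := powersetCard k univ)
      (g := fun J : Fin k → Fin M => univ.image J), mul_sum]
  · refine sum_congr rfl fun s hs => ?_
    have hcard := (mem_powersetCard.mp hs).2
    have e0 : Fin k ≃ s := (Fintype.equivFinOfCardEq (by simpa using hcard)).symm
    have hval : ∀ J ∈ (univ.filter Function.Injective).filter
        (fun J : Fin k → Fin M => univ.image J = s),
        (A.submatrix J J).det =
          (A.submatrix (Subtype.val : s → Fin M) (Subtype.val : s → Fin M)).det := by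
      intro J hJ
      obtain ⟨hJ1, hJ2⟩ := mem_filter.mp hJ
      have hJi := (mem_filter.mp hJ1).2
      let e : Fin k ≃ s := Equiv.ofBijective (fun a => ⟨J a, hJ2 ▸ mem_image_of_mem J (mem_univ a)⟩)
        ⟨fun a b h => hJi (congrArg Subtype.val h), fun ⟨x, hx⟩ => by
          rw [← hJ2] at hx
          obtain ⟨a, _, rfl⟩ := mem_image.mp hx
          exact ⟨a, rfl⟩⟩
      rw [← Matrix.det_submatrix_equiv_self e, Matrix.submatrix_submatrix]
      rfl
    rw [sum_congr rfl hval, sum_const, nsmul_eq_mul]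
    congr 2
    have : k.factorial = Fintype.card (Fin k ≃ s) := by
      rw [Fintype.card_equiv e0, Fintype.card_fin]
    rw [this, ← card_univ]
    symm
    refine card_bij (fun e _ a => (e a : Fin M)) (fun e _ => ?_) (fun e _ e' _ h => ?_)
      (fun J hJ => ?_)
    · refine mem_filter.mpr ⟨mem_filter.mpr ⟨mem_univ _,
        Subtype.val_injective.comp e.injective⟩, ?_⟩
      ext x
      simp only [mem_image, mem_univ, true_and]
      constructor
      · rintro ⟨a, rfl⟩
        exact (e a).2
      · intro hx
        exact ⟨e.symm ⟨x, hx⟩, by simp⟩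
    · exact Equiv.ext fun a => Subtype.ext (congrFun h a)
    · obtain ⟨hJ1, hJ2⟩ := mem_filter.mp hJ
      have hJi := (mem_filter.mp hJ1).2
      exact ⟨Equiv.ofBijective (fun a => ⟨J a, hJ2 ▸ mem_image_of_mem J (mem_univ a)⟩)
        ⟨fun a b h => hJi (congrArg Subtype.val h), fun ⟨x, hx⟩ => by
          rw [← hJ2] at hx
          obtain ⟨a, _, rfl⟩ := mem_image.mp hx
          exact ⟨a, rfl⟩⟩, mem_univ _, rfl⟩
  · intro J hJ
    refine mem_powersetCard.mpr ⟨subset_univ _, ?_⟩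
    rw [card_image_of_injective _ (mem_filter.mp hJ).2, card_univ, Fintype.card_fin]

/-- Sylvester's identity: the Fredholm determinant of a kernel of finite rank is a finite
determinant. -/
theorem hasSum_fredholmTerm_sepKernel (hr : 0 ≤ r)
    (hu : ∀ j, ContinuousOn (u j) (Metric.sphere c r))
    (hv : ∀ j, ContinuousOn (v j) (Metric.sphere c r)) (M : ℕ) :
    HasSum (fredholmTerm (sepKernel u v M) c r) (1 + gramMatrix u v c r M).det := by
  set A := gramMatrix u v c r M with hA
  set P : Polynomial ℂ := (1 + (Polynomial.X : Polynomial ℂ) • A.map Polynomial.C).det with hP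
  have hterm : ∀ k, fredholmTerm (sepKernel u v M) c r k = P.coeff k := by
    intro k
    have hfac : (k.factorial : ℂ) ≠ 0 := by exact_mod_cast k.factorial_ne_zero
    rw [fredholmTerm_eq_torusAvg, torusAvg_det_sepKernel hr hu hv, sum_det_submatrix,
      inv_mul_cancel_left₀ hfac, hP, Matrix.coeff_det_one_add_X_smul_eq_sum_minors]
  have heval : (1 + A).det = P.eval 1 := by
    rw [hP, ← Polynomial.coe_evalRingHom, RingHom.map_det]
    congr 1
    ext i j
    by_cases hij : i = j
    · subst hij
      simp
    · simp [Matrix.one_apply_ne hij]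
  rw [heval, Polynomial.eval_eq_sum_range]
  simp_rw [one_pow, mul_one, ← hterm]
  refine hasSum_sum_of_ne_finset_zero fun k hk => ?_
  rw [hterm]
  exact Polynomial.coeff_eq_zero_of_natDegree_lt (by simpa using hk)

theorem prod_pow_le_prod_range_card {θ : ℝ} (hθ0 : 0 ≤ θ) (hθ1 : θ ≤ 1) (s : Finset ℕ) :
    ∏ j ∈ s, θ ^ j ≤ ∏ j ∈ range s.card, θ ^ j := by
  induction s using Finset.induction_on_max with
  | empty => simp
  | insert m s hm ih =>
    have hms : m ∉ s := fun h => lt_irrefl _ (hm m h)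
    have hc : s.card ≤ m := by
      have h : s ⊆ range m := fun x hx => mem_range.mpr (hm x hx)
      simpa using card_le_card h
    rw [prod_insert hms, card_insert_of_notMem hms, prod_range_succ, mul_comm]
    exact mul_le_mul ih (pow_le_pow_of_le_one hθ0 hθ1 hc) (by positivity) (by positivity)

variable {C θ : ℝ}

/-- A bound uniform in the rank `M`. The indices of a tuple that contributes are distinct, so that
one of the two factors `∏ θ^{J_a}` is at most `∏_{j<k} θ^j`, and the other one makes the sum over
the tuples converge. -/
theorem norm_det_sepKernel_le (hC : 0 ≤ C) (hθ0 : 0 < θ) (hθ1 : θ < 1)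
    (hb : ∀ j, ∀ w ∈ Metric.sphere c r, ∀ w' ∈ Metric.sphere c r,
      ‖u j w‖ * ‖v j w'‖ ≤ C * (θ ^ j * θ ^ j)) (M k : ℕ) (w : Fin k → ℂ) (hw : w ∈ torusSet c r k) :
    ‖Matrix.det (Matrix.of fun a b => sepKernel u v M (w a) (w b))‖ ≤
      k.factorial * ((C * (1 - θ)⁻¹) ^ k * ∏ j ∈ range k, θ ^ j) := by
  have h1 : ∀ J : Fin k → Fin M, ‖∑ σ : Equiv.Perm (Fin k), (Equiv.Perm.sign σ : ℂ) *
        ∏ a, (u (J (σ a)) (w (σ a)) * v (J (σ a)) (w a))‖ ≤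
      k.factorial * (C ^ k * ((∏ j ∈ range k, θ ^ j) * ∏ a, θ ^ (J a).val)) := by
    intro J
    by_cases hJ : Function.Injective J
    swap
    · rw [sum_sign_mul_prod_eq_zero w J hJ, norm_zero]
      positivity
    have h2 : ∀ σ : Equiv.Perm (Fin k), ‖(Equiv.Perm.sign σ : ℂ) *
        ∏ a, (u (J (σ a)) (w (σ a)) * v (J (σ a)) (w a))‖ ≤
        C ^ k * ((∏ a, θ ^ (J a).val) * ∏ a, θ ^ (J a).val) := by
      intro σ
      have hs : ‖((Equiv.Perm.sign σ : ℤ) : ℂ)‖ = 1 := by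
        rcases Int.units_eq_one_or (Equiv.Perm.sign σ) with h | h <;> simp [h]
      rw [norm_mul, hs, one_mul, norm_prod]
      calc ∏ a, ‖u (J (σ a)) (w (σ a)) * v (J (σ a)) (w a)‖
          ≤ ∏ a, C * (θ ^ (J (σ a)).val * θ ^ (J (σ a)).val) := by
            refine prod_le_prod (fun _ _ => norm_nonneg _) fun a _ => ?_
            rw [norm_mul]
            exact hb _ _ (hw _) _ (hw _)
        _ = ∏ a, C * (θ ^ (J a).val * θ ^ (J a).val) :=
            Equiv.prod_comp σ fun a => C * (θ ^ (J a).val * θ ^ (J a).val)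
        _ = _ := by
            rw [prod_mul_distrib, prod_mul_distrib, prod_const, card_univ, Fintype.card_fin]
    have h3 : ∏ a, θ ^ (J a).val ≤ ∏ j ∈ range k, θ ^ j := by
      have hi : Function.Injective fun a => (J a).val := Fin.val_injective.comp hJ
      have h4 := prod_pow_le_prod_range_card hθ0.le hθ1.le (univ.image fun a => (J a).val)
      rwa [prod_image hi.injOn, card_image_of_injective _ hi, card_univ, Fintype.card_fin] at h4
    refine (norm_sum_le _ _).trans ((sum_le_card_nsmul _ _ _ fun σ _ => h2 σ).trans ?_)
    rw [card_univ, Fintype.card_perm, Fintype.card_fin, nsmul_eq_mul]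
    gcongr
  rw [det_sepKernel]
  refine (norm_sum_le _ _).trans ((sum_le_sum fun J _ => h1 J).trans ?_)
  rw [← mul_sum, ← mul_sum, ← mul_sum, mul_pow, mul_assoc, mul_comm ((1 - θ)⁻¹ ^ k)]
  have h5 : ∑ J : Fin k → Fin M, ∏ a, θ ^ (J a).val = (∑ j : Fin M, θ ^ j.val) ^ k := by
    rw [← Fintype.piFinset_univ, ← prod_univ_sum (fun _ => univ) fun (_ : Fin k) (j : Fin M) => θ ^ j.val,
      prod_const, card_univ, Fintype.card_fin]
  have h6 : ∑ j : Fin M, θ ^ j.val ≤ (1 - θ)⁻¹ := by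
    rw [Fin.sum_univ_eq_sum_range (fun j => θ ^ j) M, ← tsum_geometric_of_lt_one hθ0.le hθ1]
    exact (summable_geometric_of_lt_one hθ0.le hθ1).sum_le_tsum _ fun j _ => by positivity
  rw [h5]
  gcongr

/-- The Fredholm determinant of a kernel `∑_j u_j(w) v_j(w')` with geometrically decaying terms is
the limit of the determinants of the finite sections of `1 + (∮ v_i u_j dz/(2πi))_{i,j}`. -/
theorem hasFredholmDet_separable (hr : 0 ≤ r) (hu : ∀ j, ContinuousOn (u j) (Metric.sphere c r))
    (hv : ∀ j, ContinuousOn (v j) (Metric.sphere c r)) (hC : 0 ≤ C) (hθ0 : 0 < θ) (hθ1 : θ < 1)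
    (hb : ∀ j, ∀ w ∈ Metric.sphere c r, ∀ w' ∈ Metric.sphere c r,
      ‖u j w‖ * ‖v j w'‖ ≤ C * (θ ^ j * θ ^ j)) {K : ℂ → ℂ → ℂ}
    (hK : ∀ w ∈ Metric.sphere c r, ∀ w' ∈ Metric.sphere c r,
      HasSum (fun j => u j w * v j w') (K w w')) :
    HasFredholmDet K c r ∧
      Tendsto (fun M => (1 + gramMatrix u v c r M).det) atTop (𝓝 (fredholmDet K c r)) := by
  set D : ℝ := C * (1 - θ)⁻¹ with hD
  have hD0 : 0 ≤ D := mul_nonneg hC (inv_nonneg.mpr (by linarith))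
  have htendK : ∀ w ∈ Metric.sphere c r, ∀ w' ∈ Metric.sphere c r,
      Tendsto (fun M => sepKernel u v M w w') atTop (𝓝 (K w w')) := by
    intro w hw w' hw'
    refine (hK w hw w' hw').tendsto_sum_nat.congr fun M => ?_
    rw [sepKernel, Fin.sum_univ_eq_sum_range (fun j => u j w * v j w') M]
  have hcontK : ContinuousOn (fun p : ℂ × ℂ => K p.1 p.2)
      (Metric.sphere c r ×ˢ Metric.sphere c r) := by
    have h1 : ContinuousOn (fun p : ℂ × ℂ => ∑' j, u j p.1 * v j p.2)
        (Metric.sphere c r ×ˢ Metric.sphere c r) := by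
      refine continuousOn_tsum (u := fun j => C * (θ ^ j * θ ^ j)) (fun j => ?_) ?_ ?_
      · exact ((hu j).comp continuousOn_fst fun p hp => hp.1).mul
          ((hv j).comp continuousOn_snd fun p hp => hp.2)
      · refine Summable.mul_left _ ?_
        simp_rw [← mul_pow]
        exact summable_geometric_of_lt_one (by positivity) (by nlinarith)
      · intro j p hp
        rw [norm_mul]
        exact hb j _ hp.1 _ hp.2
    exact h1.congr fun p hp => (hK _ hp.1 _ hp.2).tsum_eq.symm
  have hterm : ∀ k, Tendsto (fun M => fredholmTerm (sepKernel u v M) c r k) atTop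
      (𝓝 (fredholmTerm K c r k)) := by
    intro k
    unfold fredholmTerm
    refine Tendsto.const_mul _ ?_
    unfold torusIntegral
    have hcont : ∀ M, ContinuousOn (fun w : Fin k → ℂ =>
        Matrix.det (Matrix.of fun a b => sepKernel u v M (w a) (w b))) (torusSet c r k) :=
      fun M => by
        refine continuousOn_det_kernel ?_ k
        unfold sepKernel
        exact continuousOn_finsetSum _ fun j _ =>
          ((hu j).comp continuousOn_fst fun p hp => hp.1).mul
            ((hv j).comp continuousOn_snd fun p hp => hp.2)
    refine tendsto_integral_of_dominated_convergence
      (fun _ => r ^ k * (k.factorial * (D ^ k * ∏ j ∈ range k, θ ^ j)))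
      (fun M => (torusIntegrable_of_continuousOn hr (hcont M)).function_integrable.aestronglyMeasurable)
      ?_ (fun M => Eventually.of_forall fun Θ => ?_) (Eventually.of_forall fun Θ => ?_)
    · exact integrableOn_const (isCompact_Icc.measure_lt_top.ne)
    · rw [norm_smul]
      gcongr
      · rw [norm_prod]
        simp [Complex.norm_exp_ofReal_mul_I, abs_of_nonneg hr]
      · exact norm_det_sepKernel_le hC hθ0 hθ1 hb M k _ (torusMap_mem_torusSet hr Θ)
    · refine Tendsto.const_smul ?_ _
      have hdet : Continuous fun A : Matrix (Fin k) (Fin k) ℂ => A.det := continuous_id.matrix_det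
      refine (hdet.tendsto _).comp ?_
      refine tendsto_pi_nhds.mpr fun a => tendsto_pi_nhds.mpr fun b => ?_
      exact htendK _ (torusMap_mem_torusSet hr Θ a) _ (torusMap_mem_torusSet hr Θ b)
  have hbound : ∀ M k, ‖fredholmTerm (sepKernel u v M) c r k‖ ≤
      (r * D) ^ k * ∏ j ∈ range k, θ ^ j := by
    intro M k
    have hfac : (k.factorial : ℝ) ≠ 0 := by exact_mod_cast k.factorial_ne_zero
    have h1 : ‖torusIntegral (fun w : Fin k → ℂ =>
        Matrix.det (Matrix.of fun a b => sepKernel u v M (w a) (w b))) (fun _ => c) (fun _ => r)‖ ≤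
        ((2 * Real.pi) ^ k * ∏ _i : Fin k, |r|) *
          (k.factorial * (D ^ k * ∏ j ∈ range k, θ ^ j)) :=
      norm_torusIntegral_le_of_norm_le_const fun Θ =>
        norm_det_sepKernel_le hC hθ0 hθ1 hb M k _ (torusMap_mem_torusSet hr Θ)
    rw [fredholmTerm, norm_mul, norm_mul, norm_inv, norm_pow, norm_inv]
    have h2 : ‖2 * (Real.pi : ℂ) * Complex.I‖ = 2 * Real.pi := by
      simp [abs_of_pos Real.pi_pos]
    rw [h2, Complex.norm_natCast]
    refine (mul_le_mul_of_nonneg_left h1 (by positivity)).trans (le_of_eq ?_)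
    rw [prod_const, card_univ, Fintype.card_fin, abs_of_nonneg hr]
    have hpi : (2 * Real.pi) ^ k ≠ 0 := by positivity
    rw [inv_pow, mul_pow r D]
    generalize (2 * Real.pi) ^ k = P at *
    field_simp
  have hsum : Summable fun k : ℕ => (r * D) ^ k * ∏ j ∈ range k, θ ^ j := by
    refine Summable.of_nonneg_of_le (fun k => by positivity) (fun k => ?_)
      (summable_pow_mul_prod_pow hθ0 hθ1 (r * D))
    gcongr
    have h1 := qPoch_pos hθ0.le hθ1 hθ1 k
    have h2 := qPoch_le_one hθ0.le hθ1 hθ0.le hθ1.le k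
    rw [le_div_iff₀ h1]
    exact mul_le_of_le_one_right (by positivity) h2
  have hlim := tendsto_tsum_of_dominated_convergence hsum hterm
    (Eventually.of_forall fun M k => hbound M k)
  refine ⟨hasFredholmDet_of_continuousOn hr hcontK (Summable.of_norm_bounded hsum fun k =>
    le_of_tendsto (hterm k).norm (Eventually.of_forall fun M => hbound M k)), ?_⟩
  refine hlim.congr fun M => ?_
  exact (hasSum_fredholmTerm_sepKernel hr hu hv M).tsum_eq

end Separable

/-! ### The scalar Mellin–Barnes integral -/

section Scalar

/-- The logistic substitution in the Beta integral. -/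
theorem deriv_mul_betaIntegrand_sigmoid (τ : ℂ) (y : ℝ) :
    |2 * Real.pi * (Real.sigmoid (2 * Real.pi * y) * (1 - Real.sigmoid (2 * Real.pi * y)))| •
      (((Real.sigmoid (2 * Real.pi * y) : ℝ) : ℂ) ^ ((1 / 2 + τ) - 1) *
        (1 - ((Real.sigmoid (2 * Real.pi * y) : ℝ) : ℂ)) ^ ((1 / 2 - τ) - 1)) =
      Real.pi * (Complex.exp (2 * Real.pi * τ * y) / Real.cosh (Real.pi * y)) := by
  set x : ℝ := 2 * Real.pi * y with hx
  set s : ℝ := Real.sigmoid x with hs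
  have hs0 : 0 < s := Real.sigmoid_pos x
  have hs1 : 0 < 1 - s := sub_pos.mpr (Real.sigmoid_lt_one x)
  have h1 : 1 - s = Real.exp (-x) * s := by
    rw [hs, ← Real.sigmoid_neg, ← Real.sigmoid_mul_rexp_neg, mul_comm]
  have hlog1 : Real.log (1 - s) = Real.log s - x := by
    rw [h1, Real.log_mul (Real.exp_pos _).ne' hs0.ne', Real.log_exp]
    ring
  have h2 : (s : ℂ) ^ ((1 / 2 + τ) - 1) = Complex.exp (Real.log s * (τ - 1 / 2)) := by
    rw [Complex.cpow_def_of_ne_zero (by exact_mod_cast hs0.ne'), ← Complex.ofReal_log hs0.le]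
    congr 1
    ring
  have h3 : (1 - (s : ℂ)) ^ ((1 / 2 - τ) - 1) =
      Complex.exp ((Real.log s - x) * (-τ - 1 / 2)) := by
    rw [← Complex.ofReal_one, ← Complex.ofReal_sub, Complex.cpow_def_of_ne_zero
      (by exact_mod_cast hs1.ne'), ← Complex.ofReal_log hs1.le, hlog1]
    push_cast
    congr 1
    ring
  have h4 : (s : ℂ) = Complex.exp (Real.log s) := by
    rw [← Complex.ofReal_exp, Real.exp_log hs0]
  have h5 : s * Real.exp (-(Real.pi * y)) * (2 * Real.cosh (Real.pi * y)) = 1 := by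
    have : (1 + Real.exp (-x)) ≠ 0 := by positivity
    rw [hs, Real.sigmoid_def, Real.cosh_eq]
    have e1 : Real.exp (-x) = Real.exp (-(Real.pi * y)) * Real.exp (-(Real.pi * y)) := by
      rw [← Real.exp_add, hx]
      congr 1
      ring
    have e2 : Real.exp (-(Real.pi * y)) * Real.exp (Real.pi * y) = 1 := by
      rw [← Real.exp_add]
      simp
    field_simp
    rw [e1]
    linear_combination e2
  rw [abs_of_pos (by positivity), h1, h2, h3, ← Complex.exp_add]
  have hc : (Real.cosh (Real.pi * y) : ℂ) ≠ 0 := by exact_mod_cast (Real.cosh_pos _).ne'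
  have e3 : Complex.exp (Real.log s * (τ - 1 / 2) + (Real.log s - x) * (-τ - 1 / 2)) =
      Complex.exp (-Real.log s) * (Complex.exp (2 * Real.pi * τ * y) *
        Complex.exp (Real.pi * y)) := by
    rw [← Complex.exp_add, ← Complex.exp_add, hx]
    congr 1
    push_cast
    ring
  have e4 : Complex.exp (-Real.log s) * s = 1 := by
    rw [Complex.exp_neg, ← h4, inv_mul_cancel₀]
    exact_mod_cast hs0.ne'
  have e5 : ((Real.exp (-x) : ℝ) : ℂ) * Complex.exp (Real.pi * y) = (Real.exp (-(Real.pi * y)) : ℝ) := by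
    push_cast
    rw [← Complex.exp_add, hx]
    congr 1
    push_cast
    ring
  have h5' : (s : ℂ) * (Real.exp (-(Real.pi * y)) : ℝ) * (2 * (Real.cosh (Real.pi * y) : ℝ)) = 1 := by
    exact_mod_cast h5
  rw [e3, Complex.real_smul]
  rw [← mul_div_assoc, eq_div_iff hc]
  push_cast at e5 h5' ⊢
  calc _ = (2 * Real.pi * (Real.cosh (Real.pi * y) : ℝ) * s * Complex.exp (2 * Real.pi * τ * y)) *
        (Complex.exp (-Real.log s) * s) *
        (Complex.exp (-(x : ℂ)) * Complex.exp (Real.pi * y)) := by push_cast; ring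
    _ = (Real.pi * Complex.exp (2 * Real.pi * τ * y)) * ((s : ℂ) * Complex.exp (-(Real.pi * y)) *
        (2 * Complex.cosh (Real.pi * y))) := by rw [e4, e5]; push_cast; ring
    _ = _ := by rw [h5', mul_one]

/-- The Fourier–Laplace transform of `1 / cosh(πy)`: a Beta integral, evaluated by the reflection
formula of the Gamma function. -/
theorem integral_exp_div_cosh {τ : ℂ} (hτ : |τ.re| < 1 / 2) :
    Integrable (fun y : ℝ => Complex.exp (2 * Real.pi * τ * y) / Real.cosh (Real.pi * y)) ∧
    ∫ y : ℝ, Complex.exp (2 * Real.pi * τ * y) / Real.cosh (Real.pi * y) =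
      1 / Complex.cos (Real.pi * τ) := by
  obtain ⟨hτ1, hτ2⟩ := abs_lt.mp hτ
  have hpi : (Real.pi : ℂ) ≠ 0 := by exact_mod_cast Real.pi_ne_zero
  set f : ℝ → ℝ := fun y => Real.sigmoid (2 * Real.pi * y) with hf
  have hder : ∀ y ∈ (Set.univ : Set ℝ), HasDerivWithinAt f
      (2 * Real.pi * (Real.sigmoid (2 * Real.pi * y) * (1 - Real.sigmoid (2 * Real.pi * y))))
      Set.univ y := by
    intro y _
    have h := (Real.hasDerivAt_sigmoid (2 * Real.pi * y)).comp y
      ((hasDerivAt_id y).const_mul (2 * Real.pi))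
    exact (h.congr_deriv (by ring)).hasDerivWithinAt
  have hinj : Set.InjOn f Set.univ := fun a _ b _ h =>
    mul_left_cancel₀ (by positivity : (2 * Real.pi) ≠ 0) (Real.sigmoid_injective h)
  have himg : f '' Set.univ = Set.Ioo 0 1 := by
    rw [Set.image_univ, ← Real.range_sigmoid]
    refine Function.Surjective.range_comp (fun x => ⟨x / (2 * Real.pi), ?_⟩) Real.sigmoid
    exact mul_div_cancel₀ x (by positivity)
  set g : ℝ → ℂ := fun x => (x : ℂ) ^ ((1 / 2 + τ) - 1) * (1 - (x : ℂ)) ^ ((1 / 2 - τ) - 1) with hg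
  have ha : 0 < (1 / 2 + τ).re := by
    simp
    linarith
  have hb : 0 < (1 / 2 - τ).re := by
    simp
    linarith
  have hint := (intervalIntegrable_iff_integrableOn_Ioo_of_le zero_le_one).mp
    (Complex.betaIntegral_convergent ha hb)
  have hbeta : ∫ x in Set.Ioo (0 : ℝ) 1, g x = Real.pi / Complex.cos (Real.pi * τ) := by
    have h1 := Complex.Gamma_mul_Gamma_eq_betaIntegral ha hb
    rw [show (1 / 2 + τ) + (1 / 2 - τ) = 1 by ring, Complex.Gamma_one, one_mul,
      show (1 / 2 - τ) = 1 - (1 / 2 + τ) by ring, Complex.Gamma_mul_Gamma_one_sub,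
      show (Real.pi : ℂ) * (1 / 2 + τ) = Real.pi * τ + Real.pi / 2 by ring,
      Complex.sin_add_pi_div_two, show 1 - (1 / 2 + τ) = 1 / 2 - τ by ring, Complex.betaIntegral,
      intervalIntegral.integral_of_le zero_le_one, integral_Ioc_eq_integral_Ioo] at h1
    exact h1.symm
  rw [← himg] at hint hbeta
  rw [integrableOn_image_iff_integrableOn_abs_deriv_smul MeasurableSet.univ hder hinj] at hint
  rw [integral_image_eq_integral_abs_deriv_smul MeasurableSet.univ hder hinj] at hbeta
  simp only [hf, hg, deriv_mul_betaIntegrand_sigmoid, Measure.restrict_univ, integrableOn_univ]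
    at hint hbeta
  constructor
  · have := hint.const_mul (Real.pi : ℂ)⁻¹
    simpa [inv_mul_cancel_left₀ hpi] using this
  · rw [integral_const_mul] at hbeta
    rw [eq_comm, ← mul_right_inj' hpi, hbeta]
    ring

/-- The Mellin–Barnes integral `(1/2πi) ∫ π/sin(-πs) z^s ds = -z/(1+z)` along `Re s = 1/2`. -/
theorem integral_cpow_div_cosh {z : ℂ} (hz : z ∈ Complex.slitPlane) :
    Integrable (fun y : ℝ => z ^ (1 / 2 + y * Complex.I) / Real.cosh (Real.pi * y)) ∧
    ∫ y : ℝ, z ^ (1 / 2 + y * Complex.I) / Real.cosh (Real.pi * y) = 2 * z / (1 + z) := by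
  have hpi : (Real.pi : ℂ) ≠ 0 := by exact_mod_cast Real.pi_ne_zero
  have hz0 := Complex.slitPlane_ne_zero hz
  set τ : ℂ := Complex.I * Complex.log z / (2 * Real.pi) with hτ
  have hre : |τ.re| < 1 / 2 := by
    have h1 : τ.re = -z.arg / (2 * Real.pi) := by
      rw [hτ, show (2 * Real.pi : ℂ) = ((2 * Real.pi : ℝ) : ℂ) by push_cast; ring,
        Complex.div_ofReal_re, Complex.I_mul_re, Complex.log_im]
    have h2 : |z.arg| < Real.pi := by
      rw [abs_lt]
      exact ⟨Complex.neg_pi_lt_arg z, lt_of_le_of_ne (Complex.arg_le_pi z)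
        (Complex.mem_slitPlane_iff_arg.mp hz).1⟩
    rw [h1, abs_div, abs_neg, abs_of_pos (by positivity : (0 : ℝ) < 2 * Real.pi),
      div_lt_iff₀ (by positivity)]
    linarith
  obtain ⟨h1, h2⟩ := integral_exp_div_cosh hre
  have he : ∀ y : ℝ, z ^ (1 / 2 + y * Complex.I) / Real.cosh (Real.pi * y) =
      Complex.exp (Complex.log z / 2) *
        (Complex.exp (2 * Real.pi * τ * y) / Real.cosh (Real.pi * y)) := by
    intro y
    rw [Complex.cpow_def_of_ne_zero hz0, ← mul_div_assoc, ← Complex.exp_add]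
    congr 2
    rw [hτ]
    field_simp
  simp_rw [he]
  refine ⟨h1.const_mul _, ?_⟩
  rw [integral_const_mul, h2]
  have e1 : (Real.pi : ℂ) * τ = Complex.log z / 2 * Complex.I := by
    rw [hτ]
    field_simp
  have e2 : Complex.exp (Complex.log z / 2) * Complex.exp (Complex.log z / 2) = z := by
    rw [← Complex.exp_add, add_halves, Complex.exp_log hz0]
  rw [e1, Complex.cos_mul_I, Complex.cosh, Complex.exp_neg]
  set E := Complex.exp (Complex.log z / 2) with hE
  have hE0 : E ≠ 0 := Complex.exp_ne_zero _
  have h1z : 1 + z ≠ 0 := fun h => by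
    have : z = -1 := by linear_combination h
    rw [this] at hz
    norm_num [Complex.mem_slitPlane_iff] at hz
  rw [← e2] at h1z ⊢
  have : E + E⁻¹ = (1 + E * E) / E := by
    field_simp
    ring
  rw [this]
  field_simp

end Scalar

/-! ### Taylor coefficients and residues -/

section Residue

theorem circleAvg_congr {c : ℂ} {r : ℝ} (hr : 0 ≤ r) {f g : ℂ → ℂ}
    (h : ∀ z ∈ Metric.sphere c r, f z = g z) : circleAvg c r f = circleAvg c r g := by
  rw [circleAvg, circleAvg, circleIntegral.integral_congr hr h]

theorem circleAvg_const_mul (c : ℂ) (r : ℝ) (a : ℂ) (f : ℂ → ℂ) :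
    circleAvg c r (fun z => a * f z) = a * circleAvg c r f := by
  rw [circleAvg, circleAvg, circleIntegral.integral_const_mul, mul_left_comm]

theorem circleAvg_add {c : ℂ} {r : ℝ} (hr : 0 ≤ r) {f g : ℂ → ℂ}
    (hf : ContinuousOn f (Metric.sphere c r)) (hg : ContinuousOn g (Metric.sphere c r)) :
    circleAvg c r (fun z => f z + g z) = circleAvg c r f + circleAvg c r g := by
  rw [circleAvg, circleAvg, circleAvg, circleIntegral.integral_add (hf.circleIntegrable hr)
    (hg.circleIntegrable hr), mul_add]

theorem circleAvg_eq_zero {c : ℂ} {r : ℝ} (hr : 0 ≤ r) {f : ℂ → ℂ}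
    (hf : DifferentiableOn ℂ f (Metric.closedBall c r)) : circleAvg c r f = 0 := by
  rw [circleAvg, Complex.circleIntegral_eq_zero_of_differentiable_on_off_countable hr
    Set.countable_empty hf.continuousOn fun z hz =>
      hf.differentiableAt (Metric.closedBall_mem_nhds_of_mem hz.1), mul_zero]

theorem circleAvg_pow_mul_inv_pow {R : ℝ} (hR : 0 < R) (i j : ℕ) :
    circleAvg 0 R (fun w => w ^ j * (w ^ (i + 1))⁻¹) = if i = j then 1 else 0 := by
  have h : ∀ w ∈ Metric.sphere (0 : ℂ) R, w ^ j * (w ^ (i + 1))⁻¹ =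
      (w - 0) ^ ((j : ℤ) - (i + 1 : ℕ)) := by
    intro w hw
    have hw0 : w ≠ 0 := by
      rintro rfl
      simp at hw
      exact hR.ne hw
    rw [sub_zero, zpow_sub₀ hw0, zpow_natCast, zpow_natCast, div_eq_mul_inv]
  rw [circleAvg_congr hR.le h, circleAvg]
  split_ifs with hij
  · subst hij
    have : ((i : ℤ) - (i + 1 : ℕ)) = -1 := by push_cast; ring
    simp only [this, zpow_neg_one]
    rw [circleIntegral.integral_sub_center_inv 0 hR.ne', inv_mul_cancel₀ Complex.two_pi_I_ne_zero]
  · rw [circleIntegral.integral_sub_zpow_of_ne (by push_cast; omega), mul_zero]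

/-- The residue at a pole of order `n` at `1` only depends on the germ of the numerator. The
induction passes from the numerator `H` to its difference quotient at `1`. -/
theorem circleAvg_div_pow_eq {c₁ c₂ : ℂ} {r₁ r₂ : ℝ} (h₁ : (1 : ℂ) ∈ Metric.ball c₁ r₁)
    (h₂ : (1 : ℂ) ∈ Metric.ball c₂ r₂) (n : ℕ) {H₁ H₂ : ℂ → ℂ}
    (hH₁ : DifferentiableOn ℂ H₁ (Metric.closedBall c₁ r₁))
    (hH₂ : DifferentiableOn ℂ H₂ (Metric.closedBall c₂ r₂)) (heq : H₁ =ᶠ[𝓝 1] H₂) :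
    circleAvg c₁ r₁ (fun w => H₁ w / (1 - w) ^ n) = circleAvg c₂ r₂ fun w => H₂ w / (1 - w) ^ n := by
  have hr : ∀ {c : ℂ} {r : ℝ}, (1 : ℂ) ∈ Metric.ball c r → 0 ≤ r := fun h =>
    (dist_nonneg.trans_lt (Metric.mem_ball.mp h)).le
  rcases n with _ | n
  · simp only [pow_zero, div_one]
    rw [circleAvg_eq_zero (hr h₁) hH₁, circleAvg_eq_zero (hr h₂) hH₂]
  induction n generalizing H₁ H₂ with
  | zero =>
    have h : ∀ {c : ℂ} {r : ℝ}, (1 : ℂ) ∈ Metric.ball c r → ∀ {H : ℂ → ℂ},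
        DifferentiableOn ℂ H (Metric.closedBall c r) →
        circleAvg c r (fun w => H w / (1 - w) ^ (0 + 1)) = -H 1 := by
      intro c r h H hH
      have h1 := hH.circleIntegral_sub_inv_smul h
      have h2 : ∀ w ∈ Metric.sphere c r, H w / (1 - w) ^ (0 + 1) = -1 * ((w - 1)⁻¹ • H w) := by
        intro w _
        rw [zero_add, pow_one, ← neg_sub, div_neg, smul_eq_mul]
        ring
      rw [circleAvg_congr (hr h) h2, circleAvg_const_mul, circleAvg, h1, smul_eq_mul,
        inv_mul_cancel_left₀ Complex.two_pi_I_ne_zero, neg_one_mul]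
    rw [h h₁ hH₁, h h₂ hH₂, heq.eq_of_nhds]
  | succ n ih =>
    have h : ∀ {c : ℂ} {r : ℝ}, (1 : ℂ) ∈ Metric.ball c r → ∀ {H : ℂ → ℂ},
        DifferentiableOn ℂ H (Metric.closedBall c r) →
        circleAvg c r (fun w => H w / (1 - w) ^ (n + 1 + 1)) =
          -1 * circleAvg c r (fun w => dslope H 1 w / (1 - w) ^ (n + 1)) := by
      intro c r h H hH
      have hd : DifferentiableOn ℂ (dslope H 1) (Metric.closedBall c r) :=
        (Complex.differentiableOn_dslope (Metric.closedBall_mem_nhds_of_mem h)).mpr hH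
      have hne : ∀ w ∈ Metric.sphere c r, 1 - w ≠ 0 := fun w hw h0 =>
        notMem_ball_of_mem_sphere hw (sub_eq_zero.mp h0 ▸ h)
      have h2 : ∀ w ∈ Metric.sphere c r, H w / (1 - w) ^ (n + 1 + 1) =
          ((-1) ^ (n + 1 + 1) * H 1) * (w - 1) ^ (-((n + 1 + 1 : ℕ) : ℤ)) +
            -1 * (dslope H 1 w / (1 - w) ^ (n + 1)) := by
        intro w hw
        have e1 := sub_smul_dslope H 1 w
        rw [smul_eq_mul] at e1
        have e2 : H w = H 1 + (w - 1) * dslope H 1 w := by rw [e1]; ring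
        rw [e2, zpow_neg, zpow_natCast]
        have h3 : (w - 1) ^ (n + 1 + 1) = (-1) ^ (n + 1 + 1) * (1 - w) ^ (n + 1 + 1) := by
          rw [← mul_pow]
          congr 1
          ring
        have h4 := hne w hw
        have h5 : ((-1 : ℂ) ^ (n + 1 + 1)) ≠ 0 := pow_ne_zero _ (by norm_num)
        rw [h3, pow_succ (1 - w)]
        generalize (-1 : ℂ) ^ (n + 1 + 1) = s at *
        field_simp
        ring
      have hc1 : ContinuousOn (fun w : ℂ => ((-1) ^ (n + 1 + 1) * H 1) *
          (w - 1) ^ (-((n + 1 + 1 : ℕ) : ℤ))) (Metric.sphere c r) := by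
        refine continuousOn_const.mul (ContinuousOn.zpow₀ (by fun_prop) _ fun w hw => Or.inl ?_)
        rw [← neg_sub]
        exact neg_ne_zero.mpr (hne w hw)
      have hc2 : ContinuousOn (fun w : ℂ => -1 * (dslope H 1 w / (1 - w) ^ (n + 1)))
          (Metric.sphere c r) :=
        continuousOn_const.mul (ContinuousOn.div
          (hd.continuousOn.mono Metric.sphere_subset_closedBall) (by fun_prop)
          fun w hw => pow_ne_zero _ (hne w hw))
      rw [circleAvg_congr (hr h) h2, circleAvg_add (hr h) hc1 hc2, circleAvg_const_mul,
        circleAvg_const_mul]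
      have h5 : circleAvg c r (fun w => (w - 1) ^ (-((n + 1 + 1 : ℕ) : ℤ))) = 0 := by
        rw [circleAvg, circleIntegral.integral_sub_zpow_of_ne (by push_cast; omega), mul_zero]
      rw [h5, mul_zero, zero_add]
    have hd : ∀ {c : ℂ} {r : ℝ}, (1 : ℂ) ∈ Metric.ball c r → ∀ {H : ℂ → ℂ},
        DifferentiableOn ℂ H (Metric.closedBall c r) →
        DifferentiableOn ℂ (dslope H 1) (Metric.closedBall c r) := fun h _ hH =>
      (Complex.differentiableOn_dslope (Metric.closedBall_mem_nhds_of_mem h)).mpr hH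
    rw [h h₁ hH₁, h h₂ hH₂, ih (hd h₁ hH₁) (hd h₂ hH₂) ?_]
    have h1 := heq.eq_of_nhds
    have h2 := heq.deriv_eq
    filter_upwards [heq] with w hw
    rcases eq_or_ne w 1 with rfl | hne
    · rw [dslope_same, dslope_same, h2]
    · rw [dslope_of_ne _ hne, dslope_of_ne _ hne, slope, slope, hw, h1]

end Residue

section Taylor

variable {R : NNReal} {G : ℂ → ℂ}

/-- The Taylor coefficients at `0`, as Cauchy integrals over the circle of radius `R`. -/
def taylorCoeff (G : ℂ → ℂ) (R : NNReal) (l : ℕ) : ℂ := (cauchyPowerSeries G 0 R).coeff l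

/-- The function `w^{-j-1} ∑_{l≤j} p_l w^l` of a coefficient sequence `p`: the part of negative
exponents of `w^{-j-1} ∑_l p_l w^l`, and the coefficient of `z^j` in `∑_l p_l z^l / (w - z)`. -/
def polarPart (p : ℕ → ℂ) (j : ℕ) (w : ℂ) : ℂ :=
  (∑ l ∈ range (j + 1), p l * w ^ l) * (w ^ (j + 1))⁻¹

theorem summable_norm_taylorCoeff (hG : DifferentiableOn ℂ G (Metric.closedBall 0 R)) (hR : 1 < R) :
    Summable fun l => ‖taylorCoeff G R l‖ := by
  have h := hG.hasFPowerSeriesOnBall (zero_lt_one.trans hR)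
  have h1 := (cauchyPowerSeries G 0 R).summable_norm_mul_pow (r := 1)
    (lt_of_lt_of_le (by exact_mod_cast hR) h.r_le)
  simpa [taylorCoeff, FormalMultilinearSeries.norm_apply_eq_norm_coef] using h1

theorem hasSum_taylorCoeff (hG : DifferentiableOn ℂ G (Metric.closedBall 0 R)) (hR : 1 < R) {z : ℂ}
    (hz : ‖z‖ < R) : HasSum (fun l => taylorCoeff G R l * z ^ l) (G z) := by
  have h := (hG.hasFPowerSeriesOnBall (zero_lt_one.trans hR)).hasSum (y := z) (by
    rw [Metric.mem_eball, edist_zero_right, enorm_eq_nnnorm]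
    exact_mod_cast hz)
  rw [zero_add] at h
  refine h.congr_fun fun l => ?_
  rw [FormalMultilinearSeries.apply_eq_pow_smul_coeff, smul_eq_mul, mul_comm, taylorCoeff]

/-- The remainder of the Taylor polynomial is divisible by `w^i` in the ring of holomorphic
functions. -/
theorem exists_taylor_remainder (hG : DifferentiableOn ℂ G (Metric.closedBall 0 R)) (hR : 1 < R)
    (i : ℕ) : ∃ H : ℂ → ℂ, DifferentiableOn ℂ H (Metric.closedBall 0 R) ∧
      ∀ w, G w = ∑ l ∈ range i, taylorCoeff G R l * w ^ l + w ^ i * H w := by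
  have hp := (hG.hasFPowerSeriesOnBall (zero_lt_one.trans hR)).hasFPowerSeriesAt
  have hnhds : Metric.closedBall (0 : ℂ) R ∈ 𝓝 0 :=
    Metric.closedBall_mem_nhds 0 (by exact_mod_cast zero_lt_one.trans hR)
  suffices h : DifferentiableOn ℂ ((Function.swap dslope 0)^[i] G) (Metric.closedBall 0 R) ∧
      ∀ w, G w = ∑ l ∈ range i, taylorCoeff G R l * w ^ l +
        w ^ i * (Function.swap dslope 0)^[i] G w from ⟨_, h⟩
  induction i with
  | zero => exact ⟨hG, fun w => by simp⟩
  | succ i ih =>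
    obtain ⟨ih1, ih2⟩ := ih
    rw [Function.iterate_succ_apply']
    refine ⟨(Complex.differentiableOn_dslope hnhds).mpr ih1, fun w => ?_⟩
    have h0 : taylorCoeff G R i = (Function.swap dslope 0)^[i] G 0 := by
      have h1 := (hp.has_fpower_series_iterate_dslope_fslope i).coeff_zero ![]
      rw [← h1, taylorCoeff]
      have h2 := FormalMultilinearSeries.coeff_iterate_fslope (p := cauchyPowerSeries G 0 R) i 0
      rw [zero_add] at h2
      rw [← h2, FormalMultilinearSeries.coeff]
      congr 1
      exact Subsingleton.elim _ _
    have h1 := sub_smul_dslope ((Function.swap dslope 0)^[i] G) 0 w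
    rw [smul_eq_mul, sub_zero] at h1
    rw [ih2 w, sum_range_succ, h0]
    have : Function.swap dslope 0 ((Function.swap dslope 0)^[i] G) w =
      dslope ((Function.swap dslope 0)^[i] G) 0 w := rfl
    rw [this, pow_succ, mul_assoc, h1]
    ring

theorem norm_polarPart_le {p : ℕ → ℂ} (hp : Summable fun l => ‖p l‖) (j : ℕ) {w : ℂ} (hw : w ≠ 0) :
    ‖polarPart p j w‖ ≤ (∑' l, ‖p l‖) * ‖w‖⁻¹ * max 1 ‖w‖⁻¹ ^ j := by
  have hw' : 0 < ‖w‖ := norm_pos_iff.mpr hw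
  have h1 : ∀ l ∈ range (j + 1), ‖p l * w ^ l * (w ^ (j + 1))⁻¹‖ ≤
      ‖p l‖ * (‖w‖⁻¹ * max 1 ‖w‖⁻¹ ^ j) := by
    intro l hl
    have hl' : l ≤ j := by
      have := mem_range.mp hl
      omega
    rw [mul_assoc, norm_mul]
    refine mul_le_mul_of_nonneg_left ?_ (norm_nonneg _)
    have e1 : w ^ l * (w ^ (j + 1))⁻¹ = w⁻¹ * w⁻¹ ^ (j - l) := by
      obtain ⟨d, rfl⟩ : ∃ d, j = l + d := ⟨j - l, by omega⟩
      rw [add_tsub_cancel_left, pow_succ, pow_add, inv_pow]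
      field_simp
    rw [e1, norm_mul, norm_pow, norm_inv]
    refine mul_le_mul_of_nonneg_left ?_ (by positivity)
    calc ‖w‖⁻¹ ^ (j - l) ≤ max 1 ‖w‖⁻¹ ^ (j - l) := by
          gcongr
          exact le_max_right _ _
      _ ≤ max 1 ‖w‖⁻¹ ^ j := pow_le_pow_right₀ (le_max_left _ _) (by omega)
  rw [polarPart, sum_mul]
  refine (norm_sum_le _ _).trans ((sum_le_sum h1).trans ?_)
  rw [← sum_mul, mul_assoc]
  refine mul_le_mul_of_nonneg_right ?_ (by positivity)
  exact hp.sum_le_tsum _ fun _ _ => norm_nonneg _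

/-- The expansion of `G(z)/(w-z)` in powers of `z`. -/
theorem hasSum_pow_mul_polarPart (hG : DifferentiableOn ℂ G (Metric.closedBall 0 R)) (hR : 1 < R)
    {z w : ℂ} (hz : ‖z‖ ≤ 1) (hzw : ‖z‖ < ‖w‖) :
    HasSum (fun j => z ^ j * polarPart (taylorCoeff G R) j w) (G z / (w - z)) := by
  have hw0 : w ≠ 0 := norm_pos_iff.mp ((norm_nonneg _).trans_lt hzw)
  have hzR : ‖z‖ < R := hz.trans_lt (by exact_mod_cast hR)
  have h1 := hasSum_taylorCoeff hG hR hzR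
  have hratio : ‖z / w‖ < 1 := by
    rw [norm_div, div_lt_one (norm_pos_iff.mpr hw0)]
    exact hzw
  have h2 := (hasSum_geometric_of_norm_lt_one hratio).mul_left w⁻¹
  have hs1 : Summable fun l => ‖taylorCoeff G R l * z ^ l‖ := by
    refine Summable.of_nonneg_of_le (fun _ => norm_nonneg _) (fun l => ?_)
      (summable_norm_taylorCoeff hG hR)
    rw [norm_mul, norm_pow]
    exact mul_le_of_le_one_right (norm_nonneg _) (pow_le_one₀ (norm_nonneg _) hz)
  have hs2 : Summable fun l => ‖w⁻¹ * (z / w) ^ l‖ := by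
    simp_rw [norm_mul, norm_pow]
    exact (summable_geometric_of_lt_one (norm_nonneg _) hratio).mul_left _
  have h3 := hasSum_sum_range_mul_of_summable_norm hs1 hs2
  rw [h1.tsum_eq, h2.tsum_eq] at h3
  have e1 : G z * (w⁻¹ * (1 - z / w)⁻¹) = G z / (w - z) := by
    rw [← mul_inv, mul_sub, mul_one, mul_div_cancel₀ _ hw0, div_eq_mul_inv]
  rw [e1] at h3
  refine h3.congr_fun fun j => ?_
  rw [polarPart, sum_mul, mul_sum]
  refine sum_congr rfl fun l hl => ?_
  obtain ⟨d, rfl⟩ : ∃ d, j = l + d := ⟨j - l, by have := mem_range.mp hl; omega⟩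
  rw [add_tsub_cancel_left, pow_succ, pow_add, pow_add, div_pow]
  field_simp

/-- The integral of `w^{j-i-1} [G]_{≤i}(w) γ(w)/(1-w)^n`, where `[G]_{≤i}` is a Taylor polynomial,
over a circle around `1` which leaves out `0` differs by `δ_{ij}` from the one over a circle around
`0` and `1`, if `γ G = (1-w)^n`: after subtraction of `w^{j-i-1}` the integrand has no pole at `0`.
-/
theorem circleAvg_polarPart (hG : DifferentiableOn ℂ G (Metric.closedBall 0 R)) (hR : 1 < R)
    {c : ℂ} {r : ℝ} (h1 : (1 : ℂ) ∈ Metric.ball c r) (h0 : (0 : ℂ) ∉ Metric.closedBall c r)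
    {γ : ℂ → ℂ} (hγ : DifferentiableOn ℂ γ (Metric.closedBall 0 R))
    (hγ' : DifferentiableOn ℂ γ (Metric.closedBall c r)) (n : ℕ)
    (hγG : ∀ w ∈ Metric.closedBall (0 : ℂ) R, γ w * G w = (1 - w) ^ n) (i j : ℕ) :
    circleAvg c r (fun w => polarPart (taylorCoeff G R) i w * (w ^ j * (γ w / (1 - w) ^ n))) =
      circleAvg 0 R (fun w => polarPart (taylorCoeff G R) i w * (w ^ j * (γ w / (1 - w) ^ n))) -
        if i = j then 1 else 0 := by
  have hr : 0 ≤ r := (dist_nonneg.trans_lt (Metric.mem_ball.mp h1)).le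
  have hR0 : (0 : ℝ) < R := by exact_mod_cast zero_lt_one.trans hR
  have h1R : (1 : ℂ) ∈ Metric.ball (0 : ℂ) R := by
    simpa using hR
  obtain ⟨H, hH, hGH⟩ := exists_taylor_remainder hG hR (i + 1)
  set p := taylorCoeff G R with hp
  set H₁ : ℂ → ℂ := fun w => -(w ^ j * (H w * γ w)) with hH₁
  set H₂ : ℂ → ℂ := fun w => w ^ j * (w ^ (i + 1))⁻¹ *
    ((∑ l ∈ range (i + 1), p l * w ^ l) * γ w - (1 - w) ^ n) with hH₂
  have hd₁ : DifferentiableOn ℂ H₁ (Metric.closedBall 0 R) := by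
    simp only [hH₁]
    exact (DifferentiableOn.mul (by fun_prop) (hH.mul hγ)).neg
  have hw0 : ∀ w ∈ Metric.closedBall c r, w ≠ 0 := fun w hw h => h0 (h ▸ hw)
  have hd₃ : DifferentiableOn ℂ (fun w : ℂ => w ^ j * (w ^ (i + 1))⁻¹) (Metric.closedBall c r) :=
    DifferentiableOn.mul (by fun_prop) (DifferentiableOn.inv (by fun_prop)
      fun w hw => pow_ne_zero _ (hw0 w hw))
  have hd₂ : DifferentiableOn ℂ H₂ (Metric.closedBall c r) := by
    simp only [hH₂]
    exact hd₃.mul ((DifferentiableOn.mul (by fun_prop) hγ').sub (by fun_prop))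
  have heq : ∀ w ∈ Metric.closedBall (0 : ℂ) R, w ≠ 0 → H₁ w = H₂ w := by
    intro w hw hne
    have e1 := hGH w
    have e2 := hγG w hw
    have e3 : (w ^ (i + 1))⁻¹ * w ^ (i + 1) = 1 := inv_mul_cancel₀ (pow_ne_zero _ hne)
    simp only [hH₁, hH₂]
    rw [← e2, e1]
    linear_combination (w ^ j * H w * γ w) * e3
  have heq' : H₁ =ᶠ[𝓝 1] H₂ := by
    filter_upwards [Metric.closedBall_mem_nhds_of_mem h1R, isOpen_ne.mem_nhds one_ne_zero]
      with w hw hne using heq w hw hne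
  have hres := circleAvg_div_pow_eq h1R h1 n hd₁ hd₂ heq'
  have hsplit : ∀ {c : ℂ} {r : ℝ}, 0 ≤ r → (1 : ℂ) ∈ Metric.ball c r →
      (∀ w ∈ Metric.sphere c r, w ≠ 0) → ∀ {F : ℂ → ℂ},
      ContinuousOn F (Metric.sphere c r) → (∀ w ∈ Metric.sphere c r, F w = H₂ w) →
      circleAvg c r (fun w => polarPart p i w * (w ^ j * (γ w / (1 - w) ^ n))) =
        circleAvg c r (fun w => F w / (1 - w) ^ n) +
          circleAvg c r (fun w => w ^ j * (w ^ (i + 1))⁻¹) := by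
    intro c r hr h1 hw0 F hF hFH
    have hne : ∀ w ∈ Metric.sphere c r, 1 - w ≠ 0 := fun w hw h =>
      notMem_ball_of_mem_sphere hw (sub_eq_zero.mp h ▸ h1)
    have hc1 : ContinuousOn (fun w => F w / (1 - w) ^ n) (Metric.sphere c r) :=
      hF.div (by fun_prop) fun w hw => pow_ne_zero _ (hne w hw)
    have hc2 : ContinuousOn (fun w : ℂ => w ^ j * (w ^ (i + 1))⁻¹) (Metric.sphere c r) :=
      ContinuousOn.mul (by fun_prop) (ContinuousOn.inv₀ (by fun_prop)
        fun w hw => pow_ne_zero _ (hw0 w hw))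
    rw [← circleAvg_add hr hc1 hc2]
    refine circleAvg_congr hr fun w hw => ?_
    have := pow_ne_zero n (hne w hw)
    rw [hFH w hw, polarPart]
    simp only [hH₂]
    field_simp
    ring
  rw [hsplit hr h1 (fun w hw => hw0 w (Metric.sphere_subset_closedBall hw))
      (hd₂.continuousOn.mono Metric.sphere_subset_closedBall) (fun w _ => rfl),
    hsplit hR0.le h1R (fun w hw h => by
      rw [h] at hw
      simp at hw
      rw [← hw] at hR0
      exact lt_irrefl _ hR0)
      (hd₁.continuousOn.mono Metric.sphere_subset_closedBall) (fun w hw =>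
        heq w (Metric.sphere_subset_closedBall hw) fun h => by
          rw [h] at hw
          simp at hw
          rw [← hw] at hR0
          exact lt_irrefl _ hR0),
    hres, circleAvg_eq_zero hr hd₃, circleAvg_pow_mul_inv_pow hR0]
  ring

end Taylor

/-! ### The function `g` and the geometry of the contours -/

section Contours

variable {q μ ν : ℝ} {c : ℂ} {r : ℝ} {ζ : ℂ}

/-- The function `1/g`. It is holomorphic in the disc of radius `1/μ` around `0`, the poles of
`g` in it included. -/
def gInv (q μ ν : ℝ) (n t : ℕ) (w : ℂ) : ℂ :=
  (qPochInf w (q : ℂ) / qPochInf (ν * w) (q : ℂ)) ^ n *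
    (qPochInf (ν * w) (q : ℂ) / qPochInf (μ * w) (q : ℂ)) ^ t * qPochInf (ν * w) (q : ℂ)

/-- The numerator `(1-w)^n g(w)` of `g` at its pole `1`. -/
def gNum (q μ ν : ℝ) (n t : ℕ) (w : ℂ) : ℂ :=
  (qPochInf (ν * w) (q : ℂ) / qPochInf (q * w) (q : ℂ)) ^ n *
    (qPochInf (μ * w) (q : ℂ) / qPochInf (ν * w) (q : ℂ)) ^ t * (1 / qPochInf (ν * w) (q : ℂ))

theorem inv_gFun (n t : ℕ) (w : ℂ) : (gFun q μ ν n t w)⁻¹ = gInv q μ ν n t w := by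
  rw [gFun, gInv, mul_inv, mul_inv, ← inv_pow, ← inv_pow, inv_div, inv_div, one_div, inv_inv]

theorem gFun_eq_gNum_div (hq0 : 0 < q) (hq1 : q < 1) (n t : ℕ) (w : ℂ) :
    gFun q μ ν n t w = gNum q μ ν n t w / (1 - w) ^ n := by
  rw [gFun, gNum, qPochInf_eq_one_sub_mul (norm_ofReal_lt_one hq0 hq1) w, mul_comm (1 - w),
    div_mul_eq_div_div, div_pow _ (1 - w)]
  ring

theorem gNum_mul_gInv (hq0 : 0 < q) (hq1 : q < 1) (n t : ℕ) {w : ℂ}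
    (h1 : qPochInf (ν * w) (q : ℂ) ≠ 0) (h2 : qPochInf (q * w) (q : ℂ) ≠ 0)
    (h3 : qPochInf (μ * w) (q : ℂ) ≠ 0) :
    gNum q μ ν n t w * gInv q μ ν n t w = (1 - w) ^ n := by
  rw [gNum, gInv, qPochInf_eq_one_sub_mul (norm_ofReal_lt_one hq0 hq1) w]
  generalize qPochInf (ν * w) (q : ℂ) = a at *
  generalize qPochInf (q * w) (q : ℂ) = b at *
  generalize qPochInf (μ * w) (q : ℂ) = d at *
  simp only [div_pow, mul_pow]
  field_simp

theorem differentiable_qPochInf_mul (hq0 : 0 < q) (hq1 : q < 1) (a : ℂ) :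
    Differentiable ℂ fun w : ℂ => qPochInf (a * w) (q : ℂ) :=
  (differentiable_qPochInf (norm_ofReal_lt_one hq0 hq1)).comp (by fun_prop)

theorem differentiableOn_gNum (hq0 : 0 < q) (hq1 : q < 1) (n t : ℕ) {s : Set ℂ}
    (h1 : ∀ w ∈ s, qPochInf (ν * w) (q : ℂ) ≠ 0) (h2 : ∀ w ∈ s, qPochInf (q * w) (q : ℂ) ≠ 0) :
    DifferentiableOn ℂ (gNum q μ ν n t) s := by
  have hd := fun a => (differentiable_qPochInf_mul hq0 hq1 a).differentiableOn (s := s)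
  unfold gNum
  exact (((hd ν).fun_div (hd q) h2).fun_pow n |>.fun_mul
    (((hd μ).fun_div (hd ν) h1).fun_pow t)).fun_mul
    ((differentiableOn_const (1 : ℂ)).fun_div (hd ν) h1)

theorem differentiableOn_gInv (hq0 : 0 < q) (hq1 : q < 1) (n t : ℕ) {s : Set ℂ}
    (h1 : ∀ w ∈ s, qPochInf (ν * w) (q : ℂ) ≠ 0) (h2 : ∀ w ∈ s, qPochInf (μ * w) (q : ℂ) ≠ 0) :
    DifferentiableOn ℂ (gInv q μ ν n t) s := by
  have hd := fun a => (differentiable_qPochInf_mul hq0 hq1 a).differentiableOn (s := s)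
  have hd1 := (differentiable_qPochInf (norm_ofReal_lt_one hq0 hq1)).differentiableOn (s := s)
  unfold gInv
  exact ((hd1.fun_div (hd ν) h1).fun_pow n |>.fun_mul
    (((hd ν).fun_div (hd μ) h2).fun_pow t)).fun_mul (hd ν)

/-- By convexity, a disc around `1` which leaves out `x ≥ 1` leaves out `[x, ∞)`. -/
theorem notMem_closedBall_of_le (h1 : (1 : ℂ) ∈ Metric.ball c r) {x y : ℝ} (hx1 : 1 ≤ x)
    (hxy : x ≤ y) (hx : (x : ℂ) ∉ Metric.closedBall c r) : (y : ℂ) ∉ Metric.closedBall c r := by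
  intro hy
  refine hx ((convex_closedBall c r).segment_subset (Metric.ball_subset_closedBall h1) hy ?_)
  rcases eq_or_lt_of_le (hx1.trans hxy) with h | h
  · have : x = 1 := le_antisymm (hxy.trans h.symm.le) hx1
    rw [this]
    simpa using left_mem_segment ℝ (1 : ℂ) (y : ℂ)
  · have h' : 0 < y - 1 := by linarith
    refine ⟨1 - (x - 1) / (y - 1), (x - 1) / (y - 1), ?_, div_nonneg (by linarith) h'.le, by ring, ?_⟩
    · rw [sub_nonneg, div_le_one h']
      linarith
    · simp only [Complex.real_smul]
      have : (y : ℂ) - 1 ≠ 0 := by exact_mod_cast h'.ne'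
      push_cast
      field_simp
      ring

/-- There are no poles of `g` other than `1` inside the contour: those of `1/(qw;q)_∞`. -/
theorem qPochInf_q_mul_ne_zero (hq0 : 0 < q) (hq1 : q < 1) (h1 : (1 : ℂ) ∈ Metric.ball c r)
    (hq : (q : ℂ)⁻¹ ∉ Metric.closedBall c r) {w : ℂ} (hw : w ∈ Metric.closedBall c r) :
    qPochInf (q * w) (q : ℂ) ≠ 0 := by
  refine qPochInf_ne_zero (norm_ofReal_lt_one hq0 hq1) fun i h => ?_
  have hwe : w = (((q ^ (i + 1))⁻¹ : ℝ) : ℂ) := by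
    push_cast
    refine eq_inv_of_mul_eq_one_left ?_
    rw [← h]
    ring
  refine notMem_closedBall_of_le h1 (x := q⁻¹) (y := (q ^ (i + 1))⁻¹) ?_ ?_ ?_ (hwe ▸ hw)
  · exact (one_le_inv₀ hq0).mpr hq1.le
  · refine inv_anti₀ (by positivity) ?_
    rw [pow_succ]
    exact mul_le_of_le_one_left hq0.le (pow_le_one₀ hq0.le hq1.le)
  · push_cast
    exact hq

/-- There are no poles of `g` other than `1` inside the contour: those of `1/(νw;q)_∞`. -/
theorem qPochInf_ν_mul_ne_zero (hq0 : 0 < q) (hq1 : q < 1) (hν : 0 ≤ ν) (hν1 : ν < 1)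
    (h1 : (1 : ℂ) ∈ Metric.ball c r)
    (hout : ν ≠ 0 → (ν : ℂ)⁻¹ ∉ Metric.closedBall c r) {w : ℂ} (hw : w ∈ Metric.closedBall c r) :
    qPochInf (ν * w) (q : ℂ) ≠ 0 := by
  refine qPochInf_ne_zero (norm_ofReal_lt_one hq0 hq1) fun i h => ?_
  have hν0 : ν ≠ 0 := by
    rintro rfl
    simp at h
  have hνp : 0 < ν := lt_of_le_of_ne hν hν0.symm
  have hwe : w = (((ν * q ^ i)⁻¹ : ℝ) : ℂ) := by
    push_cast
    refine eq_inv_of_mul_eq_one_left ?_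
    rw [← h]
    ring
  refine notMem_closedBall_of_le h1 (x := ν⁻¹) (y := (ν * q ^ i)⁻¹) ?_ ?_ ?_ (hwe ▸ hw)
  · exact (one_le_inv₀ hνp).mpr hν1.le
  · refine inv_anti₀ (by positivity) ?_
    exact mul_le_of_le_one_right hν (pow_le_one₀ hq0.le hq1.le)
  · push_cast
    exact hout hν0

/-- A circle that separates `1` from `0` meets the interval `(0,1)`. -/
theorem exists_mem_sphere_norm_lt_one (h1 : (1 : ℂ) ∈ Metric.ball c r)
    (h0 : (0 : ℂ) ∉ Metric.closedBall c r) : ∃ w ∈ Metric.sphere c r, ‖w‖ < 1 := by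
  have hcont : ContinuousOn (fun x : ℝ => dist (x : ℂ) c) (Set.Icc 0 1) := by fun_prop
  have hmem : r ∈ Set.Icc (dist ((1 : ℝ) : ℂ) c) (dist ((0 : ℝ) : ℂ) c) := by
    rw [Metric.mem_ball] at h1
    rw [Metric.mem_closedBall, not_le] at h0
    push_cast
    exact ⟨h1.le, h0.le⟩
  obtain ⟨x, hx, hxr⟩ := intermediate_value_Icc' zero_le_one hcont hmem
  refine ⟨x, hxr, ?_⟩
  rw [Complex.norm_real, Real.norm_of_nonneg hx.1]
  refine lt_of_le_of_ne hx.2 fun h => ?_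
  rw [h] at hxr
  rw [Metric.mem_ball] at h1
  push_cast at hxr
  linarith

end Contours

/-! ### The Mellin–Barnes kernel as a separable kernel -/

section MellinBarnes

variable {q μ ν : ℝ} {c : ℂ} {r : ℝ} {ζ : ℂ}

theorem mul_pow_ne_ofReal (hq0 : 0 < q) (hζ : ∀ r : ℝ, 0 ≤ r → ζ ≠ (r : ℂ)) (j : ℕ) :
    ∀ r : ℝ, 0 ≤ r → ζ * (q : ℂ) ^ j ≠ (r : ℂ) := by
  intro r hr h
  have hq : (q : ℂ) ^ j ≠ 0 := pow_ne_zero _ (by exact_mod_cast hq0.ne')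
  refine hζ (r / q ^ j) (by positivity) ?_
  push_cast
  rw [eq_div_iff hq, h]

theorem neg_mem_slitPlane (hζ : ∀ r : ℝ, 0 ≤ r → ζ ≠ (r : ℂ)) : -ζ ∈ Complex.slitPlane := by
  rw [Complex.mem_slitPlane_iff]
  by_contra h
  push Not at h
  obtain ⟨h1, h2⟩ := h
  simp only [Complex.neg_re, Complex.neg_im, neg_eq_zero] at h1 h2
  exact hζ ζ.re (by linarith) (Complex.ext (by simp) (by simpa using h2))

/-- The factor `(q^s)^j` replaces `ζ` by `ζ q^j` in `(-ζ)^s`; this is true for the principal branch,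
because `q^j` is positive. -/
theorem cpow_mul_pow (hq0 : 0 < q) (hζ : -ζ ≠ 0) (s : ℂ) (j : ℕ) :
    (-ζ) ^ s * ((q : ℂ) ^ s) ^ j = (-(ζ * (q : ℂ) ^ j)) ^ s := by
  have hq : (q : ℂ) ≠ 0 := by exact_mod_cast hq0.ne'
  have hqj : 0 < q ^ j := by positivity
  have h1 : -(ζ * (q : ℂ) ^ j) = ((q ^ j : ℝ) : ℂ) * -ζ := by
    push_cast
    ring
  have h2 : -(ζ * (q : ℂ) ^ j) ≠ 0 := by
    rw [h1]
    exact mul_ne_zero (by exact_mod_cast hqj.ne') hζ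
  rw [Complex.cpow_def_of_ne_zero hζ, Complex.cpow_def_of_ne_zero hq,
    Complex.cpow_def_of_ne_zero h2, h1, Complex.log_ofReal_mul hqj hζ, ← Complex.exp_nat_mul,
    ← Complex.exp_add, Real.log_pow, ← Complex.ofReal_log hq0.le]
  congr 1
  push_cast
  ring

theorem mbIntegrand_eq (n t : ℕ) (w w' : ℂ) (y : ℝ) :
    mbIntegrand q μ ν n t ζ w w' (1 / 2 + y * Complex.I) =
      (Real.pi * gFun q μ ν n t w) *
        ((-ζ) ^ (1 / 2 + y * Complex.I) / Real.cosh (Real.pi * y)) *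
        (gInv q μ ν n t ((q : ℂ) ^ (1 / 2 + y * Complex.I) * w) /
          (w' - (q : ℂ) ^ (1 / 2 + y * Complex.I) * w)) := by
  have h1 : Complex.sin (-(Real.pi : ℂ) * (1 / 2 + y * Complex.I)) =
      -(Real.cosh (Real.pi * y) : ℂ) := by
    rw [neg_mul, Complex.sin_neg, show (Real.pi : ℂ) * (1 / 2 + y * Complex.I) =
      (Real.pi * y) * Complex.I + Real.pi / 2 by ring, Complex.sin_add_pi_div_two,
      Complex.cos_mul_I]
    push_cast
    rfl
  rw [mbIntegrand, h1, ← inv_gFun, ← neg_sub w', div_neg, one_div_neg_eq_neg_one_div]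
  ring

/-- The expansion of the Mellin–Barnes kernel. On the line of integration `|q^s w| = √q |w|`, so
that `1 / (g(q^s w) (w' - q^s w))` may be expanded in powers of `q^s w`; each term is an integral
`integral_cpow_div_cosh` with `ζ q^j` in place of `ζ`. -/
theorem mbKernel_expansion (hq0 : 0 < q) {R : NNReal} (hR : 1 < R) (n t : ℕ)
    (hG : DifferentiableOn ℂ (gInv q μ ν n t) (Metric.closedBall 0 R))
    (hζ : ∀ r : ℝ, 0 ≤ r → ζ ≠ (r : ℂ)) {w w' : ℂ} (hw : Real.sqrt q * ‖w‖ < 1)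
    (hww' : Real.sqrt q * ‖w‖ < ‖w'‖) :
    Integrable (fun y : ℝ => mbIntegrand q μ ν n t ζ w w' (1 / 2 + y * Complex.I)) ∧
    HasSum (fun j => -(ζ * (q : ℂ) ^ j / (1 - ζ * (q : ℂ) ^ j)) * (w ^ j * gFun q μ ν n t w) *
      polarPart (taylorCoeff (gInv q μ ν n t) R) j w') (mbKernel q μ ν n t ζ w w') := by
  set v := polarPart (taylorCoeff (gInv q μ ν n t) R) with hv
  set x : ℝ := Real.sqrt q * ‖w‖ with hx
  have hx0 : 0 ≤ x := by positivity
  set z : ℝ → ℂ := fun y => (q : ℂ) ^ (1 / 2 + y * Complex.I) * w with hz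
  have hzn : ∀ y, ‖z y‖ = x := by
    intro y
    rw [hz]
    simp only
    rw [norm_mul, Complex.norm_cpow_eq_rpow_re_of_pos hq0, hx, Real.sqrt_eq_rpow]
    simp
  have hw'0 : w' ≠ 0 := norm_pos_iff.mp (hx0.trans_lt hww')
  have hslit := fun j => integral_cpow_div_cosh (neg_mem_slitPlane (mul_pow_ne_ofReal hq0 hζ j))
  have hζ0 := Complex.slitPlane_ne_zero (neg_mem_slitPlane hζ)
  set W : ℝ → ℂ := fun y => (-ζ) ^ (1 / 2 + y * Complex.I) / Real.cosh (Real.pi * y) with hW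
  have hWint : Integrable W := (integral_cpow_div_cosh (neg_mem_slitPlane hζ)).1
  set κ : ℂ := Real.pi * gFun q μ ν n t w with hκ
  set F : ℕ → ℝ → ℂ := fun j y => κ * W y * (z y ^ j * v j w') with hF
  have hF' : ∀ j y, F j y = (κ * (w ^ j * v j w')) *
      ((-(ζ * (q : ℂ) ^ j)) ^ (1 / 2 + y * Complex.I) / Real.cosh (Real.pi * y)) := by
    intro j y
    rw [← cpow_mul_pow hq0 hζ0]
    simp only [hF, hW, hz]
    ring
  have hFint : ∀ j, Integrable (F j) := by
    intro j
    rw [show F j = _ from funext (hF' j)]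
    exact (hslit j).1.const_mul _
  have hFnorm : ∀ j y, ‖F j y‖ = (‖κ‖ * (x ^ j * ‖v j w'‖)) * ‖W y‖ := by
    intro j y
    simp only [hF]
    rw [norm_mul (κ * W y), norm_mul κ, norm_mul (z y ^ j), norm_pow, hzn]
    ring
  have hsumv : Summable fun j => x ^ j * ‖v j w'‖ := by
    have hm : x * max 1 ‖w'‖⁻¹ < 1 := by
      rw [mul_max_of_nonneg _ _ hx0, mul_one, max_lt_iff]
      refine ⟨hw, ?_⟩
      rw [← div_eq_mul_inv, div_lt_one (norm_pos_iff.mpr hw'0)]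
      exact hww'
    refine Summable.of_nonneg_of_le (fun j => by positivity) (fun j => ?_)
      ((summable_geometric_of_lt_one (by positivity) hm).mul_left
        ((∑' l, ‖taylorCoeff (gInv q μ ν n t) R l‖) * ‖w'‖⁻¹))
    refine (mul_le_mul_of_nonneg_left (norm_polarPart_le (summable_norm_taylorCoeff hG hR) j hw'0)
      (by positivity)).trans (le_of_eq ?_)
    rw [mul_pow]
    ring
  have hsum : ∀ y, HasSum (fun j => F j y)
      (mbIntegrand q μ ν n t ζ w w' (1 / 2 + y * Complex.I)) := by
    intro y
    rw [mbIntegrand_eq]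
    exact (hasSum_pow_mul_polarPart hG hR (z := z y) (by rw [hzn]; exact hw.le)
      (by rw [hzn]; exact hww')).mul_left _
  constructor
  · refine Integrable.mono' (hWint.norm.const_mul (‖κ‖ * ∑' j, x ^ j * ‖v j w'‖))
      (aestronglyMeasurable_of_tendsto_ae atTop (f := fun M y => ∑ j ∈ range M, F j y)
        (fun M => (integrable_finsetSum _ fun j _ => hFint j).aestronglyMeasurable)
        (Eventually.of_forall fun y => (hsum y).tendsto_sum_nat)) (Eventually.of_forall fun y => ?_)
    have hs : Summable fun j => ‖F j y‖ := by
      simp_rw [hFnorm]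
      exact (hsumv.mul_left _).mul_right _
    rw [← (hsum y).tsum_eq]
    refine (norm_tsum_le_tsum_norm hs).trans (le_of_eq ?_)
    simp_rw [hFnorm]
    rw [tsum_mul_right, tsum_mul_left]
  · have hsI : Summable fun j => ∫ y, ‖F j y‖ := by
      simp_rw [hFnorm, integral_const_mul]
      exact (hsumv.mul_left _).mul_right _
    have h := hasSum_integral_of_summable_integral_norm hFint hsI
    simp_rw [fun y => (hsum y).tsum_eq] at h
    have h2 := h.mul_left (1 / (2 * (Real.pi : ℂ)))
    have e1 : mbKernel q μ ν n t ζ w w' = 1 / (2 * (Real.pi : ℂ)) *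
        ∫ y : ℝ, mbIntegrand q μ ν n t ζ w w' (1 / 2 + y * Complex.I) := by
      rw [mbKernel, integral_mul_const]
      have := Complex.I_ne_zero
      have hpi : (Real.pi : ℂ) ≠ 0 := by exact_mod_cast Real.pi_ne_zero
      field_simp
    rw [e1]
    refine h2.congr_fun fun j => ?_
    simp_rw [hF']
    rw [integral_const_mul, (hslit j).2, hκ]
    have hpi : (Real.pi : ℂ) ≠ 0 := by exact_mod_cast Real.pi_ne_zero
    have h1 : 1 - ζ * (q : ℂ) ^ j ≠ 0 := fun h =>
      mul_pow_ne_ofReal hq0 hζ j 1 zero_le_one (by push_cast; linear_combination -h)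
    rw [← sub_eq_add_neg]
    field_simp

end MellinBarnes

/-! ### From the Cauchy determinant to the Mellin–Barnes determinant -/

section Comparison

variable {q μ ν : ℝ} {c : ℂ} {r : ℝ} {ζ : ℂ} {N : ℕ}

theorem fredholmDet_transpose (h : ℂ → ℂ) (k : ℂ → ℂ → ℂ) (c : ℂ) (r : ℝ) :
    fredholmDet (fun w w' => h w * k w w') c r = fredholmDet (fun w w' => h w * k w' w) c r := by
  refine tsum_congr fun m => ?_
  rw [fredholmTerm_eq_torusAvg, fredholmTerm_eq_torusAvg]
  congr 2
  funext w
  have e : ∀ k' : ℂ → ℂ → ℂ, Matrix.det (Matrix.of fun a b => h (w a) * k' (w a) (w b)) =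
      (∏ a, h (w a)) * Matrix.det (Matrix.of fun a b => k' (w a) (w b)) := fun k' =>
    Matrix.det_mul_column (fun a => h (w a)) (Matrix.of fun a b => k' (w a) (w b))
  rw [e, e fun z z' => k z' z, ← Matrix.det_transpose (Matrix.of fun a b => k (w a) (w b))]
  rfl

theorem continuousOn_polarPart (p : ℕ → ℂ) (j : ℕ) {s : Set ℂ} (hs : (0 : ℂ) ∉ s) :
    ContinuousOn (polarPart p j) s := by
  unfold polarPart
  refine ContinuousOn.mul (by fun_prop) (ContinuousOn.inv₀ (by fun_prop) fun w hw => ?_)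
  exact pow_ne_zero _ fun h => hs (h ▸ hw)

/-- A kernel `∑_j d_j w^j f(w) v_j(w')` with `d_j = O(q^j)`, where `v_j` are the polar parts of a
power series, has a Fredholm determinant, the limit of the determinants of its finite sections. -/
theorem hasFredholmDet_of_hasSum_polarPart (hq0 : 0 < q) (hr : 0 ≤ r)
    (h0 : (0 : ℂ) ∉ Metric.sphere c r) {f : ℂ → ℂ} (hf : ContinuousOn f (Metric.sphere c r))
    {d : ℕ → ℂ} {D : ℝ} (hD : 0 ≤ D) (hd : ∀ j, ‖d j‖ ≤ D * q ^ j) {p : ℕ → ℂ}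
    (hp : Summable fun l => ‖p l‖) {ρ : ℝ} (hρ0 : 0 < ρ) (hρ1 : ρ < 1)
    (hρ : ∀ w ∈ Metric.sphere c r, ∀ w' ∈ Metric.sphere c r, q * ‖w‖ * max 1 ‖w'‖⁻¹ ≤ ρ)
    {K : ℂ → ℂ → ℂ} (hK : ∀ w ∈ Metric.sphere c r, ∀ w' ∈ Metric.sphere c r,
      HasSum (fun j => d j * (w ^ j * f w) * polarPart p j w') (K w w')) :
    HasFredholmDet K c r ∧ Tendsto
      (fun M => (1 + gramMatrix (fun j w => d j * (w ^ j * f w)) (polarPart p) c r M).det)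
      atTop (𝓝 (fredholmDet K c r)) := by
  obtain ⟨B, hB⟩ := (isCompact_sphere c r).exists_bound_of_continuousOn hf
  obtain ⟨m, hm⟩ := (isCompact_sphere c r).exists_bound_of_continuousOn
    (f := fun w : ℂ => w⁻¹) (continuousOn_id.inv₀ fun w hw h => h0 (h ▸ hw))
  set P := ∑' l, ‖p l‖ with hP
  have hP0 : 0 ≤ P := tsum_nonneg fun _ => norm_nonneg _
  refine hasFredholmDet_separable (C := D * |B| * P * |m|) (θ := Real.sqrt ρ) hr
    (u := fun j w => d j * (w ^ j * f w))
    (fun j => continuousOn_const.mul (ContinuousOn.mul (by fun_prop) hf))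
    (fun j => continuousOn_polarPart p j h0) (by positivity) (Real.sqrt_pos.mpr hρ0)
    ((Real.sqrt_lt' one_pos).mpr (by rwa [one_pow])) (fun j w hw w' hw' => ?_) hK
  have hw'0 : w' ≠ 0 := fun h => h0 (h ▸ hw')
  have h1 := norm_polarPart_le hp j hw'0
  rw [← hP] at h1
  have h2 : ‖w'‖⁻¹ ≤ |m| := by
    rw [← norm_inv]
    exact (hm w' hw').trans (le_abs_self m)
  have h3 : ‖f w‖ ≤ |B| := (hB w hw).trans (le_abs_self B)
  rw [← mul_pow, Real.mul_self_sqrt hρ0.le, norm_mul (d j), norm_mul (w ^ j), norm_pow]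
  calc ‖d j‖ * (‖w‖ ^ j * ‖f w‖) * ‖polarPart p j w'‖
      ≤ D * q ^ j * (‖w‖ ^ j * |B|) * (P * |m| * max 1 ‖w'‖⁻¹ ^ j) := by
        refine mul_le_mul (mul_le_mul (hd j) (by gcongr) (by positivity) (by positivity))
          (h1.trans (by gcongr)) (norm_nonneg _) (by positivity)
    _ = D * |B| * P * |m| * (q * ‖w‖ * max 1 ‖w'‖⁻¹) ^ j := by
        rw [mul_pow, mul_pow]
        ring
    _ ≤ D * |B| * P * |m| * ρ ^ j := by
        gcongr
        exact hρ w hw w' hw'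

/-- If the averages on the two circles differ by `δ_{ij}`, as they do by `circleAvg_polarPart`, the
finite sections on them differ column by column by the factors `1 - x_j`: `δ_{ij} (1 - x_j) - x_j
(a_{ij} - δ_{ij}) = δ_{ij} - x_j a_{ij}`. -/
theorem det_one_add_gramMatrix_mul {f : ℂ → ℂ} {p : ℕ → ℂ} {c₁ c₂ : ℂ} {r₁ r₂ : ℝ} {x : ℕ → ℂ}
    (hx : ∀ j, 1 - x j ≠ 0)
    (h : ∀ i j, circleAvg c₁ r₁ (fun w => polarPart p i w * (w ^ j * f w)) =
      circleAvg c₂ r₂ (fun w => polarPart p i w * (w ^ j * f w)) - if i = j then 1 else 0) (M : ℕ) :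
    (1 + gramMatrix (fun j w => -(x j / (1 - x j)) * (w ^ j * f w)) (polarPart p) c₁ r₁ M).det *
        ∏ j ∈ range M, (1 - x j) =
      (1 + gramMatrix (fun j w => -x j * (w ^ j * f w)) (polarPart p) c₂ r₂ M).det := by
  rw [← Fin.prod_univ_eq_prod_range (fun j => 1 - x j), ← Matrix.det_diagonal, ← Matrix.det_mul]
  congr 1
  ext i j
  have e : ∀ (a : ℂ) (i j : ℕ) (c : ℂ) (r : ℝ),
      circleAvg c r (fun w => polarPart p i w * (a * (w ^ j * f w))) =
        a * circleAvg c r (fun w => polarPart p i w * (w ^ j * f w)) := fun a i j c r => by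
    rw [← circleAvg_const_mul]
    congr 1
    funext w
    ring
  rw [Matrix.mul_diagonal, Matrix.add_apply, Matrix.add_apply, gramMatrix, gramMatrix,
    Matrix.of_apply, Matrix.of_apply, e, e, h, Matrix.one_apply]
  have := hx j
  simp only [← Fin.ext_iff]
  split_ifs
  · field_simp
    ring
  · field_simp
    ring

/-- The large circle has to enclose `1`, but none of the points `q^{-i-1}` and `q^{-i}/μ`. -/
theorem exists_radius (hq0 : 0 < q) (hq1 : q < 1) (hμ : μ < 1) :
    ∃ R : NNReal, 1 < R ∧ q * R < 1 ∧ μ * R < 1 := by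
  set m := max q μ with hm
  have hm0 : 0 < m := hq0.trans_le (le_max_left _ _)
  have hm1 : m < 1 := max_lt hq1 hμ
  have h : m * (2 / (1 + m)) < 1 := by
    rw [← mul_div_assoc, div_lt_one (by linarith)]
    linarith
  have h2 : 0 ≤ 2 / (1 + m) := by positivity
  obtain ⟨R, hR⟩ : ∃ R : NNReal, (R : ℝ) = 2 / (1 + m) :=
    ⟨Real.toNNReal (2 / (1 + m)), Real.coe_toNNReal _ h2⟩
  refine ⟨R, ?_⟩
  rw [← NNReal.coe_lt_coe, hR, NNReal.coe_one, one_lt_div (by linarith)]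
  exact ⟨by linarith, (mul_le_mul_of_nonneg_right (le_max_left _ _) h2).trans_lt h,
    (mul_le_mul_of_nonneg_right (le_max_right _ _) h2).trans_lt h⟩

theorem norm_ofReal_mul_lt_one {a : ℝ} (ha : 0 ≤ a) {R : NNReal} (haR : a * R < 1) {w : ℂ}
    (hw : w ∈ Metric.closedBall (0 : ℂ) R) : ‖(a : ℂ) * w‖ < 1 := by
  rw [norm_mul, Complex.norm_real, Real.norm_of_nonneg ha]
  exact (mul_le_mul_of_nonneg_left (mem_closedBall_zero_iff.mp hw) ha).trans_lt haR

/-- The circle of radius `R ∈ (1, min(1/q, 1/μ))` meets neither poles nor zeros of `g`. -/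
theorem notMem_gSingular (hq0 : 0 < q) (hq1 : q < 1) (hν : 0 ≤ ν) (hνμ : ν ≤ μ)
    {R : NNReal} (hR : 1 < R) (hqR : q * R < 1) (hμR : μ * R < 1) {w : ℂ}
    (hw : w ∈ Metric.sphere (0 : ℂ) R) : w ∉ gSingular q μ ν := by
  have hw' := Metric.sphere_subset_closedBall hw
  have hpow : ∀ (z : ℂ) (i : ℕ), ‖z‖ < 1 → z * (q : ℂ) ^ i ≠ 1 := by
    intro z i hz h
    have h1 := congrArg norm h
    rw [norm_mul, norm_pow, norm_one] at h1
    have h2 : ‖(q : ℂ)‖ ^ i ≤ 1 := pow_le_one₀ (norm_nonneg _) (norm_ofReal_lt_one hq0 hq1).le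
    nlinarith [norm_nonneg z]
  rintro ⟨i, h | h | h⟩
  · rcases i with _ | i
    · rw [pow_zero, mul_one] at h
      rw [h, mem_sphere_zero_iff_norm, norm_one] at hw
      have : (1 : ℝ) < R := by exact_mod_cast hR
      linarith
    · refine hpow _ i (norm_ofReal_mul_lt_one hq0.le hqR hw') ?_
      rw [← h]
      ring
  · have hνR : ν * R < 1 := (mul_le_mul_of_nonneg_right hνμ R.coe_nonneg).trans_lt hμR
    exact hpow _ i (norm_ofReal_mul_lt_one hν hνR hw') h
  · exact hpow _ i (norm_ofReal_mul_lt_one (hν.trans hνμ) hμR hw') h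

/-- The reciprocals of the numbers `1 - ζ q^j` are bounded, because these tend to `1`. -/
theorem exists_norm_mul_pow_div_le (hq0 : 0 < q) (hq1 : q < 1) (ζ : ℂ) :
    ∃ D, 0 ≤ D ∧ ∀ j : ℕ, ‖-(ζ * (q : ℂ) ^ j / (1 - ζ * (q : ℂ) ^ j))‖ ≤ D * q ^ j := by
  have h1 : Tendsto (fun j : ℕ => (1 - ζ * (q : ℂ) ^ j)⁻¹) atTop (𝓝 (1 - ζ * 0)⁻¹) :=
    ((tendsto_pow_atTop_nhds_zero_of_norm_lt_one (norm_ofReal_lt_one hq0 hq1)).const_mul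
      ζ |>.const_sub 1).inv₀ (by simp)
  obtain ⟨B, hB⟩ := (Metric.isBounded_range_of_tendsto _ h1).exists_norm_le
  have hB0 : 0 ≤ B := (norm_nonneg _).trans (hB _ ⟨0, rfl⟩)
  refine ⟨‖ζ‖ * B, by positivity, fun j => ?_⟩
  rw [norm_neg, div_eq_mul_inv, norm_mul, norm_mul, norm_pow, Complex.norm_real,
    Real.norm_of_nonneg hq0.le]
  have := hB _ ⟨j, rfl⟩
  calc ‖ζ‖ * q ^ j * ‖(1 - ζ * (q : ℂ) ^ j)⁻¹‖ ≤ ‖ζ‖ * q ^ j * B := by gcongr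
    _ = ‖ζ‖ * B * q ^ j := by ring

/-- The Mellin–Barnes determinant: its finite sections are those of the Cauchy type determinant on a
large circle, divided by `(ζ;q)_M`. -/
theorem hasFredholmDet_mbKernel (hq0 : 0 < q) (hq1 : q < 1) (hν : 0 ≤ ν) (hνμ : ν ≤ μ)
    (hμ : μ < 1) (t n : ℕ) (hn : 1 ≤ n) (hnN : n ≤ N) (hζ : ∀ r : ℝ, 0 ≤ r → ζ ≠ (r : ℂ))
    (h1 : (1 : ℂ) ∈ Metric.ball c r) (h0 : (0 : ℂ) ∉ Metric.closedBall c r)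
    (hq : (q : ℂ)⁻¹ ∉ Metric.closedBall c r) (hout : ν ≠ 0 → (ν : ℂ)⁻¹ ∉ Metric.closedBall c r)
    (hsmall : ∀ w ∈ Metric.sphere c r, ∀ w' ∈ Metric.sphere c r, Real.sqrt q * ‖w‖ < ‖w'‖) :
    (∀ w ∈ Metric.sphere c r, ∀ w' ∈ Metric.sphere c r,
      Integrable (fun y : ℝ => mbIntegrand q μ ν n t ζ w w' (1 / 2 + y * Complex.I))) ∧
    HasFredholmDet (mbKernel q μ ν n t ζ) c r ∧
    ∫ x : Config N, eqObservable q ζ (x ⟨n - 1, sub_one_lt_of_le hn hnN⟩ + n) ∂(tasepLaw q μ ν N t) =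
      fredholmDet (mbKernel q μ ν n t ζ) c r := by
  have hqn := norm_ofReal_lt_one hq0 hq1
  have hr : 0 ≤ r := (dist_nonneg.trans_lt (Metric.mem_ball.mp h1)).le
  have h0' : (0 : ℂ) ∉ Metric.sphere c r := fun h => h0 (Metric.sphere_subset_closedBall h)
  obtain ⟨R, hR, hqR, hμR⟩ := exists_radius hq0 hq1 hμ
  have hνR : ν * R < 1 := (mul_le_mul_of_nonneg_right hνμ R.coe_nonneg).trans_lt hμR
  have hR1 : (1 : ℝ) < R := by exact_mod_cast hR
  have hR0 : (0 : ℝ) < R := zero_lt_one.trans hR1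
  have hne : ∀ a : ℝ, 0 ≤ a → a * R < 1 → ∀ w ∈ Metric.closedBall (0 : ℂ) R,
      qPochInf (a * w) (q : ℂ) ≠ 0 := fun a ha haR w hw =>
    qPochInf_ne_zero_of_norm_lt hqn (norm_ofReal_mul_lt_one ha haR hw)
  have hG : DifferentiableOn ℂ (gInv q μ ν n t) (Metric.closedBall 0 R) :=
    differentiableOn_gInv hq0 hq1 n t (hne ν hν hνR) (hne μ (hν.trans hνμ) hμR)
  have hγ : DifferentiableOn ℂ (gNum q μ ν n t) (Metric.closedBall 0 R) :=
    differentiableOn_gNum hq0 hq1 n t (hne ν hν hνR) (hne q hq0.le hqR)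
  have hγ' : DifferentiableOn ℂ (gNum q μ ν n t) (Metric.closedBall c r) :=
    differentiableOn_gNum hq0 hq1 n t
      (fun w hw => qPochInf_ν_mul_ne_zero hq0 hq1 hν (hνμ.trans_lt hμ) h1 hout hw)
      fun w hw => qPochInf_q_mul_ne_zero hq0 hq1 h1 hq hw
  set p := taylorCoeff (gInv q μ ν n t) R with hp
  have hps : Summable fun l => ‖p l‖ := summable_norm_taylorCoeff hG hR
  have hgcont : ∀ (c : ℂ) (r : ℝ), (1 : ℂ) ∉ Metric.sphere c r →
      DifferentiableOn ℂ (gNum q μ ν n t) (Metric.closedBall c r) →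
      ContinuousOn (gFun q μ ν n t) (Metric.sphere c r) := by
    intro c r h1 h
    rw [show gFun q μ ν n t = fun w => gNum q μ ν n t w / (1 - w) ^ n from
      funext (gFun_eq_gNum_div hq0 hq1 n t)]
    refine (h.continuousOn.mono Metric.sphere_subset_closedBall).div (by fun_prop) fun w hw => ?_
    exact pow_ne_zero _ (sub_ne_zero.mpr fun h => h1 (h ▸ hw))
  have h1R : (1 : ℂ) ∈ Metric.ball (0 : ℂ) R := by simpa using hR1
  have h1s : ∀ {c : ℂ} {r : ℝ}, (1 : ℂ) ∈ Metric.ball c r → (1 : ℂ) ∉ Metric.sphere c r :=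
    fun h h' => notMem_ball_of_mem_sphere h' h
  -- with `w' = w₀`, the smallness condition bounds `√q |w|` by `1` on the whole circle
  obtain ⟨w₀, hw₀, hw₀'⟩ := exists_mem_sphere_norm_lt_one h1 h0
  have hsq0 : 0 < Real.sqrt q := Real.sqrt_pos.mpr hq0
  have hsq1 : Real.sqrt q < 1 := (Real.sqrt_lt' one_pos).mpr (by rwa [one_pow])
  have hw1 : ∀ w ∈ Metric.sphere c r, Real.sqrt q * ‖w‖ < 1 := fun w hw =>
    (hsmall w hw w₀ hw₀).trans hw₀'
  have hmb := fun w hw w' hw' =>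
    mbKernel_expansion hq0 hR n t hG hζ (hw1 w hw) (hsmall w hw w' hw')
  refine ⟨fun w hw w' hw' => (hmb w hw w' hw').1, ?_⟩
  obtain ⟨D, hD, hd⟩ := exists_norm_mul_pow_div_le hq0 hq1 ζ
  obtain ⟨hFK, hlim⟩ := hasFredholmDet_of_hasSum_polarPart hq0 hr h0' (hgcont c r (h1s h1) hγ')
    hD hd hps hsq0 hsq1 (fun w hw w' hw' => by
      have hw'0 : 0 < ‖w'‖ := norm_pos_iff.mpr fun h => h0' (h ▸ hw')
      have h2 : q * ‖w‖ * max 1 ‖w'‖⁻¹ =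
          Real.sqrt q * (Real.sqrt q * ‖w‖ * max 1 ‖w'‖⁻¹) := by
        nth_rewrite 1 [← Real.mul_self_sqrt hq0.le]
        ring
      rw [h2]
      refine mul_le_of_le_one_right hsq0.le ?_
      rw [mul_max_of_nonneg _ _ (by positivity), mul_one, ← div_eq_mul_inv]
      exact max_le (hw1 w hw).le ((div_le_one hw'0).mpr (hsmall w hw w' hw').le))
    fun w hw w' hw' => (hmb w hw w' hw').2
  refine ⟨hFK, ?_⟩
  -- transposition turns the denominator `q w' - w` into `q w - w'`, and then the Cauchy type kernel on the
  -- circle of radius `R` has an expansion in the same functions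
  obtain ⟨-, hlimR⟩ := hasFredholmDet_of_hasSum_polarPart (c := 0) (r := R)
    (f := gFun q μ ν n t) (d := fun j => -(ζ * (q : ℂ) ^ j)) (D := ‖ζ‖) (p := p) (ρ := q * R)
    (K := fun w w' => ζ * gRatio μ ν n t w * (q * w - w')⁻¹) hq0 hR0.le
    (by simpa using hR0.ne) (hgcont 0 R (h1s h1R) hγ) (norm_nonneg _)
    (fun j => by
      rw [norm_neg, norm_mul, norm_pow, Complex.norm_real, Real.norm_of_nonneg hq0.le])
    hps (by positivity) hqR
    (fun w hw w' hw' => by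
      rw [mem_sphere_zero_iff_norm.mp hw, mem_sphere_zero_iff_norm.mp hw',
        max_eq_left (inv_le_one_of_one_le₀ hR1.le), mul_one])
    (fun w hw w' hw' => by
      have hqw := norm_ofReal_mul_lt_one hq0.le hqR (Metric.sphere_subset_closedBall hw)
      have h2 := (hasSum_pow_mul_polarPart hG hR (z := q * w) (w := w') hqw.le (hqw.trans (by
        rwa [mem_sphere_zero_iff_norm.mp hw']))).mul_left (-(ζ * gFun q μ ν n t w))
      have e : ζ * gRatio μ ν n t w * (q * w - w')⁻¹ =
          -(ζ * gFun q μ ν n t w) * (gInv q μ ν n t (q * w) / (w' - q * w)) := by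
        rw [← gFun_div_gFun hq0 hq1 n t (notMem_gSingular hq0 hq1 hν hνμ hR hqR hμR hw),
          ← inv_gFun, ← neg_sub w', inv_neg]
        ring
      rw [e]
      refine h2.congr_fun fun j => ?_
      rw [mul_pow]
      ring)
  have hL := (hasFredholmDet_gRatio hq0 hq1 hν hνμ hμ (Metric.mem_ball_self hR0) h1R (fun hν0 h => by
    rw [mem_closedBall_zero_iff, norm_inv, Complex.norm_real, Real.norm_of_nonneg hν] at h
    have hνp : 0 < ν := lt_of_le_of_ne hν hν0.symm
    have := (inv_le_iff_one_le_mul₀' hνp).mp h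
    linarith) t n hn hnN hζ).2
  have hT : fredholmDet (fun w w' => ζ * gRatio μ ν n t w * (q * w - w')⁻¹) 0 R =
      fredholmDet (fun w w' => ζ * (gRatio μ ν n t w / (q * w' - w))) 0 R := by
    rw [fredholmDet_transpose (fun w => ζ * gRatio μ ν n t w) fun w w' => (q * w - w')⁻¹]
    simp only [div_eq_mul_inv, mul_assoc]
  rw [hT, hL] at hlimR
  have hx : ∀ j : ℕ, 1 - ζ * (q : ℂ) ^ j ≠ 0 := fun j h =>
    mul_pow_ne_ofReal hq0 hζ j 1 zero_le_one (by push_cast; linear_combination -h)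
  have hsec := det_one_add_gramMatrix_mul (f := gFun q μ ν n t) (p := p) (c₁ := c) (r₁ := r)
    (c₂ := 0) (r₂ := R) (x := fun j => ζ * (q : ℂ) ^ j) hx fun i j => by
      simp only [gFun_eq_gNum_div hq0 hq1]
      exact circleAvg_polarPart hG hR h1 h0 hγ hγ' n (fun w hw =>
        gNum_mul_gInv hq0 hq1 n t (hne ν hν hνR w hw) (hne q hq0.le hqR w hw)
          (hne μ (hν.trans hνμ) hμR w hw)) i j
  -- multiplied by `(ζ;q)_M`, the finite sections on both circles have the same determinants
  have hprod := hlim.mul (tendsto_qPoch hqn ζ)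
  have heq := tendsto_nhds_unique (hprod.congr hsec) hlimR
  rw [mul_comm] at heq
  exact (mul_left_cancel₀ (qPochInf_ne_zero_of_forall hq0 hq1 hζ) heq).symm

end Comparison

end

theorem theorem1p7 (q μ ν : ℝ) (hq0 : 0 < q) (hq1 : q < 1)
    (hν : 0 ≤ ν) (hνμ : ν ≤ μ) (hμ : μ < 1)
    (N n t : ℕ) (hn : 1 ≤ n) (hnN : n ≤ N)
    (ζ : ℂ) (hζ : ∀ r : ℝ, 0 ≤ r → ζ ≠ (r : ℂ)) :
    -- the law of the process is a probability measure and the expectation exists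
    IsProbabilityMeasure (tasepLaw q μ ν N t) ∧
    Integrable (fun x : Config N => eqObservable q ζ (x ⟨n - 1, by omega⟩ + n))
      (tasepLaw q μ ν N t) ∧
    -- the Mellin–Barnes formula, on every sufficiently small circle around `1`
    (∀ (c : ℂ) (r : ℝ), 1 ∈ Metric.ball c r → 0 ∉ Metric.closedBall c r →
      (q : ℂ)⁻¹ ∉ Metric.closedBall c r → (ν ≠ 0 → (ν : ℂ)⁻¹ ∉ Metric.closedBall c r) →
      (∀ w ∈ Metric.sphere c r, ∀ w' ∈ Metric.sphere c r, Real.sqrt q * ‖w‖ < ‖w'‖) →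
      (∀ w ∈ Metric.sphere c r, ∀ w' ∈ Metric.sphere c r,
        Integrable (fun y : ℝ => mbIntegrand q μ ν n t ζ w w' (1 / 2 + y * Complex.I))) ∧
      HasFredholmDet (mbKernel q μ ν n t ζ) c r ∧
      ∫ x : Config N, eqObservable q ζ (x ⟨n - 1, by omega⟩ + n) ∂(tasepLaw q μ ν N t) =
        fredholmDet (mbKernel q μ ν n t ζ) c r) ∧
    -- the Cauchy type formula, on every circle around `0` and `1` that leaves out `1/ν`
    (∀ (c : ℂ) (r : ℝ), 0 ∈ Metric.ball c r → 1 ∈ Metric.ball c r →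
      (ν ≠ 0 → (ν : ℂ)⁻¹ ∉ Metric.closedBall c r) →
      HasFredholmDet (fun w w' => ζ * cauchyKernel q μ ν n t w w') c r ∧
      ∫ x : Config N, eqObservable q ζ (x ⟨n - 1, by omega⟩ + n) ∂(tasepLaw q μ ν N t) =
        fredholmDet (fun w w' => ζ * cauchyKernel q μ ν n t w w') c r /
          qPochInf ζ (q : ℂ)) := by
  refine ⟨isProbabilityMeasure_tasepLaw hq0 hq1 hν hνμ hμ t,
    integrable_eqObservable hq0 hq1 hν hνμ hμ hζ t n hn hnN,
    fun c r h1 h0 hq hout hsmall =>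
      hasFredholmDet_mbKernel hq0 hq1 hν hνμ hμ t n hn hnN hζ h1 h0 hq hout hsmall,
    fun c r h0 h1 hout => ?_⟩
  obtain ⟨h2, h3⟩ := hasFredholmDet_cauchyKernel hq0 hq1 hν hνμ hμ h0 h1 hout t n hn hnN hζ
  refine ⟨h2, ?_⟩
  rw [eq_div_iff (qPochInf_ne_zero_of_forall hq0 hq1 hζ), h3, mul_comm]
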